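/- For every integer $m\ge 1$ let $k=2^m-1$. For $r\ge 0$ let $\mathrm{RM}(r,m)\subseteq\mathbb F_2^{2^m}$ be the Reed–Muller code of evaluations on $\mathbb F_2^m$ of all polynomials in $\mathbb F_2[x_1,\dots,x_m]$ of total degree at most $r$. For an $\mathbb F_2$-linear bijection $\varphi:\mathbb F_{2^m}\to\mathbb F_2^m$ and a generator $\alpha$ of $\mathbb F_{2^m}^*$, let $\mathrm{RM}^*(r,m)\subseteq\mathbb F_2^k$ be the punctured code obtained by omitting the coordinate of the point $0$ and ordering the other points as $\varphi(\alpha^0),\varphi(\alpha^1),\dots,\varphi(\alpha^{k-1})$. There are a constant $\varepsilon>0$, a polynomial $P$, a function $d=d(k)$ with $d(k)\ge \varepsilon\sqrt k$, and a family of binary double-circulant codes $D_k\subseteq\mathbb F_2^{2k}$, $k=2^m-1$, $m\ge 1$, such that for every such $k$: 1. $D_k=\{(u,A_ku): u\in\mathbb F_2^k\}$, where $A_k$ is the circulant $k\times k$ matrix whose first column is the coefficient vector of $g_k(x) \bmod (x^k-1)$, and $g_k$ is the generator polynomial of the cyclic code $\mathrm{RM}^*(\lfloor m/2\rfloor,m)^\perp$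 for some choice of $\varphi$ and $\alpha$ as above (the generator polynomial of a cyclic code $C\subseteq\mathbb F_2^k$ is the monic $g\mid x^k-1$ such that $(c_0,\dots,c_{k-1})\in C$ if and only if $g\mid\sum_i c_ix^i$); 2. $D_k$ has minimum distance at least $d$; 3. $D_k$ is $(2,d)$-balanced: $\mathrm{wt}(c_0)+\mathrm{wt}_{\mathrm{bal}}(c_1)\ge d$ for every non-zero $(c_0,c_1)\in D_k$ with $c_0,c_1\in\mathbb F_2^k$, where $\mathrm{wt}$ is the Hamming weight and $\mathrm{wt}_{\mathrm{bal}}(w)=\min_{\beta\in\mathbb F_2}|\{i: w_i\ne\beta\}|$; 4. the family is explicit: one algorithm, given $k$, outputs the $2k\times k$ generator matrix $\binom{I_k}{A_k}$ of $D_k$ in time at most $P(k)$; 5. $D_k$ can be decoded from $d/2$ errors in polynomial time: one algorithm, given $k$ and any $w\in\mathbb F_2^{2k}$, outputs in time at most $P(k)$ the codeword of $D_k$ that differs from $w$ in at most $d/2$ coordinates, or reports that there is none. Here the algorithms are fixed programs, the same for all $k$, on a unit-cost random access machine with addition and truncated subtraction of natural numbers. -/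

import Mathlib

open Polynomial

/-! ### A random access machine with step count

Programs act on natural-number registers and natural-number arrays (a program mentions only finitely
many of them).  The arithmetic operations are addition and truncated subtraction; every operation,
memory access and test costs one step.  This is the usual unit-cost random access machine without
multiplication, with structured control flow. -/

/-- Memory contents: register `x` holds `reg x`, and cell `i` of array `n` holds `arr n i`. -/
structure RamState where
  reg : ℕ → ℕ
  arr : ℕ → ℕ → ℕ

/-- Expressions: literals, registers, sums, truncated differences, array cells. -/
inductive RamExpr where
  | lit (n : ℕ)
  | var (x : ℕ)
  | add (e₁ e₂ : RamExpr)
  | sub (e₁ e₂ : RamExpr)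
  | get (n : ℕ) (e : RamExpr)

/-- The value of an expression. -/
def RamExpr.eval (s : RamState) : RamExpr → ℕ
  | .lit n => n
  | .var x => s.reg x
  | .add e₁ e₂ => e₁.eval s + e₂.eval s
  | .sub e₁ e₂ => e₁.eval s - e₂.eval s
  | .get n e => s.arr n (e.eval s)

/-- The number of steps needed to evaluate an expression: its number of nodes. -/
def RamExpr.cost : RamExpr → ℕ
  | .lit _ => 1
  | .var _ => 1
  | .add e₁ e₂ => e₁.cost + e₂.cost + 1
  | .sub e₁ e₂ => e₁.cost + e₂.cost + 1
  | .get _ e => e.cost + 1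

/-- Programs. `store n e₁ e₂` writes the value of `e₂` into cell `e₁` of array `n`; `branch` and
`loop` test whether the value of their expression is nonzero. -/
inductive RamProg where
  | nop
  | assign (x : ℕ) (e : RamExpr)
  | store (n : ℕ) (e₁ e₂ : RamExpr)
  | seq (p q : RamProg)
  | branch (e : RamExpr) (p q : RamProg)
  | loop (e : RamExpr) (p : RamProg)

/-- Writing a register. -/
def RamState.setReg (s : RamState) (x v : ℕ) : RamState :=
  { s with reg := Function.update s.reg x v }

/-- Writing an array cell. -/
def RamState.setCell (s : RamState) (n i v : ℕ) : RamState :=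
  { s with arr := Function.update s.arr n (Function.update (s.arr n) i v) }

/-- `RamExec p s s' t`: started in memory `s`, the program `p` halts after exactly `t` steps with
memory `s'`. -/
inductive RamExec : RamProg → RamState → RamState → ℕ → Prop where
  | nop (s : RamState) : RamExec .nop s s 1
  | assign (x : ℕ) (e : RamExpr) (s : RamState) :
      RamExec (.assign x e) s (s.setReg x (e.eval s)) (e.cost + 1)
  | store (n : ℕ) (e₁ e₂ : RamExpr) (s : RamState) :
      RamExec (.store n e₁ e₂) s (s.setCell n (e₁.eval s) (e₂.eval s)) (e₁.cost + e₂.cost + 1)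
  | seq {p q : RamProg} {s s₁ s₂ : RamState} {t₁ t₂ : ℕ}
      (hp : RamExec p s s₁ t₁) (hq : RamExec q s₁ s₂ t₂) :
      RamExec (.seq p q) s s₂ (t₁ + t₂)
  | branchTrue {e : RamExpr} {p q : RamProg} {s s₁ : RamState} {t : ℕ}
      (he : e.eval s ≠ 0) (hp : RamExec p s s₁ t) :
      RamExec (.branch e p q) s s₁ (e.cost + 1 + t)
  | branchFalse {e : RamExpr} {p q : RamProg} {s s₁ : RamState} {t : ℕ}
      (he : e.eval s = 0) (hq : RamExec q s s₁ t) :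
      RamExec (.branch e p q) s s₁ (e.cost + 1 + t)
  | loopTrue {e : RamExpr} {p : RamProg} {s s₁ s₂ : RamState} {t₁ t₂ : ℕ}
      (he : e.eval s ≠ 0) (hp : RamExec p s s₁ t₁) (hl : RamExec (.loop e p) s₁ s₂ t₂) :
      RamExec (.loop e p) s s₂ (e.cost + 1 + t₁ + t₂)
  | loopFalse {e : RamExpr} {p : RamProg} {s : RamState} (he : e.eval s = 0) :
      RamExec (.loop e p) s s (e.cost + 1)

/-! ### Linear codes -/

/-- The dual code. -/
def dualCode {F ι : Type*} [Field F] [Fintype ι] (C : Submodule F (ι → F)) :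
    Submodule F (ι → F) where
  carrier := {c' | ∀ c ∈ C, ∑ i, c' i * c i = 0}
  zero_mem' := by intro c _; simp
  add_mem' := by
    intro x y hx hy c hc
    simp only [Pi.add_apply, add_mul, Finset.sum_add_distrib]
    rw [hx c hc, hy c hc, add_zero]
  smul_mem' := by
    intro r x hx c hc
    simp only [Pi.smul_apply, smul_eq_mul, mul_assoc, ← Finset.mul_sum]
    rw [hx c hc, mul_zero]

/-- Any two distinct codewords are at Hamming distance at least `d`. -/
def HasDistanceAtLeast {F ι : Type*} [Field F] [Fintype ι] [DecidableEq F]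
    (C : Submodule F (ι → F)) (d : ℕ) : Prop :=
  ∀ c ∈ C, ∀ c' ∈ C, c ≠ c' → d ≤ hammingDist c c'

/-- The balanced weight of a word: the least number of entries that differ from a fixed symbol. -/
noncomputable def balancedWeight {F ι : Type*} [Fintype ι] [DecidableEq F] (w : ι → F) : ℕ :=
  ⨅ β : F, (Finset.univ.filter fun i => w i ≠ β).card

/-- `(2, d)`-balanced codes; a word of length `2k` is a pair of words of length `k`, indexed by the
two summands. -/
def IsTwoBalanced {F : Type*} [Field F] [DecidableEq F] {k : ℕ}
    (C : Submodule F (Fin k ⊕ Fin k → F)) (d : ℕ) : Prop :=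
  ∀ c ∈ C, c ≠ 0 → d ≤ hammingNorm (c ∘ Sum.inl) + balancedWeight (c ∘ Sum.inr)

/-- The polynomial `∑ c_i x^i` of a word. -/
noncomputable def wordPoly {F : Type*} [Field F] {n : ℕ} (c : Fin n → F) : F[X] :=
  ∑ i : Fin n, Polynomial.C (c i) * X ^ (i : ℕ)

/-- `g` is the generator polynomial of the (necessarily cyclic) code `C` of length `n`. -/
def IsGeneratorPoly {F : Type*} [Field F] {n : ℕ} (C : Submodule F (Fin n → F)) (g : F[X]) : Prop :=
  g.Monic ∧ g ∣ X ^ n - 1 ∧ ∀ c : Fin n → F, c ∈ C ↔ g ∣ wordPoly c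

/-- The generator matrix obtained by stacking the identity on the circulant matrix with first
column `a` (its entry at `(i, j)` is `a (i - j)`, indices modulo `k`). -/
def doubleCirculantMatrix {F : Type*} [Field F] {k : ℕ} (a : Fin k → F) :
    Matrix (Fin k ⊕ Fin k) (Fin k) F :=
  Matrix.fromRows 1 (Matrix.circulant a)

/-- The double-circulant code with this generator matrix. -/
def doubleCirculantCode {F : Type*} [Field F] {k : ℕ} (a : Fin k → F) :
    Submodule F (Fin k ⊕ Fin k → F) :=
  LinearMap.range (doubleCirculantMatrix a).mulVecLin

/-! ### Reed-Muller codes -/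

/-- The binary Reed-Muller code: evaluations on `𝔽₂^m` of the polynomials of total degree at
most `r`. -/
noncomputable def reedMuller (r m : ℕ) :
    Submodule (ZMod 2) ((Fin m → ZMod 2) → ZMod 2) :=
  (MvPolynomial.restrictTotalDegree (Fin m) (ZMod 2) r).map
    (MvPolynomial.evalₗ (ZMod 2) (Fin m))

/-- The punctured Reed-Muller code, with the nonzero evaluation points in the order
`φ (α ^ i)`, `i = 0, …, 2 ^ m - 2`, where `φ` is a linear bijection between the field with `2 ^ m`
elements and `𝔽₂^m`, and `α` (a generator of the multiplicative group in all uses). -/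
noncomputable def puncturedReedMuller (r m : ℕ)
    (φ : GaloisField 2 m ≃ₗ[ZMod 2] (Fin m → ZMod 2)) (α : (GaloisField 2 m)ˣ) :
    Submodule (ZMod 2) (Fin (2 ^ m - 1) → ZMod 2) :=
  (reedMuller r m).map
    (LinearMap.funLeft (ZMod 2) (ZMod 2)
      fun i : Fin (2 ^ m - 1) => φ ((α : GaloisField 2 m) ^ (i : ℕ)))

/-- `a ∈ 𝔽₂^k`, `k = 2 ^ m - 1`, is the coefficient vector of the generator polynomial of the dual
of the punctured Reed-Muller code of order `⌊m/2⌋`, for an admissible order of the evaluation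
points.  The reduction modulo `x^k - 1` changes nothing unless the dual code is zero (`m ≤ 2`), when
the generator polynomial is `x^k - 1` itself. -/
def IsDualRMColumn (m : ℕ) (a : Fin (2 ^ m - 1) → ZMod 2) : Prop :=
  ∃ (φ : GaloisField 2 m ≃ₗ[ZMod 2] (Fin m → ZMod 2)) (α : (GaloisField 2 m)ˣ) (g : (ZMod 2)[X]),
    (∀ β : (GaloisField 2 m)ˣ, β ∈ Subgroup.zpowers α) ∧
    IsGeneratorPoly (dualCode (puncturedReedMuller (m / 2) m φ α)) g ∧
    ∀ i, a i = (g %ₘ (X ^ (2 ^ m - 1) - 1)).coeff (i : ℕ)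

/-! ### Algorithms for binary codes of length `2k` -/

/-- The position of a coordinate of a word of length `2k`. -/
def coordPos {k : ℕ} : Fin k ⊕ Fin k → ℕ
  | .inl i => i
  | .inr i => k + i

/-- The input of the construction algorithm: register `0` holds `k`, everything else is `0`. -/
def constructInput (k : ℕ) : RamState where
  reg := fun x => if x = 0 then k else 0
  arr := fun _ _ => 0

/-- The input of the decoding algorithm: register `0` holds `k`, the first `2k` cells of array `0`
hold the received word, everything else is `0`. -/
def decodeInput {k : ℕ} (w : Fin k ⊕ Fin k → ZMod 2) : RamState where
  reg := fun x => if x = 0 then k else 0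
  arr := fun n i =>
    if n = 0 then
      if h : i < k then (w (.inl ⟨i, h⟩)).val
      else if h' : i - k < k then (w (.inr ⟨i - k, h'⟩)).val
      else 0
    else 0

/-- On input `k`, the program `p` writes the `2k × k` matrix `G` into array `0`, row by row, within
`T` steps. -/
def Constructs {k : ℕ} (p : RamProg) (G : Matrix (Fin k ⊕ Fin k) (Fin k) (ZMod 2)) (T : ℕ) :
    Prop :=
  ∃ s t, RamExec p (constructInput k) s t ∧ t ≤ T ∧
    ∀ (i : Fin k ⊕ Fin k) (j : Fin k), s.arr 0 (coordPos i * k + (j : ℕ)) = (G i j).val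

/-- On every received word `w`, the program `p` halts within `T` steps.  If `c` is a codeword that
differs from `w` in at most `d / 2` positions, then register `0` holds `1` and array `0` holds `c`;
if there is no such codeword, then register `0` holds `0`. -/
def DecodesHalf {k : ℕ} (p : RamProg) (C : Submodule (ZMod 2) (Fin k ⊕ Fin k → ZMod 2))
    (d T : ℕ) : Prop :=
  ∀ w : Fin k ⊕ Fin k → ZMod 2, ∃ s t, RamExec p (decodeInput w) s t ∧ t ≤ T ∧
    (∀ c ∈ C, 2 * hammingDist w c ≤ d →
      s.reg 0 = 1 ∧ ∀ i, s.arr 0 (coordPos i) = (c i).val) ∧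
    ((¬ ∃ c ∈ C, 2 * hammingDist w c ≤ d) → s.reg 0 = 0)

/-! Let k = 2^m - 1 and r = ⌊m/2⌋. Position n of a word of length k stands for the nonzero point w_n
= φ(α^n) of F_2^m. In suitable coordinates w_n is the window (s_n, …, s_{n+m-1}) of a linear
recurring sequence s of period k. A cyclic shift of positions is a linear map on points, and
Reed-Muller codes are invariant under linear substitutions. Hence the polynomials orthogonal to
RM(r,m) along the windows form an ideal that contains x^k - 1. Its generator is g, and A is the
circulant matrix of g modulo x^k - 1.

Two dual facts about flats, given by fixing h coordinates, carry the coding part. The indicator of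
such a flat has degree at most h, so for h ≤ r every word of the ideal sums to zero over it
(`flatChecks_of_mem_dualIdeal`). A polynomial of degree at most r sums to zero over it when h + r <
m (`sum_flat_eq_zero`), so the incidence word of such a flat off the origin lies in the ideal.
Therefore every Au satisfies flat checks with h = r. If Au = 0, then u is annihilated by the whole
ideal, and u read backwards satisfies flat checks with h = m - r - 1
(`flatChecks_of_circulant_eq_zero`).

The k cyclic shifts of the coordinates give k flats through a point p. The origin, or any one other
point, lies on at most 2^(m-h) - 1 of them, because the sum of two different windows is again a
window (`card_bad_shifts_le`). So a nonzero word with vanishing checks has weight above t if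
t(2^(m-h) - 1) < k, and a majority vote over the flats corrects t errors if 2(t+1)(2^(m-h) - 1) < k
(`flatMajority_add`). Both values of h are close to m/2, which allows t of order √k.

For the distance, either Au = 0 and u is heavy, or Au is a nonzero word with vanishing checks and is
heavy itself. In the second case Au + 1 satisfies the checks too. It is nonzero because Au has even
weight and k is odd, and this gives the balanced weight (`isTwoBalanced`).

For decoding, let (w₀, w₁) = (x + f₀, Ax + f₁). The syndrome w₁ + Aw₀ equals Af₀ + f₁, and a vote
finds f₁. Division of Af₀ by g gives some u with Au = Af₀. Then u + f₀ lies in the kernel of A, and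
a second vote on the reversed u finds f₀ (`decode_eq`). A final comparison with the received word
decides acceptance.

The algorithms find s by trying all feedback coefficients. They find g by eliminating all monomials
of degree at most r from the standard basis: in echelon form the first nonzero row is the word of
least degree orthogonal to them. Everything is written in a small language whose loops all run up to
N = 3k + 3. Its programs compile to the machine with a time bound that is a polynomial in N. -/

namespace RamState

/-! ### Memories that agree below the work space, and counting loops. -/

@[simp] theorem reg_setReg (s : RamState) (x v y : ℕ) :
    (s.setReg x v).reg y = if y = x then v else s.reg y :=
  Function.update_apply ..

@[simp] theorem arr_setReg (s : RamState) (x v : ℕ) : (s.setReg x v).arr = s.arr := rfl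

@[simp] theorem arr_setCell (s : RamState) (n i v n' i' : ℕ) :
    (s.setCell n i v).arr n' i' = if n' = n ∧ i' = i then v else s.arr n' i' := by
  by_cases hn : n' = n
  · subst hn
    simp [setCell, Function.update_apply]
  · simp [setCell, hn]

/-- Two memories with the same arrays whose registers below `d` agree. -/
def AgreeBelow (d : ℕ) (s s' : RamState) : Prop :=
  (∀ x < d, s.reg x = s'.reg x) ∧ s.arr = s'.arr

theorem AgreeBelow.refl (d : ℕ) (s : RamState) : AgreeBelow d s s := ⟨fun _ _ => rfl, rfl⟩

theorem AgreeBelow.symm {d : ℕ} {s s' : RamState} (h : AgreeBelow d s s') : AgreeBelow d s' s :=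
  ⟨fun x hx => (h.1 x hx).symm, h.2.symm⟩

theorem AgreeBelow.trans {d : ℕ} {s s' s'' : RamState} (h : AgreeBelow d s s')
    (h' : AgreeBelow d s' s'') : AgreeBelow d s s'' :=
  ⟨fun x hx => (h.1 x hx).trans (h'.1 x hx), h.2.trans h'.2⟩

theorem AgreeBelow.mono {d d' : ℕ} {s s' : RamState} (h : AgreeBelow d s s') (hd : d' ≤ d) :
    AgreeBelow d' s s' :=
  ⟨fun x hx => h.1 x (hx.trans_le hd), h.2⟩

theorem AgreeBelow.setReg {d : ℕ} {s s' : RamState} (h : AgreeBelow d s s') (x v : ℕ) :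
    AgreeBelow d (s.setReg x v) (s'.setReg x v) := by
  refine ⟨fun y hy => ?_, h.2⟩
  simp [h.1 y hy]

theorem AgreeBelow.setCell {d : ℕ} {s s' : RamState} (h : AgreeBelow d s s') (n i v : ℕ) :
    AgreeBelow d (s.setCell n i v) (s'.setCell n i v) := by
  refine ⟨fun y hy => h.1 y hy, ?_⟩
  simp only [RamState.setCell, h.2]

theorem agreeBelow_setReg {d x : ℕ} (hx : d ≤ x) (s : RamState) (v : ℕ) :
    AgreeBelow d s (s.setReg x v) := by
  refine ⟨fun y hy => ?_, rfl⟩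
  have : y ≠ x := by omega
  simp [this]

end RamState

open RamState

/-- A loop that counts register `x` up to the value of register `1`. -/
theorem exec_countingLoop {x N T : ℕ} {body : RamProg} (I : ℕ → RamState → Prop)
    (hreg : ∀ i s, I i s → s.reg 1 = N ∧ s.reg x = i)
    (hbody : ∀ i < N, ∀ s, I i s → ∃ s' t, RamExec body s s' t ∧ t ≤ T ∧ I (i + 1) s')
    {s : RamState} (hs : I 0 s) :
    ∃ s' t, RamExec (.loop (.sub (.var 1) (.var x)) body) s s' t ∧ t ≤ N * (T + 4) + 4 ∧
      I N s' := by
  -- The induction is on the number `j` of rounds that remain.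
  have key : ∀ j ≤ N, ∀ s, I (N - j) s →
      ∃ s' t, RamExec (.loop (.sub (.var 1) (.var x)) body) s s' t ∧ t ≤ j * (T + 4) + 4 ∧
        I N s' := by
    intro j
    induction j with
    | zero =>
      intro _ s hs
      obtain ⟨h1, hx⟩ := hreg _ _ hs
      refine ⟨s, _, .loopFalse ?_, ?_, by simpa using hs⟩
      · simp [RamExpr.eval, h1, hx]
      · simp [RamExpr.cost]
    | succ j ih =>
      intro hj s hs
      obtain ⟨h1, hx⟩ := hreg _ _ hs
      obtain ⟨s', t, he, ht, hI⟩ := hbody _ (by omega) s hs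
      rw [show N - (j + 1) + 1 = N - j by omega] at hI
      obtain ⟨s'', t', he', ht', hI'⟩ := ih (by omega) s' hI
      refine ⟨s'', _, .loopTrue ?_ he he', ?_, hI'⟩
      · simp only [RamExpr.eval, h1, hx]
        omega
      · simp only [RamExpr.cost]
        rw [add_mul]
        omega
  exact key N le_rfl s (by simpa using hs)

/-! ### Bounded expressions -/

/-- Expressions with conditionals and with sums whose index register runs below the value of
register `1`; `fold true` counts modulo two the indices with a nonzero value. -/
inductive BExpr where
  | lit (n : ℕ)
  | var (x : ℕ)
  | add (e₁ e₂ : BExpr)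
  | sub (e₁ e₂ : BExpr)
  | get (n : ℕ) (e : BExpr)
  | cond (c e₁ e₂ : BExpr)
  | fold (parity : Bool) (x : ℕ) (e : BExpr)

namespace BExpr

/-- One step of a sum, or of a count modulo two. -/
def foldStep (parity : Bool) (a v : ℕ) : ℕ :=
  if parity then (if v = 0 then a else 1 - a) else a + v

/-- The value of a bounded expression. -/
def eval (s : RamState) : BExpr → ℕ
  | .lit n => n
  | .var x => s.reg x
  | .add e₁ e₂ => e₁.eval s + e₂.eval s
  | .sub e₁ e₂ => e₁.eval s - e₂.eval s
  | .get n e => s.arr n (e.eval s)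
  | .cond c e₁ e₂ => if c.eval s = 0 then e₂.eval s else e₁.eval s
  | .fold b x e =>
      Nat.rec 0 (fun i a => foldStep b a (e.eval (s.setReg x i))) (s.reg 1)

/-- All registers are below `d`, and register `1` is never an index register. -/
def Ok (d : ℕ) : BExpr → Bool
  | .lit _ => true
  | .var x => x < d
  | .add e₁ e₂ => e₁.Ok d && e₂.Ok d
  | .sub e₁ e₂ => e₁.Ok d && e₂.Ok d
  | .get _ e => e.Ok d
  | .cond c e₁ e₂ => c.Ok d && (e₁.Ok d && e₂.Ok d)
  | .fold _ x e => decide (x < d) && (decide (x ≠ 1) && e.Ok d)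

/-- The step of a sum on the accumulator `d` and the value in register `d + 2`. -/
def foldProg (parity : Bool) (d : ℕ) : RamProg :=
  if parity then
    .branch (.var (d + 2)) (.assign d (.sub (.lit 1) (.var d))) .nop
  else .assign d (.add (.var d) (.var (d + 2)))

/-- A program that leaves the value of an expression in register `d`, using registers from `d` on
as work space. -/
def comp (d : ℕ) : BExpr → RamProg
  | .lit n => .assign d (.lit n)
  | .var x => .assign d (.var x)
  | .add e₁ e₂ =>
      .seq (e₁.comp d) (.seq (e₂.comp (d + 1)) (.assign d (.add (.var d) (.var (d + 1)))))
  | .sub e₁ e₂ =>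
      .seq (e₁.comp d) (.seq (e₂.comp (d + 1)) (.assign d (.sub (.var d) (.var (d + 1)))))
  | .get n e => .seq (e.comp d) (.assign d (.get n (.var d)))
  | .cond c e₁ e₂ => .seq (c.comp d) (.branch (.var d) (e₁.comp d) (e₂.comp d))
  | .fold b x e =>
      .seq (.assign (d + 1) (.var x)) <| .seq (.assign x (.lit 0)) <| .seq (.assign d (.lit 0)) <|
        .seq (.loop (.sub (.var 1) (.var x))
            (.seq (e.comp (d + 2)) (.seq (foldProg b d) (.assign x (.add (.var x) (.lit 1))))))
          (.assign x (.var (d + 1)))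

/-- A bound for the running time of `comp`, in terms of the value of register `1`. -/
noncomputable def cost : BExpr → ℕ[X]
  | .lit _ => 2
  | .var _ => 2
  | .add e₁ e₂ => e₁.cost + e₂.cost + 4
  | .sub e₁ e₂ => e₁.cost + e₂.cost + 4
  | .get _ e => e.cost + 3
  | .cond c e₁ e₂ => c.cost + e₁.cost + e₂.cost + 2
  | .fold _ _ e => X * (e.cost + 14) + 12

/-- Work registers do not influence values: only registers below `d` are read, and binding an index
register preserves the agreement below `d`. Register 1 is among the agreeing ones because 2 ≤ d, so
sums have the same length. -/
theorem eval_congr {d : ℕ} (hd : 2 ≤ d) (e : BExpr) (he : e.Ok d) {s s' : RamState}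
    (h : AgreeBelow d s s') : e.eval s = e.eval s' := by
  induction e generalizing s s' with
  | lit n => rfl
  | var x => exact h.1 x (by simpa [Ok] using he)
  | add e₁ e₂ ih₁ ih₂ =>
    simp only [Ok, Bool.and_eq_true] at he
    simp only [eval, ih₁ he.1 h, ih₂ he.2 h]
  | sub e₁ e₂ ih₁ ih₂ =>
    simp only [Ok, Bool.and_eq_true] at he
    simp only [eval, ih₁ he.1 h, ih₂ he.2 h]
  | get n e ih => simp only [eval, ih he h, h.2]
  | cond c e₁ e₂ ih ih₁ ih₂ =>
    simp only [Ok, Bool.and_eq_true] at he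
    simp only [eval, ih he.1 h, ih₁ he.2.1 h, ih₂ he.2.2 h]
  | fold b x e ih =>
    simp only [Ok, Bool.and_eq_true] at he
    simp only [eval, h.1 1 (by omega), fun i => ih he.2.2 (h.setReg x i)]

theorem exec_foldProg (b : Bool) (d : ℕ) (s : RamState) :
    ∃ t, RamExec (foldProg b d) s (s.setReg d (foldStep b (s.reg d) (s.reg (d + 2)))) t ∧
      t ≤ 6 := by
  cases b with
  | false =>
    exact ⟨_, .assign _ _ _, by simp [RamExpr.cost]⟩
  | true =>
    by_cases h : s.reg (d + 2) = 0
    · have hs : s.setReg d (foldStep true (s.reg d) (s.reg (d + 2))) = s := by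
        simp [foldStep, h, setReg]
      rw [hs]
      exact ⟨_, .branchFalse h (.nop s), by simp [RamExpr.cost]⟩
    · have hs : foldStep true (s.reg d) (s.reg (d + 2)) =
          (RamExpr.sub (.lit 1) (.var d)).eval s := by
        simp [foldStep, h, RamExpr.eval]
      rw [hs]
      exact ⟨_, .branchTrue h (.assign _ _ _), by simp [RamExpr.cost]⟩

/-- Correctness of the compilation of expressions. The bound `d₀` on the registers of the expression
stays fixed while the start `d` of the work space moves up: a second operand is evaluated from `d +
1` on, so that the first result in `d` survives. -/
theorem exec_comp {d₀ : ℕ} (hd₀ : 2 ≤ d₀) (e : BExpr) (he : e.Ok d₀) {d : ℕ} (hd : d₀ ≤ d)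
    (s : RamState) :
    ∃ s' t, RamExec (e.comp d) s s' t ∧ t ≤ e.cost.eval (s.reg 1) ∧ s'.reg d = e.eval s ∧
      AgreeBelow d s s' := by
  induction e generalizing d s with
  | lit n =>
    exact ⟨_, _, .assign _ _ _, by simp [RamExpr.cost, cost], by simp [RamExpr.eval, eval],
      agreeBelow_setReg le_rfl _ _⟩
  | var x =>
    exact ⟨_, _, .assign _ _ _, by simp [RamExpr.cost, cost], by simp [RamExpr.eval, eval],
      agreeBelow_setReg le_rfl _ _⟩
  | add e₁ e₂ ih₁ ih₂ =>
    simp only [Ok, Bool.and_eq_true] at he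
    obtain ⟨s₁, t₁, h₁, ht₁, hv₁, ha₁⟩ := ih₁ he.1 hd s
    obtain ⟨s₂, t₂, h₂, ht₂, hv₂, ha₂⟩ := ih₂ he.2 (d := d + 1) (by omega) s₁
    refine ⟨_, _, .seq h₁ (.seq h₂ (.assign _ _ _)), ?_, ?_,
      (ha₁.trans (ha₂.mono (by omega))).trans (agreeBelow_setReg le_rfl _ _)⟩
    · rw [← ha₁.1 1 (by omega)] at ht₂
      simp [RamExpr.cost, cost]
      omega
    · simp [RamExpr.eval, eval, hv₂, ← ha₂.1 d (by omega), hv₁,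
        eval_congr hd₀ e₂ he.2 (ha₁.mono hd)]
  | sub e₁ e₂ ih₁ ih₂ =>
    simp only [Ok, Bool.and_eq_true] at he
    obtain ⟨s₁, t₁, h₁, ht₁, hv₁, ha₁⟩ := ih₁ he.1 hd s
    obtain ⟨s₂, t₂, h₂, ht₂, hv₂, ha₂⟩ := ih₂ he.2 (d := d + 1) (by omega) s₁
    refine ⟨_, _, .seq h₁ (.seq h₂ (.assign _ _ _)), ?_, ?_,
      (ha₁.trans (ha₂.mono (by omega))).trans (agreeBelow_setReg le_rfl _ _)⟩
    · rw [← ha₁.1 1 (by omega)] at ht₂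
      simp [RamExpr.cost, cost]
      omega
    · simp [RamExpr.eval, eval, hv₂, ← ha₂.1 d (by omega), hv₁,
        eval_congr hd₀ e₂ he.2 (ha₁.mono hd)]
  | get n e ih =>
    obtain ⟨s₁, t₁, h₁, ht₁, hv₁, ha₁⟩ := ih he hd s
    refine ⟨_, _, .seq h₁ (.assign _ _ _), ?_, ?_, ha₁.trans (agreeBelow_setReg le_rfl _ _)⟩
    · simp [RamExpr.cost, cost]
      omega
    · simp [RamExpr.eval, eval, hv₁, ha₁.2]
  | cond c e₁ e₂ ih ih₁ ih₂ =>
    simp only [Ok, Bool.and_eq_true] at he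
    obtain ⟨s', t, h, ht, hv, ha⟩ := ih he.1 hd s
    by_cases hc : c.eval s = 0
    · obtain ⟨s₂, t₂, h₂, ht₂, hv₂, ha₂⟩ := ih₂ he.2.2 hd s'
      refine ⟨_, _, .seq h (.branchFalse (by simp [RamExpr.eval, hv, hc]) h₂), ?_, ?_,
        ha.trans ha₂⟩
      · rw [← ha.1 1 (by omega)] at ht₂
        simp [RamExpr.cost, cost]
        omega
      · simp [eval, hc, hv₂, eval_congr hd₀ e₂ he.2.2 (ha.mono hd)]
    · obtain ⟨s₂, t₂, h₂, ht₂, hv₂, ha₂⟩ := ih₁ he.2.1 hd s'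
      refine ⟨_, _, .seq h (.branchTrue (by simp [RamExpr.eval, hv, hc]) h₂), ?_, ?_,
        ha.trans ha₂⟩
      · rw [← ha.1 1 (by omega)] at ht₂
        simp [RamExpr.cost, cost]
        omega
      · simp [eval, hc, hv₂, eval_congr hd₀ e₁ he.2.1 (ha.mono hd)]
  | fold b x e ih =>
    simp only [Ok, Bool.and_eq_true, decide_eq_true_eq] at he
    obtain ⟨hx, hx1, he⟩ := he
    let acc : ℕ → ℕ := fun i =>
      Nat.rec 0 (fun i a => foldStep b a (e.eval (s.setReg x i))) i
    -- Register `x` is exempt from the frame condition since it is the running index. Its old value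
    -- waits in register `d + 1` and is restored after the loop.
    let I : ℕ → RamState → Prop := fun i σ =>
      σ.reg x = i ∧ σ.reg d = acc i ∧ σ.reg (d + 1) = s.reg x ∧
        (∀ y < d, y ≠ x → σ.reg y = s.reg y) ∧ σ.arr = s.arr
    have hbody : ∀ i < s.reg 1, ∀ σ, I i σ → ∃ σ' t,
        RamExec (.seq (e.comp (d + 2))
          (.seq (foldProg b d) (.assign x (.add (.var x) (.lit 1))))) σ σ' t ∧
          t ≤ e.cost.eval (s.reg 1) + 9 + 1 ∧ I (i + 1) σ' := by
      rintro i - σ ⟨h1, h2, h3, h4, h5⟩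
      obtain ⟨σ₁, t₁, hE₁, ht₁, hv₁, ha₁⟩ := ih he (d := d + 2) (by omega) σ
      obtain ⟨t₂, hE₂, ht₂⟩ := exec_foldProg b d σ₁
      have hval : e.eval σ = e.eval (s.setReg x i) := by
        refine eval_congr hd₀ e he ⟨fun y hy => ?_, by simpa using h5⟩
        by_cases hyx : y = x
        · simp [hyx, h1]
        · simp [hyx, h4 y (by omega) hyx]
      refine ⟨_, _, .seq hE₁ (.seq hE₂ (.assign _ _ _)), ?_, ?_, ?_, ?_, ?_, ?_⟩
      · rw [h4 1 (by omega) (Ne.symm hx1)] at ht₁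
        simp [RamExpr.cost]
        omega
      · have : x ≠ d := by omega
        simp [RamExpr.eval, this, ← ha₁.1 x (by omega), h1]
      · have : d ≠ x := by omega
        simp [this, hv₁, ← ha₁.1 d (by omega), h2, hval, acc]
      · have : d + 1 ≠ x := by omega
        simp [this, ← ha₁.1 (d + 1) (by omega), h3]
      · intro y hy hyx
        have : y ≠ d := by omega
        simp [this, hyx, ← ha₁.1 y (by omega), h4 y hy hyx]
      · simp [← ha₁.2, h5]
    have h0 : I 0 (((s.setReg (d + 1) (s.reg x)).setReg x 0).setReg d 0) := by
      refine ⟨?_, ?_, ?_, ?_, ?_⟩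
      · simp
      · simp [acc]
      · have : d + 1 ≠ x := by omega
        simp [this]
      · intro y hy hyx
        have h1 : y ≠ d := by omega
        have h2 : y ≠ d + 1 := by omega
        simp [h1, h2, hyx]
      · simp
    obtain ⟨s', t, hE, ht, h1, h2, h3, h4, h5⟩ := exec_countingLoop (x := x) (N := s.reg 1) I
      (fun i σ h => ⟨h.2.2.2.1 1 (by omega) (Ne.symm hx1), h.1⟩) hbody h0
    refine ⟨_, _, .seq (.assign _ _ _) (.seq (.assign _ _ _) (.seq (.assign _ _ _)
      (.seq hE (.assign _ _ _)))), ?_, ?_, ?_, ?_⟩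
    · simp only [add_assoc, Nat.reduceAdd] at ht
      simp [RamExpr.cost, cost]
      omega
    · have : d ≠ x := by omega
      simp [this, h2, acc, eval]
    · intro y hy
      by_cases hyx : y = x
      · simp [hyx, RamExpr.eval, h3]
      · simp [hyx, h4 y hy hyx]
    · simp [h5]

end BExpr

/-! ### A language of bounded loops and its compilation. -/

/-- Programs whose loops run their index register through the numbers below the value of register
`1`. -/
inductive BProg where
  | skip
  | set (x : ℕ) (e : BExpr)
  | store (n : ℕ) (e₁ e₂ : BExpr)
  | seq (p q : BProg)
  | ite (e : BExpr) (p q : BProg)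
  | loop (x : ℕ) (p : BProg)

namespace BProg

/-- The effect of a program. -/
def den : BProg → RamState → RamState
  | .skip, s => s
  | .set x e, s => s.setReg x (e.eval s)
  | .store n e₁ e₂, s => s.setCell n (e₁.eval s) (e₂.eval s)
  | .seq p q, s => q.den (p.den s)
  | .ite e p q, s => if e.eval s = 0 then q.den s else p.den s
  | .loop x p, s =>
      RamState.setReg (Nat.rec s (fun i σ => p.den (σ.setReg x i)) (s.reg 1)) x (s.reg 1)

/-- Whether a program may write a register. -/
def WritesReg (x : ℕ) : BProg → Bool
  | .skip => false
  | .set y _ => x == y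
  | .store _ _ _ => false
  | .seq p q => p.WritesReg x || q.WritesReg x
  | .ite _ p q => p.WritesReg x || q.WritesReg x
  | .loop y p => (x == y) || p.WritesReg x

/-- Whether a program may write to an array. -/
def WritesArr (n : ℕ) : BProg → Bool
  | .skip => false
  | .set _ _ => false
  | .store n' _ _ => n == n'
  | .seq p q => p.WritesArr n || q.WritesArr n
  | .ite _ p q => p.WritesArr n || q.WritesArr n
  | .loop _ p => p.WritesArr n

/-- All registers are below `d`, register `1` is never written, and loops do not write their index
register. -/
def Ok (d : ℕ) : BProg → Bool
  | .skip => true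
  | .set x e => decide (x < d) && (decide (x ≠ 1) && e.Ok d)
  | .store _ e₁ e₂ => e₁.Ok d && e₂.Ok d
  | .seq p q => p.Ok d && q.Ok d
  | .ite e p q => e.Ok d && (p.Ok d && q.Ok d)
  | .loop x p => decide (x < d) && (decide (x ≠ 1) && ((!p.WritesReg x) && p.Ok d))

/-- The translation to programs of the machine, with registers from `d` on as work space. -/
def compile (d : ℕ) : BProg → RamProg
  | .skip => .nop
  | .set x e => .seq (e.comp d) (.assign x (.var d))
  | .store n e₁ e₂ => .seq (e₁.comp d) (.seq (e₂.comp (d + 1)) (.store n (.var d) (.var (d + 1))))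
  | .seq p q => .seq (p.compile d) (q.compile d)
  | .ite e p q => .seq (e.comp d) (.branch (.var d) (p.compile d) (q.compile d))
  | .loop x p => .seq (.assign x (.lit 0))
      (.loop (.sub (.var 1) (.var x)) (.seq (p.compile d) (.assign x (.add (.var x) (.lit 1)))))

/-- A bound for the running time, in terms of the value of register `1`. -/
noncomputable def cost : BProg → ℕ[X]
  | .skip => 1
  | .set _ e => e.cost + 2
  | .store _ e₁ e₂ => e₁.cost + e₂.cost + 3
  | .seq p q => p.cost + q.cost
  | .ite e p q => e.cost + p.cost + q.cost + 2
  | .loop _ p => X * (p.cost + 8) + 6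

theorem den_reg {x : ℕ} (p : BProg) (hp : p.WritesReg x = false) (s : RamState) :
    (p.den s).reg x = s.reg x := by
  induction p generalizing s with
  | skip => rfl
  | set y e => simp_all [WritesReg, den]
  | store n e₁ e₂ => rfl
  | seq p q ihp ihq =>
    simp only [WritesReg, Bool.or_eq_false_iff] at hp
    simp [den, ihp hp.1, ihq hp.2]
  | ite e p q ihp ihq =>
    simp only [WritesReg, Bool.or_eq_false_iff] at hp
    simp only [den]
    split_ifs
    exacts [ihq hp.2 s, ihp hp.1 s]
  | loop y p ih =>
    simp only [WritesReg, Bool.or_eq_false_iff, beq_eq_false_iff_ne] at hp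
    have key : ∀ i : ℕ, RamState.reg (Nat.rec s (fun i σ => p.den (σ.setReg y i)) i) x =
        s.reg x := by
      intro i
      induction i with
      | zero => rfl
      | succ i ihi => simpa [ih hp.2, hp.1] using ihi
    simp [den, hp.1, key]

theorem den_arr {n : ℕ} (p : BProg) (hp : p.WritesArr n = false) (s : RamState) :
    (p.den s).arr n = s.arr n := by
  induction p generalizing s with
  | skip => rfl
  | set y e => rfl
  | store n' e₁ e₂ =>
    simp only [WritesArr, beq_eq_false_iff_ne] at hp
    funext i
    simp [den, hp]
  | seq p q ihp ihq =>
    simp only [WritesArr, Bool.or_eq_false_iff] at hp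
    simp [den, ihp hp.1, ihq hp.2]
  | ite e p q ihp ihq =>
    simp only [WritesArr, Bool.or_eq_false_iff] at hp
    simp only [den]
    split_ifs
    exacts [ihq hp.2 s, ihp hp.1 s]
  | loop y p ih =>
    have key : ∀ i : ℕ, RamState.arr (Nat.rec s (fun i σ => p.den (σ.setReg y i)) i) n =
        s.arr n := by
      intro i
      induction i with
      | zero => rfl
      | succ i ihi => simpa [ih hp] using ihi
    simp [den, key]

theorem writesReg_one_of_ok {d : ℕ} (p : BProg) (hp : p.Ok d) : p.WritesReg 1 = false := by
  induction p with
  | skip => rfl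
  | set y e =>
    simp only [Ok, Bool.and_eq_true, decide_eq_true_eq] at hp
    simp [WritesReg, Ne.symm hp.2.1]
  | store n e₁ e₂ => rfl
  | seq p q ihp ihq => simp_all [WritesReg, Ok]
  | ite e p q ihp ihq => simp_all [WritesReg, Ok]
  | loop y p ih =>
    simp only [Ok, Bool.and_eq_true, decide_eq_true_eq] at hp
    simp [WritesReg, Ne.symm hp.2.1, ih hp.2.2.2]

/-- Compiled programs simulate the denotation up to the contents of the work space. Register 1 is
never written, so every subprogram has its cost bounded by a polynomial in the same number. -/
theorem exec_compile {d : ℕ} (hd : 2 ≤ d) (p : BProg) (hp : p.Ok d) {s σ : RamState}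
    (h : AgreeBelow d s σ) :
    ∃ s' t, RamExec (p.compile d) s s' t ∧ t ≤ p.cost.eval (σ.reg 1) ∧
      AgreeBelow d s' (p.den σ) := by
  induction p generalizing s σ with
  | skip => exact ⟨_, _, .nop s, by simp [cost], h⟩
  | set x e =>
    simp only [Ok, Bool.and_eq_true, decide_eq_true_eq] at hp
    obtain ⟨s', t, hE, ht, hv, ha⟩ := BExpr.exec_comp hd e hp.2.2 le_rfl s
    refine ⟨_, _, .seq hE (.assign _ _ _), ?_, ?_⟩
    · rw [h.1 1 (by omega)] at ht
      simp [RamExpr.cost, cost]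
      omega
    · simp only [RamExpr.eval, hv, den, BExpr.eval_congr hd e hp.2.2 h]
      exact (ha.symm.trans h).setReg _ _
  | store n e₁ e₂ =>
    simp only [Ok, Bool.and_eq_true] at hp
    obtain ⟨s₁, t₁, hE₁, ht₁, hv₁, ha₁⟩ := BExpr.exec_comp hd e₁ hp.1 le_rfl s
    obtain ⟨s₂, t₂, hE₂, ht₂, hv₂, ha₂⟩ := BExpr.exec_comp hd e₂ hp.2 (d := d + 1) (by omega) s₁
    refine ⟨_, _, .seq hE₁ (.seq hE₂ (.store _ _ _ _)), ?_, ?_⟩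
    · rw [← ha₁.1 1 (by omega), h.1 1 (by omega)] at ht₂
      rw [h.1 1 (by omega)] at ht₁
      simp [RamExpr.cost, cost]
      omega
    · simp only [RamExpr.eval, hv₂, ← ha₂.1 d (by omega), hv₁, den, BExpr.eval_congr hd e₁ hp.1 h,
        BExpr.eval_congr hd e₂ hp.2 (ha₁.symm.trans h)]
      exact ((ha₂.mono (by omega)).symm.trans (ha₁.symm.trans h)).setCell _ _ _
  | seq p q ihp ihq =>
    simp only [Ok, Bool.and_eq_true] at hp
    obtain ⟨s₁, t₁, hE₁, ht₁, ha₁⟩ := ihp hp.1 h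
    obtain ⟨s₂, t₂, hE₂, ht₂, ha₂⟩ := ihq hp.2 ha₁
    refine ⟨_, _, .seq hE₁ hE₂, ?_, ha₂⟩
    rw [den_reg p (writesReg_one_of_ok p hp.1)] at ht₂
    simp [cost]
    omega
  | ite e p q ihp ihq =>
    simp only [Ok, Bool.and_eq_true] at hp
    obtain ⟨s₁, t₁, hE₁, ht₁, hv₁, ha₁⟩ := BExpr.exec_comp hd e hp.1 le_rfl s
    rw [h.1 1 (by omega)] at ht₁
    rw [BExpr.eval_congr hd e hp.1 h] at hv₁
    by_cases he : e.eval σ = 0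
    · obtain ⟨s₂, t₂, hE₂, ht₂, ha₂⟩ := ihq hp.2.2 (ha₁.symm.trans h)
      refine ⟨_, _, .seq hE₁ (.branchFalse (by simp [RamExpr.eval, hv₁, he]) hE₂), ?_, ?_⟩
      · simp [RamExpr.cost, cost]
        omega
      · simpa [den, he] using ha₂
    · obtain ⟨s₂, t₂, hE₂, ht₂, ha₂⟩ := ihp hp.2.1 (ha₁.symm.trans h)
      refine ⟨_, _, .seq hE₁ (.branchTrue (by simp [RamExpr.eval, hv₁, he]) hE₂), ?_, ?_⟩
      · simp [RamExpr.cost, cost]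
        omega
      · simpa [den, he] using ha₂
  | loop x p ih =>
    simp only [Ok, Bool.and_eq_true, decide_eq_true_eq, Bool.not_eq_true'] at hp
    obtain ⟨hx, hx1, hpx, hp⟩ := hp
    let iter : ℕ → RamState := fun i => Nat.rec σ (fun i τ => p.den (τ.setReg x i)) i
    have hiter : ∀ i, (iter i).reg 1 = σ.reg 1 := by
      intro i
      induction i with
      | zero => rfl
      | succ i ihi =>
        simpa [iter, den_reg p (writesReg_one_of_ok p hp), Ne.symm hx1] using ihi
    obtain ⟨s', t, hE, ht, ha⟩ := exec_countingLoop (x := x) (N := σ.reg 1)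
      (body := .seq (p.compile d) (.assign x (.add (.var x) (.lit 1))))
      (T := p.cost.eval (σ.reg 1) + 4)
      (fun i s => AgreeBelow d s ((iter i).setReg x i))
      (fun i s hs => ⟨by simpa [Ne.symm hx1, hiter] using hs.1 1 (by omega),
        by simpa using hs.1 x hx⟩)
      (fun i _ s hs => by
        obtain ⟨s', t, hE, ht, ha⟩ := ih hp hs
        -- The denotation sets the index afresh in each round, while the machine increments it. The
        -- two agree because the body does not write `x`.
        have hsx : s'.reg x = i := by
          rw [ha.1 x hx, den_reg p hpx]
          simp
        refine ⟨_, _, .seq hE (.assign _ _ _), ?_, ?_⟩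
        · simp only [reg_setReg, Ne.symm hx1, if_false, hiter] at ht
          simp [RamExpr.cost]
          omega
        · simp only [RamExpr.eval, hsx]
          exact ha.setReg _ _)
      (s := s.setReg x 0) (h.setReg x 0)
    refine ⟨s', _, .seq (.assign _ _ _) hE, ?_, ha⟩
    simp only [add_assoc, Nat.reduceAdd] at ht
    simp [RamExpr.cost, cost]
    omega

/-- The invariant rule for loops. The step may use that all registers and arrays that the loop never
writes still have their initial contents, so invariants need to mention only what changes. -/
theorem den_loop {x : ℕ} {p : BProg} {s : RamState} (I : ℕ → RamState → Prop)
    (h0 : I 0 s)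
    (hstep : ∀ i < s.reg 1, ∀ σ,
      (∀ y, (BProg.loop x p).WritesReg y = false → σ.reg y = s.reg y) →
      (∀ n, p.WritesArr n = false → σ.arr n = s.arr n) →
      I i σ → I (i + 1) (p.den (σ.setReg x i))) :
    ∃ σ, I (s.reg 1) σ ∧ (BProg.loop x p).den s = σ.setReg x (s.reg 1) := by
  refine ⟨_, ?_, rfl⟩
  have key : ∀ i ≤ s.reg 1, ∀ σ : RamState, σ = Nat.rec s (fun i σ => p.den (σ.setReg x i)) i →
      (∀ y, (BProg.loop x p).WritesReg y = false → σ.reg y = s.reg y) ∧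
      (∀ n, p.WritesArr n = false → σ.arr n = s.arr n) ∧ I i σ := by
    intro i
    induction i with
    | zero =>
      rintro - σ rfl
      exact ⟨fun _ _ => rfl, fun _ _ => rfl, h0⟩
    | succ i ih =>
      rintro hi σ rfl
      obtain ⟨h1, h2, h3⟩ := ih (by omega) _ rfl
      refine ⟨fun y hy => ?_, fun n hn => ?_, hstep i (by omega) _ h1 h2 h3⟩
      · rw [← h1 y hy]
        simp only [WritesReg, Bool.or_eq_false_iff, beq_eq_false_iff_ne] at hy
        simp [den_reg p hy.2, hy.1]
      · rw [← h2 n hn]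
        simp [den_arr p hn]
  exact (key _ le_rfl _ rfl).2.2

end BProg

/-! ### Logic and arithmetic in bounded expressions. -/

namespace BExpr

/-- An expression holds if its value is nonzero. -/
def Holds (s : RamState) (e : BExpr) : Prop := e.eval s ≠ 0

instance (s : RamState) (e : BExpr) : Decidable (e.Holds s) := instDecidableNot

/-- The strict order. -/
def lt (a b : BExpr) : BExpr := .cond (.sub b a) (.lit 1) (.lit 0)

/-- The order. -/
def le (a b : BExpr) : BExpr := .cond (.sub a b) (.lit 0) (.lit 1)

/-- Equality. -/
def eq (a b : BExpr) : BExpr := .cond (.sub a b) (.lit 0) (.cond (.sub b a) (.lit 0) (.lit 1))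

/-- Negation. -/
def neg (a : BExpr) : BExpr := .cond a (.lit 0) (.lit 1)

/-- Conjunction. -/
def and (a b : BExpr) : BExpr := .cond a (.cond b (.lit 1) (.lit 0)) (.lit 0)

/-- Implication. -/
def imp (a b : BExpr) : BExpr := .cond a (.cond b (.lit 1) (.lit 0)) (.lit 1)

/-- The sum of two bits modulo two. -/
def xor (a b : BExpr) : BExpr := .add (.sub a b) (.sub b a)

/-- The number of indices at which an expression holds. -/
def count (x : ℕ) (e : BExpr) : BExpr := .fold false x (.cond e (.lit 1) (.lit 0))

/-- The parity of the number of indices at which an expression holds. -/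
def parity (x : ℕ) (e : BExpr) : BExpr := .fold true x e

/-- Bounded universal quantification. -/
def all (x : ℕ) (e : BExpr) : BExpr := .neg (.count x (.neg e))

/-- Bounded existential quantification. -/
def ex (x : ℕ) (e : BExpr) : BExpr := .neg (.neg (.count x e))

/-- The product of two numbers, the first of which is at most the value of register `1`. -/
def mul (x : ℕ) (a b : BExpr) : BExpr := .fold false x (.cond (.lt (.var x) a) b (.lit 0))

variable (s : RamState)

@[simp] theorem eval_lit (n : ℕ) : (BExpr.lit n).eval s = n := rfl
@[simp] theorem eval_var (x : ℕ) : (BExpr.var x).eval s = s.reg x := rfl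
@[simp] theorem eval_add (a b : BExpr) : (BExpr.add a b).eval s = a.eval s + b.eval s := rfl
@[simp] theorem eval_sub (a b : BExpr) : (BExpr.sub a b).eval s = a.eval s - b.eval s := rfl
@[simp] theorem eval_get (n : ℕ) (e : BExpr) : (BExpr.get n e).eval s = s.arr n (e.eval s) := rfl

@[simp] theorem eval_cond (c a b : BExpr) :
    (BExpr.cond c a b).eval s = if c.Holds s then a.eval s else b.eval s := by
  by_cases h : c.eval s = 0 <;> simp [Holds, eval, h]

@[simp] theorem holds_var (x : ℕ) : (BExpr.var x).Holds s ↔ s.reg x ≠ 0 := Iff.rfl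
@[simp] theorem holds_get (n : ℕ) (e : BExpr) :
    (BExpr.get n e).Holds s ↔ s.arr n (e.eval s) ≠ 0 := Iff.rfl

@[simp] theorem eval_lt (a b : BExpr) :
    (lt a b).eval s = if a.eval s < b.eval s then 1 else 0 := by
  simp [lt, Holds, Nat.sub_ne_zero_iff_lt]

@[simp] theorem holds_lt (a b : BExpr) : (lt a b).Holds s ↔ a.eval s < b.eval s := by
  simp [Holds]

@[simp] theorem eval_le (a b : BExpr) :
    (le a b).eval s = if a.eval s ≤ b.eval s then 1 else 0 := by
  simp only [le, eval_cond, Holds, eval_sub, eval_lit, Nat.sub_ne_zero_iff_lt]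
  split_ifs <;> first | rfl | omega

@[simp] theorem holds_le (a b : BExpr) : (le a b).Holds s ↔ a.eval s ≤ b.eval s := by
  simp [Holds]

@[simp] theorem eval_eq (a b : BExpr) :
    (eq a b).eval s = if a.eval s = b.eval s then 1 else 0 := by
  simp only [eq, eval_cond, Holds, eval_sub, eval_lit, Nat.sub_ne_zero_iff_lt]
  split_ifs <;> first | rfl | omega

@[simp] theorem holds_eq (a b : BExpr) : (eq a b).Holds s ↔ a.eval s = b.eval s := by
  simp [Holds]

@[simp] theorem eval_neg (a : BExpr) : (neg a).eval s = if a.Holds s then 0 else 1 := by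
  simp [neg]

@[simp] theorem holds_neg (a : BExpr) : (neg a).Holds s ↔ ¬ a.Holds s := by
  rw [Holds, eval_neg]
  split_ifs <;> simp [*]

@[simp] theorem eval_and (a b : BExpr) :
    (and a b).eval s = if a.Holds s ∧ b.Holds s then 1 else 0 := by
  simp [and, ite_and]

@[simp] theorem holds_and (a b : BExpr) : (and a b).Holds s ↔ a.Holds s ∧ b.Holds s := by
  rw [Holds, eval_and]
  split_ifs <;> simp_all

@[simp] theorem holds_imp (a b : BExpr) : (imp a b).Holds s ↔ (a.Holds s → b.Holds s) := by
  rw [Holds, imp, eval_cond, eval_cond]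
  split_ifs <;> simp_all

theorem eval_xor {a b : BExpr} {α β : ZMod 2} (ha : a.eval s = α.val) (hb : b.eval s = β.val) :
    (xor a b).eval s = (α + β).val := by
  simp only [xor, eval_add, eval_sub, ha, hb]
  clear ha hb
  revert α β
  decide

@[simp] theorem eval_count (x : ℕ) (e : BExpr) : (count x e).eval s =
    ((Finset.range (s.reg 1)).filter fun i => e.Holds (s.setReg x i)).card := by
  rw [Finset.card_filter]
  simp only [count, eval]
  generalize s.reg 1 = N
  induction N with
  | zero => rfl
  | succ N ih =>
    rw [Finset.sum_range_succ, ← ih]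
    by_cases h : e.eval (s.setReg x N) = 0 <;> simp [foldStep, Holds, h]

@[simp] theorem eval_parity (x : ℕ) (e : BExpr) : (parity x e).eval s =
    ((Finset.range (s.reg 1)).filter fun i => e.Holds (s.setReg x i)).card % 2 := by
  rw [Finset.card_filter]
  simp only [parity, eval]
  generalize s.reg 1 = N
  induction N with
  | zero => rfl
  | succ N ih =>
    rw [Finset.sum_range_succ]
    change foldStep true (Nat.rec 0 _ N) _ = _
    rw [ih]
    by_cases h : e.eval (s.setReg x N) = 0
    · simp [foldStep, Holds, h]
    · simp only [foldStep, Holds, h, if_true, if_false, ne_eq, not_false_eq_true]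
      omega

@[simp] theorem holds_all (x : ℕ) (e : BExpr) :
    (all x e).Holds s ↔ ∀ i < s.reg 1, e.Holds (s.setReg x i) := by
  rw [all, holds_neg, Holds, eval_count]
  simp [Finset.card_eq_zero, Finset.filter_eq_empty_iff]

theorem eval_all (x : ℕ) (e : BExpr) [Decidable (∀ i < s.reg 1, e.Holds (s.setReg x i))] :
    (all x e).eval s = if ∀ i < s.reg 1, e.Holds (s.setReg x i) then 1 else 0 := by
  by_cases h : (all x e).eval s = 0
  · rw [h, if_neg]
    exact fun H => (holds_all s x e).2 H h
  · rw [if_pos ((holds_all s x e).1 h)]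
    rw [all, eval_neg] at h ⊢
    split_ifs at h ⊢
    · exact absurd rfl h
    · rfl

@[simp] theorem holds_ex (x : ℕ) (e : BExpr) :
    (ex x e).Holds s ↔ ∃ i < s.reg 1, e.Holds (s.setReg x i) := by
  rw [ex, holds_neg, holds_neg, Holds, eval_count]
  simp [Finset.card_eq_zero, Finset.filter_eq_empty_iff]

theorem holds_parity (x : ℕ) (e : BExpr) : (parity x e).Holds s ↔
    ((Finset.range (s.reg 1)).filter fun i => e.Holds (s.setReg x i)).card % 2 = 1 := by
  rw [Holds, eval_parity]
  omega

/-- The machine has no multiplication, so `v` is added once for each index below `u`. The factors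
must not depend on the index register. -/
theorem eval_mul {x : ℕ} {a b : BExpr} {u v : ℕ} (ha : ∀ i, a.eval (s.setReg x i) = u)
    (hb : ∀ i, b.eval (s.setReg x i) = v) (hu : u ≤ s.reg 1) :
    (mul x a b).eval s = u * v := by
  simp only [mul, eval]
  have key : ∀ N, Nat.rec (motive := fun _ => ℕ) 0
      (fun i r => foldStep false r (if (lt (var x) a).eval (s.setReg x i) = 0 then 0
        else b.eval (s.setReg x i))) N = min u N * v := by
    intro N
    induction N with
    | zero => simp
    | succ N ih =>
      change foldStep false (Nat.rec 0 _ N) _ = _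
      rw [ih]
      simp only [foldStep, eval_lt, eval_var, reg_setReg, ha, hb, if_true, Bool.false_eq_true,
        if_false]
      by_cases h : N < u
      · rw [if_pos h, if_neg one_ne_zero, min_eq_right h.le, min_eq_right h, Nat.succ_mul]
      · rw [if_neg h, if_pos rfl, min_eq_left (by omega), min_eq_left (by omega), add_zero]
  rw [key, min_eq_left hu]

end BExpr

/-! ### Parities as sums over the field with two elements, and least indices by counting. -/

theorem ZMod.eq_ite_of_two (x : ZMod 2) : x = if x ≠ 0 then 1 else 0 := by
  revert x
  decide

theorem ZMod.val_sum_of_two (n : ℕ) (f : ℕ → ZMod 2) {N : ℕ} (hn : n ≤ N) {p : ℕ → Prop}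
    [DecidablePred p] (hp : ∀ i < N, p i ↔ i < n ∧ f i ≠ 0) :
    ((Finset.range N).filter p).card % 2 = (∑ i ∈ Finset.range n, f i).val := by
  rw [← ZMod.val_natCast, Finset.natCast_card_filter]
  congr 1
  rw [← Finset.sum_subset (Finset.range_subset_range.2 hn)]
  · refine Finset.sum_congr rfl fun i hi => ?_
    rw [Finset.mem_range] at hi
    rw [ZMod.eq_ite_of_two (f i)]
    simp [hp i (by omega), hi]
  · intro i hi hi'
    rw [Finset.mem_range] at hi hi'
    simp [hp i hi, hi']

theorem BExpr.eval_parity_eq (s : RamState) {x : ℕ} {e : BExpr} (n : ℕ) (f : ℕ → ZMod 2)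
    (hn : n ≤ s.reg 1) (h : ∀ i < s.reg 1, e.Holds (s.setReg x i) ↔ i < n ∧ f i ≠ 0) :
    (BExpr.parity x e).eval s = (∑ i ∈ Finset.range n, f i).val := by
  rw [eval_parity]
  exact ZMod.val_sum_of_two n f hn h

/-- Counting the initial indices without a property finds the least index with the property. -/
theorem Finset.card_filter_initial {N p : ℕ} (Q : ℕ → Prop) (hp : p < N) (hQ : Q p)
    (hlt : ∀ j < p, ¬ Q j) {R : ℕ → Prop} [DecidablePred R]
    (hR : ∀ i < N, R i ↔ ∀ j < N, j ≤ i → ¬ Q j) : ((Finset.range N).filter R).card = p := by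
  have : (Finset.range N).filter R = Finset.range p := by
    ext i
    simp only [Finset.mem_filter, Finset.mem_range]
    constructor
    · rintro ⟨hi, h⟩
      by_contra hpi
      exact (hR i hi).1 h p hp (by omega) hQ
    · intro hi
      exact ⟨by omega, (hR i (by omega)).2 fun j _ hj => hlt j (by omega)⟩
  rw [this, Finset.card_range]

theorem Finset.card_filter_initial_of_forall_not {N : ℕ} (Q : ℕ → Prop) (hQ : ∀ j < N, ¬ Q j)
    {R : ℕ → Prop} [DecidablePred R] (hR : ∀ i < N, R i ↔ ∀ j < N, j ≤ i → ¬ Q j) :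
    ((Finset.range N).filter R).card = N := by
  rw [Finset.filter_true_of_mem, Finset.card_range]
  intro i hi
  exact (hR i (Finset.mem_range.1 hi)).2 fun j hj _ => hQ j hj

/-! ### Filling arrays. -/

namespace BProg

/-- Fill the cells of array `n` below the value of register `b`. -/
def tab (n x b : ℕ) (e : BExpr) : BProg :=
  .loop x (.ite (.lt (.var x) (.var b)) (.store n (.var x) e) .skip)

/-- Fill the cells `i * k + j` of array `n`, where `k` is the value of register `0`, for `i` below
the value of register `b` and `j < k`; the array `c` holds the multiples of `k`. -/
def tab₂ (n c x y b : ℕ) (e : BExpr) : BProg :=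
  .loop x (.loop y (.ite (.and (.lt (.var x) (.var b)) (.lt (.var y) (.var 0)))
    (.store n (.add (.get c (.var x)) (.var y)) e) .skip))

/-- When cell `i` is computed, the cells before it already hold `f` and the later ones are
untouched. The expression may thus refer to earlier cells of the same array, as the recursions for
powers of two, the sequence and the division do. -/
theorem den_tab {n x b : ℕ} {e : BExpr} {s : RamState} (hb : b ≠ x) (f : ℕ → ℕ)
    (hf : ∀ i < s.reg 1, i < s.reg b → ∀ σ : RamState, (∀ y, y ≠ x → σ.reg y = s.reg y) →
      (∀ n', n' ≠ n → σ.arr n' = s.arr n') → (∀ j, i ≤ j → σ.arr n j = s.arr n j) →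
      (∀ j < i, σ.arr n j = f j) → e.eval (σ.setReg x i) = f i)
    {i : ℕ} (hi : i < s.reg 1) (hib : i < s.reg b) : ((tab n x b e).den s).arr n i = f i := by
  obtain ⟨σ, ⟨h1, h2⟩, hσ⟩ := den_loop (x := x)
    (p := .ite (.lt (.var x) (.var b)) (.store n (.var x) e) .skip) (s := s)
    (fun i σ => (∀ j < i, j < s.reg b → σ.arr n j = f j) ∧ ∀ j, i ≤ j → σ.arr n j = s.arr n j)
    (by simp) (by
      rintro i hi σ hσ hσ' ⟨h1, h2⟩
      have hr : ∀ y, y ≠ x → σ.reg y = s.reg y := fun y hy => hσ y (by simpa [WritesReg] using hy)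
      have ha : ∀ n', n' ≠ n → σ.arr n' = s.arr n' :=
        fun y hy => hσ' y (by simpa [WritesArr] using hy)
      have hlt : (BExpr.lt (.var x) (.var b)).eval (σ.setReg x i) = if i < s.reg b then 1 else 0 := by
        simp [hb, hr]
      by_cases hib : i < s.reg b
      · have hv := hf i hi hib σ hr ha h2 (fun j hj => h1 j hj (by omega))
        simp only [den, hlt, if_pos hib, if_neg one_ne_zero, hv]
        constructor
        · intro j hj hjb
          by_cases hji : j = i
          · simp [hji]
          · simp [hji, h1 j (by omega) hjb]
        · intro j hj
          have : j ≠ i := by omega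
          simp [this, h2 j (by omega)]
      · simp only [den, hlt, if_neg hib, if_true]
        exact ⟨fun j hj hjb => h1 j (by omega) hjb, fun j hj => h2 j (by omega)⟩)
  rw [tab, hσ]
  exact h1 i hi hib

theorem mul_add_inj_of_lt {k q q' i i' : ℕ} (hi : i < k) (hi' : i' < k)
    (h : q * k + i = q' * k + i') : q = q' ∧ i = i' := by
  have hk : 0 < k := by omega
  have h1 := congrArg (· / k) h
  have h2 := congrArg (· % k) h
  simp only [mul_comm _ k, Nat.mul_add_div hk, Nat.div_eq_of_lt hi, Nat.div_eq_of_lt hi',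
    Nat.mul_add_mod, Nat.mod_eq_of_lt hi, Nat.mod_eq_of_lt hi', add_zero] at h1 h2
  exact ⟨h1, h2⟩

/-- When a cell is computed it still has its old content, which permits updating a matrix in place.
The pairs (row, column) are recovered from the cell number since the column is below `k`. -/
theorem den_tab₂ {n c x y b : ℕ} {e : BExpr} {s : RamState} (hxy : x ≠ y) (hcn : c ≠ n)
    (hx0 : x ≠ 0) (hy0 : y ≠ 0) (hx1 : x ≠ 1) (hy1 : y ≠ 1) (hbx : b ≠ x) (hby : b ≠ y)
    (hc : ∀ i < s.reg 1, s.arr c i = i * s.reg 0) (hk : s.reg 0 ≤ s.reg 1) (f : ℕ → ℕ → ℕ)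
    (hf : ∀ q < s.reg 1, q < s.reg b → ∀ i < s.reg 0, ∀ σ : RamState,
      (∀ z, z ≠ x → z ≠ y → σ.reg z = s.reg z) →
      (∀ n', n' ≠ n → σ.arr n' = s.arr n') → σ.reg x = q →
      σ.arr n (q * s.reg 0 + i) = s.arr n (q * s.reg 0 + i) → e.eval (σ.setReg y i) = f q i)
    {q i : ℕ} (hq : q < s.reg 1) (hqb : q < s.reg b) (hi : i < s.reg 0) :
    ((tab₂ n c x y b e).den s).arr n (q * s.reg 0 + i) = f q i := by
  set k := s.reg 0 with hkdef
  obtain ⟨σ, h1, hσ⟩ := den_loop (x := x)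
    (p := .loop y (.ite (.and (.lt (.var x) (.var b)) (.lt (.var y) (.var 0)))
      (.store n (.add (.get c (.var x)) (.var y)) e) .skip)) (s := s)
    (fun Q σ => ∀ q i, i < k → σ.arr n (q * k + i) =
      if q < Q ∧ q < s.reg b then f q i else s.arr n (q * k + i))
    (by simp) (by
      rintro Q hQ σ hσ hσ' h1
      have hr : ∀ z, z ≠ x → z ≠ y → σ.reg z = s.reg z :=
        fun z hz hz' => hσ z (by simpa [WritesReg] using ⟨hz, hz'⟩)
      have ha : ∀ n', n' ≠ n → σ.arr n' = s.arr n' :=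
        fun z hz => hσ' z (by simpa [WritesArr] using hz)
      have hN : (σ.setReg x Q).reg 1 = s.reg 1 := by simp [Ne.symm hx1, hr 1 hx1.symm hy1.symm]
      obtain ⟨τ, h2, hτ⟩ := den_loop (x := y)
        (p := .ite (.and (.lt (.var x) (.var b)) (.lt (.var y) (.var 0)))
          (.store n (.add (.get c (.var x)) (.var y)) e) .skip) (s := σ.setReg x Q)
        (fun I τ => ∀ q i, i < k → τ.arr n (q * k + i) =
          if (q < Q ∨ (q = Q ∧ i < I)) ∧ q < s.reg b then f q i else s.arr n (q * k + i))
        (by simpa using h1) (by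
          rintro I hI τ hτ hτ' h2
          rw [hN] at hI
          have hr' : ∀ z, z ≠ x → z ≠ y → τ.reg z = s.reg z := by
            intro z hz hz'
            rw [← hr z hz hz', hτ z (by simpa [WritesReg] using hz')]
            simp [hz]
          have hxQ : τ.reg x = Q := by
            rw [hτ x (by simpa [WritesReg] using hxy)]
            simp
          have ha' : ∀ n', n' ≠ n → τ.arr n' = s.arr n' := by
            intro z hz
            rw [← ha z hz, hτ' z (by simpa [WritesArr] using hz)]
            simp
          have hg : (BExpr.and (.lt (.var x) (.var b)) (.lt (.var y) (.var 0))).eval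
              (τ.setReg y I) = if Q < s.reg b ∧ I < k then 1 else 0 := by
            simp [hxy, hxQ, hby, hr' b hbx hby, Ne.symm hy0, hr' 0 hx0.symm hy0.symm, hkdef]
          by_cases hQI : Q < s.reg b ∧ I < k
          · have hv : e.eval (τ.setReg y I) = f Q I :=
              hf Q hQ hQI.1 I hQI.2 τ hr' ha' hxQ (by
                rw [h2 Q I hQI.2, if_neg (by simp)])
            have hidx : (BExpr.add (.get c (.var x)) (.var y)).eval (τ.setReg y I) =
                Q * k + I := by
              simp [hxy, hxQ, ha' c hcn, hc Q hQ, hkdef]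
            simp only [den, hg, if_pos hQI, if_neg one_ne_zero, hv, hidx]
            intro q i hi
            by_cases hqi : q * k + i = Q * k + I
            · obtain ⟨rfl, rfl⟩ := mul_add_inj_of_lt hi hQI.2 hqi
              simp [hQI.1]
            · have : ¬ (q = Q ∧ i = I) := by
                rintro ⟨rfl, rfl⟩
                exact hqi rfl
              simp only [arr_setCell, hqi, and_false, if_false, arr_setReg, h2 q i hi]
              congr 1
              apply propext
              constructor <;> rintro ⟨h, h'⟩ <;> refine ⟨?_, h'⟩ <;> omega
          · simp only [den, hg, if_neg hQI, if_true]
            intro q i hi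
            rw [arr_setReg, h2 q i hi]
            congr 1
            apply propext
            constructor <;> rintro ⟨h, h'⟩ <;> refine ⟨?_, h'⟩
            · omega
            · rcases h with h | ⟨rfl, h⟩
              · exact .inl h
              · right
                refine ⟨rfl, ?_⟩
                by_contra hiI
                have : i = I := by omega
                subst this
                exact hQI ⟨h', hi⟩)
      rw [hτ]
      intro q i hi
      rw [arr_setReg, h2 q i hi, hN]
      congr 1
      apply propext
      constructor <;> rintro ⟨h, h'⟩ <;> refine ⟨?_, h'⟩ <;> omega)
  rw [tab₂, hσ, arr_setReg, h1 q i hi, if_pos ⟨hq, hqb⟩]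

@[simp] theorem writesReg_tab (n x b y : ℕ) (e : BExpr) :
    (tab n x b e).WritesReg y = (y == x) := by
  simp [tab, WritesReg]

@[simp] theorem writesArr_tab (n x b n' : ℕ) (e : BExpr) :
    (tab n x b e).WritesArr n' = (n' == n) := by
  simp [tab, WritesArr]

end BProg

/-! ### Linear recurring sequences of maximal period. -/

/-- The linear recurring sequence over `𝔽₂` with initial values `0, …, 0, 1`, whose feedback
coefficients are the binary digits of `c`. -/
def lfsr (m c n : ℕ) : ZMod 2 :=
  if _h : n < m then (if n + 1 = m then 1 else 0)
  else ∑ l : Fin m, if c.testBit l then lfsr m c (n - m + l) else 0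
termination_by n

theorem lfsr_of_lt {m n : ℕ} (c : ℕ) (h : n < m) : lfsr m c n = if n + 1 = m then 1 else 0 := by
  rw [lfsr, dif_pos h]

theorem lfsr_add (m c n : ℕ) :
    lfsr m c (n + m) = ∑ l ∈ Finset.range m, if c.testBit l then lfsr m c (n + l) else 0 := by
  rw [lfsr, dif_neg (by omega), Finset.sum_range]
  simp

/-- The windows of length `m` return to the initial one after exactly `2 ^ m - 1` steps. -/
def LfsrPrimitive (m c : ℕ) : Prop :=
  (∀ i, 0 < i → i < 2 ^ m - 1 → ∃ l < m, lfsr m c (i + l) ≠ lfsr m c l) ∧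
    ∀ l < m, lfsr m c (2 ^ m - 1 + l) = lfsr m c l

/-- The `n`-th window of length `m` of a sequence. -/
def window (m : ℕ) (s : ℕ → ZMod 2) (n : ℕ) : Fin m → ZMod 2 := fun l => s (n + l)

/-- A sequence of period `2 ^ m - 1` whose windows of length `m` are, in each period, all nonzero
vectors, and are shifted by a linear map. -/
structure IsMSequence (m : ℕ) (s : ℕ → ZMod 2) : Prop where
  exists_shift : ∃ T : (Fin m → ZMod 2) →ₗ[ZMod 2] (Fin m → ZMod 2),
    ∀ n, T (window m s n) = window m s (n + 1)
  periodic : ∀ n, window m s (n + (2 ^ m - 1)) = window m s n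
  inj : ∀ i < 2 ^ m - 1, ∀ j < 2 ^ m - 1, window m s i = window m s j → i = j
  ne_zero : ∀ n, window m s n ≠ 0

namespace IsMSequence

variable {m : ℕ} {s : ℕ → ZMod 2}

/-- Pigeonhole: the windows of one period are 2^m - 1 different nonzero vectors. -/
theorem exists_window_eq (hs : IsMSequence m s) {v : Fin m → ZMod 2} (hv : v ≠ 0) :
    ∃ i < 2 ^ m - 1, window m s i = v := by
  have h1 : (Finset.range (2 ^ m - 1)).image (window m s) ⊆ Finset.univ.erase 0 := by
    intro v hv
    obtain ⟨i, -, rfl⟩ := Finset.mem_image.1 hv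
    simp [hs.ne_zero i]
  have h2 : (Finset.range (2 ^ m - 1)).image (window m s) = Finset.univ.erase 0 := by
    refine Finset.eq_of_subset_of_card_le h1 ?_
    rw [Finset.card_image_of_injOn]
    · simp [Finset.card_erase_of_mem]
    · intro i hi j hj h
      exact hs.inj i (by simpa using hi) j (by simpa using hj) h
  have h3 : v ∈ (Finset.range (2 ^ m - 1)).image (window m s) := by
    rw [h2]
    simp [hv]
  obtain ⟨i, hi, h⟩ := Finset.mem_image.1 h3
  exact ⟨i, by simpa using hi, h⟩

theorem window_mod (hs : IsMSequence m s) (n : ℕ) :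
    window m s (n % (2 ^ m - 1)) = window m s n := by
  have key : ∀ q, window m s (n % (2 ^ m - 1) + (2 ^ m - 1) * q) =
      window m s (n % (2 ^ m - 1)) := by
    intro q
    induction q with
    | zero => simp
    | succ q ih => rw [mul_add, mul_one, ← add_assoc, hs.periodic, ih]
  rw [← key (n / (2 ^ m - 1)), Nat.mod_add_div]

/-- The windows of such a sequence are the powers of a generator of the field with `2 ^ m`
elements, in suitable coordinates. -/
theorem exists_generator (hm : 1 ≤ m) (hs : IsMSequence m s) :
    ∃ (φ : GaloisField 2 m ≃ₗ[ZMod 2] (Fin m → ZMod 2)) (α : (GaloisField 2 m)ˣ),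
      (∀ β : (GaloisField 2 m)ˣ, β ∈ Subgroup.zpowers α) ∧
      ∀ n, φ ((α : GaloisField 2 m) ^ n) = window m s n := by
  obtain ⟨T, hT⟩ := hs.exists_shift
  have hTn : ∀ n, (T ^ n) (window m s 0) = window m s n := by
    intro n
    induction n with
    | zero => simp
    | succ n ih => rw [pow_succ', Module.End.mul_apply, ih, hT]
  have hk : 0 < 2 ^ m - 1 := by
    have : 2 ≤ 2 ^ m := Nat.pow_le_pow_right (n := 2) (by norm_num) hm
    omega
  -- The field is built as the algebra of polynomials in the shift `T`, and evaluation at the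
  -- initial window identifies it with the space of vectors. The class of X then corresponds to the
  -- shift.
  let ψ : (ZMod 2)[X] →ₐ[ZMod 2] Module.End (ZMod 2) (Fin m → ZMod 2) := aeval T
  let K := (ZMod 2)[X] ⧸ RingHom.ker ψ
  let ev : K →ₗ[ZMod 2] (Fin m → ZMod 2) :=
    (LinearMap.applyₗ (window m s 0)).comp (Ideal.kerLiftAlg ψ).toLinearMap
  have hev : ∀ p : (ZMod 2)[X], ev (Ideal.Quotient.mk _ p) = aeval T p (window m s 0) :=
    fun p => rfl
  let x : K := Ideal.Quotient.mk _ X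
  have hx : ∀ n, ev (x ^ n) = window m s n := by
    intro n
    rw [← map_pow, hev, map_pow, aeval_X, hTn]
  -- A polynomial in `T` that kills the initial window kills all windows, because it commutes with
  -- `T`. As the windows exhaust the nonzero vectors, it is zero.
  have hinj : Function.Injective ev := by
    rw [injective_iff_map_eq_zero]
    intro y hy
    obtain ⟨p, rfl⟩ := Ideal.Quotient.mk_surjective y
    rw [hev] at hy
    rw [Ideal.Quotient.eq_zero_iff_mem, RingHom.mem_ker]
    refine LinearMap.ext fun v => ?_
    by_cases hv : v = 0
    · simp [hv]
    obtain ⟨i, -, rfl⟩ := hs.exists_window_eq hv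
    rw [← hTn i, ← Module.End.mul_apply]
    have : ψ p * T ^ i = T ^ i * ψ p := by
      have h : T = ψ X := (aeval_X T).symm
      rw [h, ← map_pow, ← map_mul, ← map_mul, mul_comm]
    rw [this, Module.End.mul_apply]
    change (T ^ i) (aeval T p (window m s 0)) = 0
    rw [hy, map_zero]
  have hsurj : Function.Surjective ev := by
    intro v
    by_cases hv : v = 0
    · exact ⟨0, by simp [hv]⟩
    obtain ⟨i, -, rfl⟩ := hs.exists_window_eq hv
    exact ⟨x ^ i, hx i⟩
  have hxk : x ^ (2 ^ m - 1) = 1 := by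
    apply hinj
    rw [hx, ← pow_zero x, hx]
    simpa using hs.periodic 0
  have hpow : ∀ y : K, y ≠ 0 → ∃ i, y = x ^ i := by
    intro y hy
    obtain ⟨i, -, hi⟩ := hs.exists_window_eq (v := ev y) (by
      rwa [Ne, map_eq_zero_iff _ hinj])
    exact ⟨i, hinj (by rw [hx, hi])⟩
  have hfield : IsField K := by
    refine ⟨⟨0, 1, fun h => hs.ne_zero 0 ?_⟩, mul_comm, fun {y} hy => ?_⟩
    · rw [← hx 0, pow_zero, ← h, map_zero]
    · obtain ⟨i, rfl⟩ := hpow y hy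
      -- With k = 2^m - 1 and x^k = 1, the inverse of x^i is x^(i(k-1)).
      refine ⟨x ^ (i * (2 ^ m - 2)), ?_⟩
      rw [← pow_add, show i + i * (2 ^ m - 2) = (2 ^ m - 1) * i by
        rw [show 2 ^ m - 1 = 2 ^ m - 2 + 1 by omega]; ring, pow_mul, hxk, one_pow]
  have : (RingHom.ker ψ).IsMaximal := Ideal.Quotient.maximal_of_isField _ hfield
  let _ : Field K := Ideal.Quotient.field _
  let e : K ≃ₗ[ZMod 2] (Fin m → ZMod 2) := LinearEquiv.ofBijective ev ⟨hinj, hsurj⟩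
  have hcard : Nat.card K = 2 ^ m := by
    rw [Nat.card_congr e.toEquiv]
    simp
  let θ : K ≃ₐ[ZMod 2] GaloisField 2 m := GaloisField.algEquivGaloisField 2 m hcard
  have hx0 : x ≠ 0 := by
    intro h
    apply hs.ne_zero 1
    rw [← hx 1, pow_one, h, map_zero]
  refine ⟨θ.symm.toLinearEquiv.trans e, Units.mk0 (θ x) (by simpa using hx0), fun β => ?_,
    fun n => ?_⟩
  · obtain ⟨i, hi⟩ := hpow (θ.symm β) (by simp)
    refine Subgroup.mem_zpowers_iff.2 ⟨i, Units.ext ?_⟩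
    rw [zpow_natCast, Units.val_pow_eq_pow_val, Units.val_mk0, ← map_pow, ← hi,
      AlgEquiv.apply_symm_apply]
  · rw [Units.val_mk0, ← map_pow]
    change ev (θ.symm (θ (x ^ n))) = _
    rw [AlgEquiv.symm_apply_apply, hx]

end IsMSequence

/-- The companion map `T` of the recurrence moves each window to the next. Hence whatever holds at
the initial window is transported along the sequence, and the finite test in `LfsrPrimitive`
suffices. -/
theorem LfsrPrimitive.isMSequence {m c : ℕ} (hm : 1 ≤ m) (h : LfsrPrimitive m c) :
    IsMSequence m (lfsr m c) := by
  obtain ⟨h1, h2⟩ := h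
  have hk : 0 < 2 ^ m - 1 := by
    have : 2 ≤ 2 ^ m := Nat.pow_le_pow_right (n := 2) (by norm_num) hm
    omega
  let T : (Fin m → ZMod 2) →ₗ[ZMod 2] (Fin m → ZMod 2) :=
    { toFun := fun v l => if h : (l : ℕ) + 1 < m then v ⟨l + 1, h⟩
        else ∑ j : Fin m, if c.testBit j then v j else 0
      map_add' := by
        intro v w
        ext l
        by_cases h : (l : ℕ) + 1 < m
        · simp [h]
        · simp only [h, dif_neg, not_false_eq_true, Pi.add_apply, ← Finset.sum_add_distrib]
          refine Finset.sum_congr rfl fun j _ => ?_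
          split_ifs <;> simp
      map_smul' := by
        intro r w
        ext l
        by_cases h : (l : ℕ) + 1 < m
        · simp [h]
        · simp [h, Finset.mul_sum] }
  have hT : ∀ n, T (window m (lfsr m c) n) = window m (lfsr m c) (n + 1) := by
    intro n
    ext l
    change (if h : (l : ℕ) + 1 < m then _ else _) = _
    split_ifs with h
    · simp [window, add_assoc, add_comm 1]
    · have hl : n + 1 + (l : ℕ) = n + m := by omega
      simp [window, hl, lfsr_add, Finset.sum_range]
  have hTn : ∀ n i, (T ^ n) (window m (lfsr m c) i) = window m (lfsr m c) (i + n) := by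
    intro n
    induction n with
    | zero => simp
    | succ n ih =>
      intro i
      rw [pow_succ', Module.End.mul_apply, ih, hT, add_assoc]
  have hper0 : window m (lfsr m c) (2 ^ m - 1) = window m (lfsr m c) 0 := by
    ext l
    simpa [window] using h2 l l.2
  have hper : ∀ n, window m (lfsr m c) (n + (2 ^ m - 1)) = window m (lfsr m c) n := by
    intro n
    rw [add_comm, ← hTn, hper0, hTn, zero_add]
  have hw0 : window m (lfsr m c) 0 ≠ 0 := by
    intro h
    have := congrFun h ⟨m - 1, by omega⟩
    rw [window, lfsr_of_lt _ (by simp; omega), if_pos (by simp; omega)] at this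
    exact one_ne_zero this
  have hret : ∀ i, 0 < i → i < 2 ^ m - 1 → window m (lfsr m c) i ≠ window m (lfsr m c) 0 := by
    intro i hi hik h
    obtain ⟨l, hl, hne⟩ := h1 i hi hik
    apply hne
    simpa [window] using congrFun h ⟨l, hl⟩
  -- If windows i and j coincide, shifting both by k - i shows that the initial window already
  -- returns after k - (i - j) steps, which is too early.
  have hlt : ∀ i < 2 ^ m - 1, ∀ j < i, window m (lfsr m c) i ≠ window m (lfsr m c) j := by
    intro i hi j hj h
    apply hret (i + (2 ^ m - 1 - i) - (i - j)) (by omega) (by omega)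
    have := congrArg (T ^ (2 ^ m - 1 - i)) h
    rw [hTn, hTn, show i + (2 ^ m - 1 - i) = 2 ^ m - 1 by omega, hper0] at this
    rw [this]
    congr 1
    omega
  refine ⟨⟨T, hT⟩, hper, fun i hi j hj h => ?_, fun n hn => hw0 ?_⟩
  · rcases lt_trichotomy i j with hij | hij | hij
    · exact absurd h.symm (hlt j hj i hij)
    · exact hij
    · exact absurd h (hlt i hi j hij)
  -- A zero window would make all later ones zero, yet the nonzero initial window recurs at every
  -- multiple of the period.
  · have : ∀ q, window m (lfsr m c) ((2 ^ m - 1) * q) = window m (lfsr m c) 0 := by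
      intro q
      induction q with
      | zero => simp
      | succ q ih => rw [mul_add, mul_one, hper, ih]
    rw [← this n, show (2 ^ m - 1) * n = n + ((2 ^ m - 1) * n - n) by
      have := Nat.le_mul_of_pos_left n hk
      omega, ← hTn, hn, map_zero]

/-- For a generator β of the multiplicative group, the powers 1, β, …, β^(m-1) form a basis, and
expanding β^m in it gives the feedback coefficients. The sequence is n ↦ λ(β^n) for a coordinate
form λ, and its period is the order of β. -/
theorem exists_lfsrPrimitive_of_field {m : ℕ} (hm : 1 ≤ m) (F : Type) [Field F] [Finite F]
    [Algebra (ZMod 2) F] (hcard : Nat.card F = 2 ^ m) (hrank : Module.finrank (ZMod 2) F = m) :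
    ∃ c < 2 ^ m, LfsrPrimitive m c := by
  obtain ⟨β, hβ⟩ := IsCyclic.exists_generator (α := Fˣ)
  have hord : orderOf β = 2 ^ m - 1 := by
    rw [orderOf_eq_card_of_forall_mem_zpowers hβ, Nat.card_units, hcard]
  have hint : IsIntegral (ZMod 2) (β : F) := IsIntegral.of_finite _ _
  have htop : Algebra.adjoin (ZMod 2) {(β : F)} = ⊤ := by
    rw [eq_top_iff]
    rintro y -
    by_cases hy : y = 0
    · rw [hy]
      exact zero_mem _
    · obtain ⟨n, hn⟩ := mem_powers_iff_mem_zpowers.2 (hβ (Units.mk0 y hy))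
      have : y = (β : F) ^ n := by
        rw [← Units.val_pow_eq_pow_val]
        exact (congrArg Units.val hn).symm
      rw [this]
      exact Subalgebra.pow_mem _ (Algebra.subset_adjoin (Set.mem_singleton _)) n
  obtain ⟨pb, hgen⟩ : ∃ pb : PowerBasis (ZMod 2) F, pb.gen = β :=
    ⟨_, PowerBasis.ofAdjoinEqTop_gen hint htop⟩
  have hdim : pb.dim = m := by
    rw [← pb.finrank, hrank]
  let b : Module.Basis (Fin m) (ZMod 2) F := pb.basis.reindex (finCongr hdim)
  have hb : ∀ l, b l = (β : F) ^ (l : ℕ) := by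
    intro l
    simp [b, hgen]
  let c : ℕ := Nat.ofBits fun l : Fin m => decide (b.repr ((β : F) ^ m) l ≠ 0)
  have hc : ∀ l : Fin m, c.testBit l = decide (b.repr ((β : F) ^ m) l ≠ 0) :=
    fun l => Nat.testBit_ofBits_lt _ _ l.2
  have hrec : (β : F) ^ m =
      ∑ l : Fin m, if c.testBit l then (β : F) ^ (l : ℕ) else 0 := by
    conv_lhs => rw [← b.sum_repr ((β : F) ^ m)]
    refine Finset.sum_congr rfl fun l _ => ?_
    rw [hc, hb]
    generalize b.repr ((β : F) ^ m) l = z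
    have : z = 0 ∨ z = 1 := by
      revert z
      decide
    rcases this with rfl | rfl <;> simp
  -- The coordinate at β^(m-1) takes the values 0, …, 0, 1 on the basis, which are the prescribed
  -- initial values.
  let top : Fin m := ⟨m - 1, by omega⟩
  let lam := b.coord top
  have hlam : ∀ n, lfsr m c n = lam ((β : F) ^ n) := by
    intro n
    induction n using Nat.strong_induction_on with
    | _ n ih =>
      by_cases hn : n < m
      · rw [lfsr_of_lt _ hn, show (β : F) ^ n = b ⟨n, hn⟩ by rw [hb]]
        simp only [lam, Module.Basis.coord_apply, Module.Basis.repr_self, Finsupp.single_apply, top,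
          Fin.mk.injEq]
        congr 1
        apply propext
        omega
      · obtain ⟨j, rfl⟩ : ∃ j, n = j + m := ⟨n - m, by omega⟩
        rw [lfsr_add, pow_add, hrec, Finset.mul_sum, map_sum, Finset.sum_range]
        refine Finset.sum_congr rfl fun l _ => ?_
        split_ifs
        · rw [ih _ (by omega), pow_add]
        · simp
  have hpow : (β : F) ^ (2 ^ m - 1) = 1 := by
    rw [← Units.val_pow_eq_pow_val, ← hord, pow_orderOf_eq_one, Units.val_one]
  refine ⟨c, Nat.ofBits_lt_two_pow _, fun i hi hik => ?_, fun l _ => ?_⟩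
  · by_contra! hcon
    set y : F := (β : F) ^ i - 1 with hy
    have hy0 : y ≠ 0 := by
      intro h0
      have : β ^ i = 1 := by
        apply Units.ext
        rw [Units.val_pow_eq_pow_val, Units.val_one]
        exact sub_eq_zero.1 h0
      have := Nat.le_of_dvd hi (orderOf_dvd_of_pow_eq_one this)
      omega
    -- An early return at step i would mean that λ vanishes on all (β^i - 1)β^l with l < m. As β^i -
    -- 1 is invertible, λ would be zero.
    have hzero : lam.comp (LinearMap.mulLeft (ZMod 2) y) = 0 := by
      refine b.ext fun l => ?_
      rw [LinearMap.comp_apply, LinearMap.mulLeft_apply, hb, hy, sub_mul, one_mul, ← pow_add,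
        map_sub, ← hlam, ← hlam, hcon l l.2, sub_self, LinearMap.zero_apply]
    have := LinearMap.congr_fun hzero (y⁻¹ * b top)
    rw [LinearMap.comp_apply, LinearMap.mulLeft_apply, mul_inv_cancel_left₀ hy0] at this
    simp [lam] at this
  · rw [hlam, hlam, pow_add, hpow, one_mul]

theorem exists_lfsrPrimitive {m : ℕ} (hm : 1 ≤ m) : ∃ c < 2 ^ m, LfsrPrimitive m c := by
  have hcard := GaloisField.card 2 m (by omega)
  have : Finite (GaloisField 2 m) := Nat.finite_of_card_ne_zero (by rw [hcard]; positivity)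
  exact exists_lfsrPrimitive_of_field hm _ hcard (GaloisField.finrank 2 (by omega))

/-! ### Reed-Muller codes as spaces of functions -/

theorem mem_reedMuller {r m : ℕ} {F : (Fin m → ZMod 2) → ZMod 2} :
    F ∈ reedMuller r m ↔
      ∃ p : MvPolynomial (Fin m) (ZMod 2), p.totalDegree ≤ r ∧ ∀ x, MvPolynomial.eval x p = F x := by
  simp only [reedMuller, Submodule.mem_map, MvPolynomial.mem_restrictTotalDegree, funext_iff,
    MvPolynomial.evalₗ_apply]

theorem reedMuller_mono {r r' m : ℕ} (h : r ≤ r') : reedMuller r m ≤ reedMuller r' m := by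
  intro F hF
  obtain ⟨p, hp, h'⟩ := mem_reedMuller.1 hF
  exact mem_reedMuller.2 ⟨p, hp.trans h, h'⟩

theorem mul_mem_reedMuller {r r' m : ℕ} {F G : (Fin m → ZMod 2) → ZMod 2}
    (hF : F ∈ reedMuller r m) (hG : G ∈ reedMuller r' m) : F * G ∈ reedMuller (r + r') m := by
  obtain ⟨p, hp, hpF⟩ := mem_reedMuller.1 hF
  obtain ⟨q, hq, hqG⟩ := mem_reedMuller.1 hG
  refine mem_reedMuller.2 ⟨p * q, (MvPolynomial.totalDegree_mul _ _).trans (add_le_add hp hq), ?_⟩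
  simp [hpF, hqG]

theorem const_mem_reedMuller (r m : ℕ) (a : ZMod 2) : (fun _ => a) ∈ reedMuller r m :=
  mem_reedMuller.2 ⟨MvPolynomial.C a, by simp, by simp⟩

theorem coord_mem_reedMuller {m : ℕ} (l : Fin m) : (fun x => x l) ∈ reedMuller 1 m :=
  mem_reedMuller.2 ⟨MvPolynomial.X l, by simp, by simp⟩

theorem prod_mem_reedMuller {m : ℕ} {ι : Type*} (S : Finset ι)
    (F : ι → (Fin m → ZMod 2) → ZMod 2) (hF : ∀ l ∈ S, F l ∈ reedMuller 1 m) :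
    ∏ l ∈ S, F l ∈ reedMuller S.card m := by
  classical
  induction S using Finset.induction_on with
  | empty => exact const_mem_reedMuller 0 m 1
  | insert l S hl ih =>
    rw [Finset.prod_insert hl, Finset.card_insert_of_notMem hl, add_comm]
    exact mul_mem_reedMuller (hF l (Finset.mem_insert_self l S))
      (ih fun j hj => hF j (Finset.mem_insert_of_mem hj))

/-- The function `∏ x_l`, `l ∈ S`. -/
def monomialFun {m : ℕ} (S : Finset (Fin m)) : (Fin m → ZMod 2) → ZMod 2 :=
  ∏ l ∈ S, fun x => x l

@[simp] theorem monomialFun_apply {m : ℕ} (S : Finset (Fin m)) (x : Fin m → ZMod 2) :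
    monomialFun S x = ∏ l ∈ S, x l := by
  simp [monomialFun]

theorem monomialFun_mem_reedMuller {r m : ℕ} {S : Finset (Fin m)} (hS : S.card ≤ r) :
    monomialFun S ∈ reedMuller r m :=
  reedMuller_mono hS (prod_mem_reedMuller S _ fun l _ => coord_mem_reedMuller l)

/-- Since x² = x on F_2, each monomial agrees as a function with the squarefree one on its support,
whose degree is no larger. -/
theorem reedMuller_eq_span (r m : ℕ) :
    reedMuller r m = Submodule.span (ZMod 2)
      (monomialFun '' {S : Finset (Fin m) | S.card ≤ r}) := by
  apply le_antisymm
  · intro F hF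
    obtain ⟨p, hp, hpF⟩ := mem_reedMuller.1 hF
    have : F = ∑ d ∈ p.support, p.coeff d • monomialFun d.support := by
      funext x
      rw [← hpF, MvPolynomial.eval_eq]
      simp only [Finset.sum_apply, Pi.smul_apply, monomialFun_apply, smul_eq_mul]
      refine Finset.sum_congr rfl fun d _ => ?_
      congr 1
      refine Finset.prod_congr rfl fun i hi => ?_
      have hi' : d i ≠ 0 := by simpa using hi
      have hx : x i = 0 ∨ x i = 1 := by
        generalize x i = z
        revert z
        decide
      rcases hx with h | h <;> simp [h, hi']
    rw [this]
    refine Submodule.sum_mem _ fun d hd => Submodule.smul_mem _ _ (Submodule.subset_span ⟨_, ?_, rfl⟩)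
    refine le_trans ?_ ((MvPolynomial.le_totalDegree hd).trans hp)
    rw [Finset.card_eq_sum_ones, Finsupp.sum]
    exact Finset.sum_le_sum fun i hi => Nat.one_le_iff_ne_zero.2 (by simpa using hi)
  · rw [Submodule.span_le]
    rintro _ ⟨S, hS, rfl⟩
    exact monomialFun_mem_reedMuller hS

/-- A linear substitution turns each coordinate into a linear form and so does not raise the degree.
This invariance is what makes the dual code cyclic. -/
theorem comp_linearMap_mem_reedMuller {r m : ℕ} {F : (Fin m → ZMod 2) → ZMod 2}
    (hF : F ∈ reedMuller r m) (T : (Fin m → ZMod 2) →ₗ[ZMod 2] (Fin m → ZMod 2)) :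
    (fun x => F (T x)) ∈ reedMuller r m := by
  rw [reedMuller_eq_span] at hF
  induction hF using Submodule.span_induction with
  | mem F hF =>
    obtain ⟨S, hS, rfl⟩ := hF
    have h : (fun x => monomialFun S (T x)) = ∏ l ∈ S, fun x => T x l := by
      funext x
      simp
    rw [h]
    refine reedMuller_mono hS (prod_mem_reedMuller S _ fun l _ => ?_)
    have hl : (fun x => T x l) =
        ∑ j, T (fun i => if j = i then 1 else 0) l • fun x : Fin m → ZMod 2 => x j := by
      funext x
      rw [LinearMap.pi_apply_eq_sum_univ T x]
      simp [mul_comm]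
    rw [hl]
    exact Submodule.sum_mem _ fun j _ => Submodule.smul_mem _ _ (coord_mem_reedMuller j)
  | zero => exact Submodule.zero_mem _
  | add F G _ _ hF hG => exact Submodule.add_mem _ hF hG
  | smul a F _ hF => exact Submodule.smul_mem _ a hF

/-! ### Words and polynomials -/

theorem coeff_wordPoly {F : Type*} [Field F] {n : ℕ} (c : Fin n → F) (i : Fin n) :
    (wordPoly c).coeff i = c i := by
  simp only [wordPoly, finsetSum_coeff, coeff_C_mul, coeff_X_pow]
  simp [Fin.val_inj]

theorem degree_wordPoly_lt {F : Type*} [Field F] {n : ℕ} (c : Fin n → F) :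
    (wordPoly c).degree < n := by
  refine (degree_sum_le _ _).trans_lt ((Finset.sup_lt_iff (by simp)).2 fun i _ => ?_)
  exact (degree_C_mul_X_pow_le _ _).trans_lt (by simp)

theorem wordPoly_injective {F : Type*} [Field F] {n : ℕ} :
    Function.Injective (wordPoly (F := F) (n := n)) := by
  intro c c' h
  funext i
  rw [← coeff_wordPoly c, h, coeff_wordPoly]

theorem wordPoly_coeff {F : Type*} [Field F] {n : ℕ} {f : F[X]} (hf : f.degree < n) :
    wordPoly (fun i : Fin n => f.coeff i) = f := by
  rw [wordPoly, ← Finset.sum_range (fun i => C (f.coeff i) * X ^ i)]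
  by_cases h : f = 0
  · simp [h]
  · exact (f.as_sum_range_C_mul_X_pow' ((natDegree_lt_iff_degree_lt h).2 hf)).symm

theorem degree_X_pow_sub_one {F : Type*} [Field F] {n : ℕ} (hn : 0 < n) :
    (X ^ n - 1 : F[X]).degree = n := by
  simpa using degree_X_pow_sub_C hn (1 : F)

theorem monic_X_pow_sub_one {F : Type*} [Field F] {n : ℕ} (hn : 0 < n) :
    (X ^ n - 1 : F[X]).Monic := by
  simpa using monic_X_pow_sub_C (1 : F) hn.ne'

theorem wordPoly_dvd_iff {F : Type*} [Field F] {n : ℕ} (hn : 0 < n) (c : Fin n → F) :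
    (X ^ n - 1 : F[X]) ∣ wordPoly c ↔ c = 0 := by
  constructor
  · intro h
    have := eq_zero_of_dvd_of_degree_lt h (by
      rw [degree_X_pow_sub_one hn]
      exact degree_wordPoly_lt c)
    apply wordPoly_injective
    rw [this]
    simp [wordPoly]
  · rintro rfl
    simp [wordPoly]

theorem X_pow_sub_one_dvd_X_pow_sub_X_pow_mod {F : Type*} [Field F] (n N : ℕ) :
    (X ^ n - 1 : F[X]) ∣ X ^ N - X ^ (N % n) := by
  have h : (X ^ N - X ^ (N % n) : F[X]) = X ^ (N % n) * ((X ^ n) ^ (N / n) - 1 ^ (N / n)) := by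
    rw [one_pow, mul_sub, mul_one, ← pow_mul, ← pow_add, Nat.mod_add_div]
  rw [h]
  exact Dvd.dvd.mul_left (sub_dvd_pow_sub_pow _ _ _) _

/-- Multiplication by a circulant matrix is multiplication of polynomials modulo `x ^ n - 1`. -/
theorem X_pow_sub_one_dvd_circulant {F : Type*} [Field F] {n : ℕ} [NeZero n] (a u : Fin n → F) :
    (X ^ n - 1 : F[X]) ∣
      wordPoly a * wordPoly u - wordPoly ((Matrix.circulant a).mulVec u) := by
  have h1 : wordPoly a * wordPoly u =
      ∑ j, ∑ i, C (a i * u j) * X ^ ((i : ℕ) + (j : ℕ)) := by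
    rw [wordPoly, wordPoly, Finset.sum_mul_sum, Finset.sum_comm]
    refine Finset.sum_congr rfl fun j _ => Finset.sum_congr rfl fun i _ => ?_
    rw [C_mul, pow_add]
    ring
  have h2 : wordPoly ((Matrix.circulant a).mulVec u) =
      ∑ j, ∑ i, C (a i * u j) * X ^ (((i : ℕ) + (j : ℕ)) % n) := by
    simp only [wordPoly, Matrix.mulVec, dotProduct, Matrix.circulant_apply, map_sum,
      Finset.sum_mul]
    rw [Finset.sum_comm]
    refine Finset.sum_congr rfl fun j _ => ?_
    rw [← Equiv.sum_comp (Equiv.addRight j)]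
    refine Finset.sum_congr rfl fun i _ => ?_
    simp [Fin.val_add]
  rw [h1, h2, ← Finset.sum_sub_distrib]
  refine Finset.dvd_sum fun j _ => ?_
  rw [← Finset.sum_sub_distrib]
  refine Finset.dvd_sum fun i _ => ?_
  rw [← mul_sub]
  exact Dvd.dvd.mul_left (X_pow_sub_one_dvd_X_pow_sub_X_pow_mod _ _) _

/-! ### The ideal of the dual of a punctured Reed-Muller code -/

/-- The linear form `∑ f_n x^n ↦ ∑ f_n F(w_n)`, where `w_n` are the windows of a sequence. -/
noncomputable def windowPairing (m : ℕ) (s : ℕ → ZMod 2) (F : (Fin m → ZMod 2) → ZMod 2) :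
    (ZMod 2)[X] →ₗ[ZMod 2] ZMod 2 :=
  Polynomial.lsum fun n => LinearMap.mulRight (ZMod 2) (F (window m s n))

theorem windowPairing_C_mul_X_pow (m : ℕ) (s : ℕ → ZMod 2) (F : (Fin m → ZMod 2) → ZMod 2)
    (a : ZMod 2) (n : ℕ) : windowPairing m s F (C a * X ^ n) = a * F (window m s n) := by
  rw [windowPairing, Polynomial.lsum_apply, C_mul_X_pow_eq_monomial, Polynomial.sum_monomial_index]
  · simp
  · simp

theorem windowPairing_wordPoly (m : ℕ) (s : ℕ → ZMod 2) (F : (Fin m → ZMod 2) → ZMod 2)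
    {n : ℕ} (c : Fin n → ZMod 2) (b : ℕ) :
    windowPairing m s F (X ^ b * wordPoly c) = ∑ i, c i * F (window m s (i + b)) := by
  rw [wordPoly, Finset.mul_sum, map_sum]
  refine Finset.sum_congr rfl fun i _ => ?_
  rw [← windowPairing_C_mul_X_pow, pow_add]
  congr 1
  ring

namespace IsMSequence

variable {m : ℕ} {s : ℕ → ZMod 2}

/-- The polynomials `∑ c_n x^n` with `∑ c_n F(w_n) = 0` for all `F` in the Reed-Muller code. -/
noncomputable def dualIdeal (hs : IsMSequence m s) (r : ℕ) : Ideal (ZMod 2)[X] where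
  carrier := {f | ∀ F ∈ reedMuller r m, windowPairing m s F f = 0}
  zero_mem' := fun F _ => map_zero _
  add_mem' := by
    intro f g hf hg F hF
    rw [map_add, hf F hF, hg F hF, add_zero]
  smul_mem' := by
    obtain ⟨T, hT⟩ := hs.exists_shift
    -- Multiplication by X moves every coefficient to the next window. This amounts to replacing F
    -- by F ∘ T, which is again in the Reed-Muller code.
    have hX : ∀ F, ∀ f : (ZMod 2)[X],
        windowPairing m s F (X * f) = windowPairing m s (fun x => F (T x)) f := by
      intro F f
      induction f using Polynomial.induction_on' with
      | add f g hf hg => rw [mul_add, map_add, hf, hg, map_add]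
      | monomial n a =>
        rw [← C_mul_X_pow_eq_monomial, windowPairing_C_mul_X_pow, hT, ← windowPairing_C_mul_X_pow]
        congr 1
        ring
    have hXn : ∀ (n : ℕ) (f : (ZMod 2)[X]), (∀ F ∈ reedMuller r m, windowPairing m s F f = 0) →
        ∀ F ∈ reedMuller r m, windowPairing m s F (X ^ n * f) = 0 := by
      intro n
      induction n with
      | zero => simp
      | succ n ih =>
        intro f hf F hF
        rw [pow_succ', mul_assoc, hX]
        exact ih f hf _ (comp_linearMap_mem_reedMuller hF T)
    intro p f hf F hF
    rw [smul_eq_mul]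
    induction p using Polynomial.induction_on' with
    | add p q hp hq => rw [add_mul, map_add, hp, hq, add_zero]
    | monomial n a =>
      rw [← C_mul_X_pow_eq_monomial, mul_assoc, C_mul', map_smul, hXn n f hf F hF, smul_zero]

theorem mem_dualIdeal (hs : IsMSequence m s) {r : ℕ} {f : (ZMod 2)[X]} :
    f ∈ hs.dualIdeal r ↔ ∀ F ∈ reedMuller r m, windowPairing m s F f = 0 := Iff.rfl

theorem wordPoly_mem_dualIdeal_iff (hs : IsMSequence m s) {r n : ℕ} (c : Fin n → ZMod 2) :
    wordPoly c ∈ hs.dualIdeal r ↔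
      ∀ S : Finset (Fin m), S.card ≤ r → ∑ i, c i * monomialFun S (window m s i) = 0 := by
  have hw : ∀ F, windowPairing m s F (wordPoly c) = ∑ i, c i * F (window m s i) := by
    intro F
    simpa using windowPairing_wordPoly m s F c 0
  simp only [mem_dualIdeal, hw]
  constructor
  · exact fun h S hS => h _ (monomialFun_mem_reedMuller hS)
  · intro h F hF
    rw [reedMuller_eq_span] at hF
    induction hF using Submodule.span_induction with
    | mem F hF =>
      obtain ⟨S, hS, rfl⟩ := hF
      exact h S hS
    | zero => simp
    | add F G _ _ hF hG => simp [mul_add, Finset.sum_add_distrib, hF, hG]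
    | smul a F _ hF => simp [mul_left_comm _ a, ← Finset.mul_sum, hF]

theorem X_pow_sub_one_mem_dualIdeal (hs : IsMSequence m s) (r : ℕ) :
    X ^ (2 ^ m - 1) - 1 ∈ hs.dualIdeal r := by
  intro F _
  have h := hs.periodic 0
  rw [zero_add] at h
  have h1 := windowPairing_C_mul_X_pow m s F 1 (2 ^ m - 1)
  have h2 := windowPairing_C_mul_X_pow m s F 1 0
  simp only [map_one, one_mul, pow_zero] at h1 h2
  rw [map_sub, h1, h2, h, sub_self]

theorem exists_generatorPoly (hm : 1 ≤ m) (hs : IsMSequence m s) (r : ℕ) :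
    ∃ g : (ZMod 2)[X], g.Monic ∧ ∀ f, f ∈ hs.dualIdeal r ↔ g ∣ f := by
  have hk : 0 < 2 ^ m - 1 := by
    have : 2 ≤ 2 ^ m := Nat.pow_le_pow_right (n := 2) (by norm_num) hm
    omega
  have hdvd : ∀ f, f ∈ hs.dualIdeal r ↔ Submodule.IsPrincipal.generator (hs.dualIdeal r) ∣ f :=
    fun f => Submodule.IsPrincipal.mem_iff_generator_dvd _
  refine ⟨_, ?_, hdvd⟩
  -- The ideal contains x^k - 1, so its generator is nonzero. Over F_2 a nonzero leading coefficient
  -- is 1.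
  have h0 : Submodule.IsPrincipal.generator (hs.dualIdeal r) ≠ 0 := by
    intro h0
    have := (hdvd _).1 (hs.X_pow_sub_one_mem_dualIdeal r)
    rw [h0, zero_dvd_iff] at this
    exact (monic_X_pow_sub_one hk).ne_zero this
  have h1 := leadingCoeff_ne_zero.2 h0
  rw [Monic]
  revert h1
  generalize (Submodule.IsPrincipal.generator (hs.dualIdeal r)).leadingCoeff = z
  revert z
  decide

/-- The generator polynomial of the dual of the punctured Reed-Muller code. -/
noncomputable def generatorPoly (hm : 1 ≤ m) (hs : IsMSequence m s) (r : ℕ) : (ZMod 2)[X] :=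
  (hs.exists_generatorPoly hm r).choose

theorem monic_generatorPoly (hm : 1 ≤ m) (hs : IsMSequence m s) (r : ℕ) :
    (hs.generatorPoly hm r).Monic :=
  (hs.exists_generatorPoly hm r).choose_spec.1

theorem generatorPoly_dvd_iff (hm : 1 ≤ m) (hs : IsMSequence m s) {r : ℕ} {f : (ZMod 2)[X]} :
    hs.generatorPoly hm r ∣ f ↔ f ∈ hs.dualIdeal r :=
  ((hs.exists_generatorPoly hm r).choose_spec.2 f).symm

/-- The first column of the circulant matrix: the coefficients of the generator polynomial modulo
`x ^ k - 1`. -/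
noncomputable def column (hm : 1 ≤ m) (hs : IsMSequence m s) (r : ℕ) :
    Fin (2 ^ m - 1) → ZMod 2 :=
  fun i => (hs.generatorPoly hm r %ₘ (X ^ (2 ^ m - 1) - 1)).coeff i

theorem isDualRMColumn_column (hm : 1 ≤ m) (hs : IsMSequence m s) :
    IsDualRMColumn m (hs.column hm (m / 2)) := by
  obtain ⟨φ, α, hα, hφ⟩ := hs.exists_generator hm
  refine ⟨φ, α, hs.generatorPoly hm (m / 2), hα, ⟨hs.monic_generatorPoly hm _,
    (hs.generatorPoly_dvd_iff hm).2 (hs.X_pow_sub_one_mem_dualIdeal _), fun c => ?_⟩,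
    fun i => rfl⟩
  rw [hs.generatorPoly_dvd_iff hm, mem_dualIdeal]
  have hw : ∀ F, windowPairing m s F (wordPoly c) = ∑ i, c i * F (window m s i) := by
    intro F
    simpa using windowPairing_wordPoly m s F c 0
  simp only [hw]
  constructor
  · intro h F hF
    have := h _ (Submodule.mem_map_of_mem (f := LinearMap.funLeft (ZMod 2) (ZMod 2)
      fun i : Fin (2 ^ m - 1) => φ ((α : GaloisField 2 m) ^ (i : ℕ))) hF)
    simpa [LinearMap.funLeft_apply, hφ] using this
  · rintro h _ ⟨F, hF, rfl⟩
    simpa [LinearMap.funLeft_apply, hφ] using h F hF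

theorem wordPoly_column (hm : 1 ≤ m) (hs : IsMSequence m s) (r : ℕ) :
    wordPoly (hs.column hm r) = hs.generatorPoly hm r %ₘ (X ^ (2 ^ m - 1) - 1) := by
  have hk : 0 < 2 ^ m - 1 := by
    have : 2 ≤ 2 ^ m := Nat.pow_le_pow_right (n := 2) (by norm_num) hm
    omega
  refine wordPoly_coeff ?_
  rw [← degree_X_pow_sub_one (F := ZMod 2) hk]
  exact degree_modByMonic_lt _ (monic_X_pow_sub_one hk)

theorem dvd_generatorPoly_sub_column (hm : 1 ≤ m) (hs : IsMSequence m s) (r : ℕ) :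
    (X ^ (2 ^ m - 1) - 1 : (ZMod 2)[X]) ∣ hs.generatorPoly hm r - wordPoly (hs.column hm r) := by
  rw [wordPoly_column]
  exact ⟨_, by rw [sub_eq_iff_eq_add, add_comm, modByMonic_add_div]⟩

theorem column_mem_dualIdeal (hm : 1 ≤ m) (hs : IsMSequence m s) (r : ℕ) :
    wordPoly (hs.column hm r) ∈ hs.dualIdeal r := by
  have h1 : hs.generatorPoly hm r ∈ hs.dualIdeal r := (hs.generatorPoly_dvd_iff hm).1 dvd_rfl
  have h2 := Ideal.mem_of_dvd _ (hs.dvd_generatorPoly_sub_column hm r)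
    (hs.X_pow_sub_one_mem_dualIdeal r)
  simpa using sub_mem h1 h2

/-- Up to a multiple of x^k - 1, which lies in the ideal, the circulant matrix multiplies by g. Thus
the second half of every codeword lies in the dual code. -/
theorem circulant_mem_dualIdeal [NeZero (2 ^ m - 1)] (hm : 1 ≤ m) (hs : IsMSequence m s) (r : ℕ)
    (u : Fin (2 ^ m - 1) → ZMod 2) :
    wordPoly ((Matrix.circulant (hs.column hm r)).mulVec u) ∈ hs.dualIdeal r := by
  have h1 := Ideal.mul_mem_right (wordPoly u) _ (hs.column_mem_dualIdeal hm r)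
  have h2 := Ideal.mem_of_dvd _ (X_pow_sub_one_dvd_circulant (hs.column hm r) u)
    (hs.X_pow_sub_one_mem_dualIdeal r)
  simpa using sub_mem h1 h2

/-- The words of the dual code, as circulant matrices, annihilate the kernel of the circulant
matrix of the generator polynomial. -/
theorem circulant_mulVec_eq_zero [NeZero (2 ^ m - 1)] (hm : 1 ≤ m) (hs : IsMSequence m s) {r : ℕ}
    {u y : Fin (2 ^ m - 1) → ZMod 2} (hu : (Matrix.circulant (hs.column hm r)).mulVec u = 0)
    (hy : wordPoly y ∈ hs.dualIdeal r) : (Matrix.circulant y).mulVec u = 0 := by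
  have hk : 0 < 2 ^ m - 1 := Nat.pos_of_neZero _
  have h1 := X_pow_sub_one_dvd_circulant (hs.column hm r) u
  rw [hu, show wordPoly (0 : Fin (2 ^ m - 1) → ZMod 2) = 0 by simp [wordPoly], sub_zero] at h1
  have h2 : (X ^ (2 ^ m - 1) - 1 : (ZMod 2)[X]) ∣ hs.generatorPoly hm r * wordPoly u := by
    have := (Dvd.dvd.mul_right (hs.dvd_generatorPoly_sub_column hm r) (wordPoly u)).add h1
    rwa [← add_mul, sub_add_cancel] at this
  have h3 : (X ^ (2 ^ m - 1) - 1 : (ZMod 2)[X]) ∣ wordPoly y * wordPoly u :=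
    h2.trans (mul_dvd_mul_right ((hs.generatorPoly_dvd_iff hm).2 hy) _)
  rw [← wordPoly_dvd_iff hk]
  have := dvd_sub h3 (X_pow_sub_one_dvd_circulant y u)
  rwa [sub_sub_cancel] at this

/-! ### Check sums over flats -/

/-- The windows miss only the origin, and `h0` makes its contribution vanish. -/
theorem sum_window (hs : IsMSequence m s) (G : (Fin m → ZMod 2) → ZMod 2) (h0 : G 0 = 0) :
    ∑ i : Fin (2 ^ m - 1), G (window m s i) = ∑ x, G x := by
  rw [← Finset.sum_range (fun i => G (window m s i)), ← Finset.sum_erase _ h0]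
  refine Finset.sum_bij (fun i _ => window m s i) ?_ ?_ ?_ ?_
  · intro i _
    simp [hs.ne_zero i]
  · intro i hi j hj h
    exact hs.inj i (by simpa using hi) j (by simpa using hj) h
  · intro v hv
    obtain ⟨i, hi, h⟩ := hs.exists_window_eq (v := v) (by simpa using hv)
    exact ⟨i, by simpa using hi, h⟩
  · intro i _
    rfl

end IsMSequence

/-- The check sums of a word over all flats not through the origin that are given by the values of
the first `h` coordinates, or by those of the coordinates after a cyclic shift, vanish. -/
def FlatChecks {k : ℕ} (s : ℕ → ZMod 2) (h : ℕ) (c : Fin k → ZMod 2) : Prop :=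
  ∀ (b : ℕ) (v : ℕ → ZMod 2), (∃ l < h, v l ≠ 0) →
    ∑ q : Fin k, (if ∀ l < h, s (q + b + l) = v l then c q else 0) = 0

/-- The indicator function of a flat. -/
theorem flat_mem_reedMuller {m h : ℕ} (hh : h ≤ m) (v : ℕ → ZMod 2) :
    (fun x : Fin m → ZMod 2 => if ∀ l : Fin m, (l : ℕ) < h → x l = v l then (1 : ZMod 2) else 0) ∈
      reedMuller h m := by
  have h1 : (fun x : Fin m → ZMod 2 =>
      if ∀ l : Fin m, (l : ℕ) < h → x l = v l then (1 : ZMod 2) else 0) =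
      -- Over F_2 the linear factor x_j + v_j + 1 is 1 if x_j = v_j and 0 otherwise.
      ∏ j : Fin h, fun x => x (Fin.castLE hh j) + (v j + 1) := by
    funext x
    rw [Finset.prod_apply]
    split_ifs with hx
    · refine (Finset.prod_eq_one fun j _ => ?_).symm
      rw [hx (Fin.castLE hh j) j.2, Fin.val_castLE]
      generalize v j = z
      revert z
      decide
    · push Not at hx
      obtain ⟨l, hl, hne⟩ := hx
      refine (Finset.prod_eq_zero (Finset.mem_univ ⟨l, hl⟩) ?_).symm
      change x l + (v l + 1) = 0
      revert hne
      generalize x l = y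
      generalize v l = z
      revert y z
      decide
  rw [h1]
  have := prod_mem_reedMuller (m := m) (Finset.univ : Finset (Fin h))
    (fun j x => x (Fin.castLE hh j) + (v j + 1)) fun j _ =>
      Submodule.add_mem _ (coord_mem_reedMuller _) (const_mem_reedMuller 1 m _)
  simpa using this

/-- A monomial of degree at most r together with the h fixed coordinates leaves some coordinate
free. Flipping that one pairs the points of the flat with equal values. -/
theorem sum_flat_eq_zero {m h r : ℕ} (hr : h + r < m) (v : ℕ → ZMod 2)
    {F : (Fin m → ZMod 2) → ZMod 2} (hF : F ∈ reedMuller r m) :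
    ∑ x : Fin m → ZMod 2, (if ∀ l : Fin m, (l : ℕ) < h → x l = v l then F x else 0) = 0 := by
  rw [reedMuller_eq_span] at hF
  induction hF using Submodule.span_induction with
  | mem F hF =>
    obtain ⟨S, hS, rfl⟩ := hF
    obtain ⟨l₀, hl₀⟩ : ∃ l₀ : Fin m, l₀ ∉ S ∪ Finset.univ.filter fun l : Fin m => (l : ℕ) < h := by
      by_contra! hcon
      have h1 : (S ∪ Finset.univ.filter fun l : Fin m => (l : ℕ) < h) = Finset.univ :=
        Finset.eq_univ_of_forall hcon
      have h2 := Finset.card_union_le S (Finset.univ.filter fun l : Fin m => (l : ℕ) < h)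
      have h3 : (Finset.univ.filter fun l : Fin m => (l : ℕ) < h).card ≤ h := by
        have := Finset.card_le_card_of_injOn (s := Finset.univ.filter fun l : Fin m => (l : ℕ) < h)
          (t := Finset.range h) (fun l => (l : ℕ)) (fun l hl => by simpa using hl)
          (fun l _ l' _ hll => Fin.ext hll)
        simpa using this
      rw [h1, Finset.card_univ, Fintype.card_fin] at h2
      have : S.card ≤ r := hS
      omega
    simp only [Finset.mem_union, Finset.mem_filter, Finset.mem_univ, true_and, not_or,
      not_lt] at hl₀
    refine Finset.sum_involution (fun x _ => Function.update x l₀ (x l₀ + 1)) ?_ ?_ ?_ ?_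
    · intro x _
      have h1 : monomialFun S (Function.update x l₀ (x l₀ + 1)) = monomialFun S x := by
        rw [monomialFun_apply, monomialFun_apply]
        refine Finset.prod_congr rfl fun l hl => Function.update_of_ne ?_ _ _
        rintro rfl
        exact hl₀.1 hl
      have h2 : (∀ l : Fin m, (l : ℕ) < h → Function.update x l₀ (x l₀ + 1) l = v l) ↔
          ∀ l : Fin m, (l : ℕ) < h → x l = v l := by
        refine forall₂_congr fun l hl => ?_
        rw [Function.update_of_ne]
        rintro rfl
        omega
      rw [h1, if_congr h2 rfl rfl]
      exact CharTwo.add_self_eq_zero _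
    · intro x _ _ hx
      have := congrFun hx l₀
      simp at this
    · intro x _
      exact Finset.mem_univ _
    · intro x _
      have : x l₀ + 1 + 1 = x l₀ := by
        generalize x l₀ = z
        revert z
        decide
      simp [this]
  | zero => simp
  | add F G _ _ hF hG =>
    have h1 : ∑ x : Fin m → ZMod 2,
        (if ∀ l : Fin m, (l : ℕ) < h → x l = v l then (F + G) x else 0) =
        ∑ x : Fin m → ZMod 2, (if ∀ l : Fin m, (l : ℕ) < h → x l = v l then F x else 0) +
        ∑ x : Fin m → ZMod 2, (if ∀ l : Fin m, (l : ℕ) < h → x l = v l then G x else 0) := by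
      rw [← Finset.sum_add_distrib]
      refine Finset.sum_congr rfl fun x _ => ?_
      split_ifs <;> simp
    rw [h1, hF, hG, add_zero]
  | smul a F _ hF =>
    have h1 : ∑ x : Fin m → ZMod 2,
        (if ∀ l : Fin m, (l : ℕ) < h → x l = v l then (a • F) x else 0) =
        a * ∑ x : Fin m → ZMod 2, (if ∀ l : Fin m, (l : ℕ) < h → x l = v l then F x else 0) := by
      rw [Finset.mul_sum]
      refine Finset.sum_congr rfl fun x _ => ?_
      split_ifs <;> simp
    rw [h1, hF, mul_zero]

namespace IsMSequence

variable {m : ℕ} {s : ℕ → ZMod 2}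

theorem forall_lt_iff_window {h b q : ℕ} (hh : h ≤ m) (v : ℕ → ZMod 2) :
    (∀ l : Fin m, (l : ℕ) < h → window m s (q + b) l = v l) ↔ ∀ l < h, s (q + b + l) = v l :=
  ⟨fun H l hl => H ⟨l, by omega⟩ hl, fun H l hl => H l hl⟩

/-- The check at shift `b` is orthogonality of x^b times the word to the indicator of a flat, a
function of degree at most h. -/
theorem flatChecks_of_mem_dualIdeal (hs : IsMSequence m s) {r h : ℕ} (hr : h ≤ r) (hm : h ≤ m)
    {c : Fin (2 ^ m - 1) → ZMod 2} (hc : wordPoly c ∈ hs.dualIdeal r) : FlatChecks s h c := by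
  intro b v _
  have h1 := Ideal.mul_mem_left _ (X ^ b) hc _ (reedMuller_mono hr (flat_mem_reedMuller hm v))
  rw [windowPairing_wordPoly] at h1
  refine Eq.trans ?_ h1
  refine Finset.sum_congr rfl fun q _ => ?_
  simp only [forall_lt_iff_window hm]
  split_ifs <;> simp

/-- By `sum_flat_eq_zero` the indicator of the flat is orthogonal to RM(r,m). Because of `hv` the
flat avoids the origin, so puncturing loses no term. -/
theorem flat_mem_dualIdeal (hs : IsMSequence m s) {r h : ℕ} (hr : h + r < m) {v : ℕ → ZMod 2}
    (hv : ∃ l < h, v l ≠ 0) :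
    wordPoly (fun q : Fin (2 ^ m - 1) => if ∀ l < h, s (q + l) = v l then (1 : ZMod 2) else 0) ∈
      hs.dualIdeal r := by
  intro F hF
  have h1 := windowPairing_wordPoly m s F
    (fun q : Fin (2 ^ m - 1) => if ∀ l < h, s (q + l) = v l then (1 : ZMod 2) else 0) 0
  rw [pow_zero, one_mul] at h1
  refine h1.trans (Eq.trans ?_ (sum_flat_eq_zero hr v hF))
  rw [← hs.sum_window]
  · refine Finset.sum_congr rfl fun q _ => ?_
    have := forall_lt_iff_window (s := s) (b := 0) (q := q) (by omega : h ≤ m) v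
    simp only [add_zero] at this ⊢
    rw [if_congr this rfl rfl]
    split_ifs <;> simp
  · obtain ⟨l, hl, hl0⟩ := hv
    rw [if_neg]
    intro H
    exact hl0 (H ⟨l, by omega⟩ hl).symm

/-- The reversed words of the kernel of the circulant matrix satisfy check sums. -/
theorem flatChecks_of_circulant_eq_zero [NeZero (2 ^ m - 1)] (hm : 1 ≤ m) (hs : IsMSequence m s)
    {r h : ℕ} (hr : h + r < m) {u : Fin (2 ^ m - 1) → ZMod 2}
    (hu : (Matrix.circulant (hs.column hm r)).mulVec u = 0) : FlatChecks s h fun q => u (-q) := by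
  intro b v hv
  -- With y the incidence word of the flat, entry b of the product is ∑ y(b - j) u(j). The
  -- substitution j = -q turns it into the check sum at shift b of q ↦ u(-q), which is why the word
  -- gets reversed.
  have h1 := congrFun (hs.circulant_mulVec_eq_zero hm hu (hs.flat_mem_dualIdeal hr hv))
    (Fin.ofNat (2 ^ m - 1) b)
  simp only [Matrix.mulVec, dotProduct, Matrix.circulant_apply, Pi.zero_apply] at h1
  refine Eq.trans ?_ h1
  rw [← Equiv.sum_comp (Equiv.neg _)]
  refine Finset.sum_congr rfl fun q _ => ?_
  have h2 : ∀ l < h, s (((Fin.ofNat (2 ^ m - 1) b - q : Fin (2 ^ m - 1)) : ℕ) + l) =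
      s (((-q : Fin (2 ^ m - 1)) : ℕ) + b + l) := by
    intro l hl
    have hq : ((Fin.ofNat (2 ^ m - 1) b - q : Fin (2 ^ m - 1)) : ℕ) =
        (((-q : Fin (2 ^ m - 1)) : ℕ) + b) % (2 ^ m - 1) := by
      rw [sub_eq_neg_add, Fin.val_add, Fin.val_ofNat, Nat.add_mod_mod]
    have := congrFun (hs.window_mod (((-q : Fin (2 ^ m - 1)) : ℕ) + b)) ⟨l, by omega⟩
    rw [hq]
    exact this
  simp only [Equiv.neg_apply, neg_neg]
  by_cases H : ∀ l < h, s (((-q : Fin (2 ^ m - 1)) : ℕ) + b + l) = v l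
  · rw [if_pos H, if_pos fun l hl => (h2 l hl).trans (H l hl), one_mul]
  · rw [if_neg H, if_neg, zero_mul]
    exact fun H' => H fun l hl => (h2 l hl).symm.trans (H' l hl)

/-! ### Counting flats -/

theorem card_vanishing_le {h : ℕ} (hh : h ≤ m) :
    (Finset.univ.filter fun x : Fin m → ZMod 2 => ∀ l : Fin m, (l : ℕ) < h → x l = 0).card ≤
      2 ^ (m - h) := by
  have h1 : (Finset.univ : Finset (Fin (m - h) → ZMod 2)).card = 2 ^ (m - h) := by simp
  rw [← h1]
  refine Finset.card_le_card_of_injOn (fun x j => x ⟨h + j, by omega⟩) (fun _ _ => by simp) ?_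
  intro x hx y hy hxy
  simp only [Finset.coe_filter, Finset.mem_univ, true_and, Set.mem_ofPred_eq] at hx hy
  funext l
  by_cases hl : (l : ℕ) < h
  · rw [hx l hl, hy l hl]
  · have := congrFun hxy ⟨l - h, by omega⟩
    simpa [Nat.add_sub_cancel' (not_lt.1 hl)] using this

/-- As b runs through a period, the windows at i + b are different nonzero vectors. Those counted
lie in a subspace of dimension m - h. -/
theorem card_shifts_le (hs : IsMSequence m s) {h : ℕ} (hh : h ≤ m) (i : ℕ) :
    ((Finset.range (2 ^ m - 1)).filter fun b => ∀ l < h, s (i + b + l) = 0).card ≤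
      2 ^ (m - h) - 1 := by
  refine le_trans ?_ (Nat.sub_le_sub_right (card_vanishing_le (m := m) hh) 1)
  rw [← Finset.card_erase_of_mem (a := 0) (by simp)]
  refine Finset.card_le_card_of_injOn (fun b => window m s (i + b)) ?_ ?_
  · intro b hb
    simp only [Finset.coe_filter, Finset.mem_range, Set.mem_ofPred_eq] at hb
    simp only [Finset.coe_erase, Finset.coe_filter, Finset.mem_univ, true_and, Set.mem_sdiff,
      Set.mem_ofPred_eq, Set.mem_singleton_iff]
    exact ⟨fun l hl => hb.2 l hl, hs.ne_zero _⟩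
  · intro b hb b' hb' hbb
    simp only [Finset.coe_filter, Finset.mem_range, Set.mem_ofPred_eq] at hb hb'
    have hk : 0 < 2 ^ m - 1 := by omega
    have h1 : (i + b) % (2 ^ m - 1) = (i + b') % (2 ^ m - 1) := by
      refine hs.inj _ (Nat.mod_lt _ hk) _ (Nat.mod_lt _ hk) ?_
      rw [hs.window_mod, hs.window_mod]
      exact hbb
    have h2 : b % (2 ^ m - 1) = b' % (2 ^ m - 1) := Nat.ModEq.add_left_cancel' i h1
    rwa [Nat.mod_eq_of_lt hb.1, Nat.mod_eq_of_lt hb'.1] at h2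

/-- The shift-and-add property: the sum of two different windows is nonzero, hence a window, and the
linear shift map carries this relation along the sequence. It reduces flats through two points to
flats through one point and the origin. -/
theorem exists_add_window (hs : IsMSequence m s) {p q : ℕ} (hp : p < 2 ^ m - 1)
    (hq : q < 2 ^ m - 1) (hpq : p ≠ q) :
    ∃ i, ∀ b, ∀ l < m, s (p + b + l) + s (q + b + l) = s (i + b + l) := by
  obtain ⟨T, hT⟩ := hs.exists_shift
  obtain ⟨i, -, hi⟩ := hs.exists_window_eq (v := window m s p + window m s q) (by
    intro h
    apply hpq
    refine hs.inj p hp q hq ?_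
    rw [eq_neg_of_add_eq_zero_left h]
    funext l
    exact ZMod.neg_eq_self_mod_two _)
  refine ⟨i, fun b => ?_⟩
  have key : window m s (p + b) + window m s (q + b) = window m s (i + b) := by
    induction b with
    | zero => exact hi.symm
    | succ b ih => rw [← add_assoc, ← add_assoc, ← add_assoc, ← hT, ← hT, ← hT, ← ih, map_add]
  intro l hl
  exact congrFun key ⟨l, hl⟩

/-- Few of the flats through a point pass through the origin or through one of some other points. -/
theorem card_bad_shifts_le (hs : IsMSequence m s) {h : ℕ} (hh : h ≤ m) (p : Fin (2 ^ m - 1))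
    (Q : Finset (Fin (2 ^ m - 1))) (hp : p ∉ Q) :
    ((Finset.range (2 ^ m - 1)).filter fun b => (∀ l < h, s (p + b + l) = 0) ∨
      ∃ q ∈ Q, ∀ l < h, s (q + b + l) = s (p + b + l)).card ≤
      (Q.card + 1) * (2 ^ (m - h) - 1) := by
  induction Q using Finset.induction_on with
  | empty => simpa using hs.card_shifts_le hh p
  | insert q Q hq ih =>
    rw [Finset.mem_insert, not_or] at hp
    obtain ⟨i, hi⟩ := hs.exists_add_window p.2 q.2 (fun h => hp.1 (Fin.ext h))
    rw [Finset.card_insert_of_notMem hq, add_mul _ 1, one_mul]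
    refine le_trans ?_ (add_le_add (ih hp.2) (hs.card_shifts_le hh i))
    refine (Finset.card_le_card ?_).trans (Finset.card_union_le _ _)
    intro b hb
    simp only [Finset.mem_filter, Finset.mem_range, Finset.mem_insert, Finset.mem_union] at hb ⊢
    obtain ⟨hbk, h0 | ⟨q', rfl | hq', hb⟩⟩ := hb
    · exact .inl ⟨hbk, .inl h0⟩
    · refine .inr ⟨hbk, fun l hl => ?_⟩
      rw [← hi b l (by omega), hb l hl]
      exact CharTwo.add_self_eq_zero _
    · exact .inl ⟨hbk, .inr ⟨q', hq', hb⟩⟩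

/-- A nonzero word with vanishing check sums has large weight. -/
theorem lt_hammingNorm_of_flatChecks (hs : IsMSequence m s) {h t : ℕ} (hh : h ≤ m)
    (ht : t * (2 ^ (m - h) - 1) < 2 ^ m - 1) {c : Fin (2 ^ m - 1) → ZMod 2} (hc : FlatChecks s h c)
    (hc0 : c ≠ 0) : t < hammingNorm c := by
  obtain ⟨p, hp⟩ := Function.ne_iff.1 hc0
  by_contra! hw
  have h1 := hs.card_bad_shifts_le hh p ((Finset.univ.filter fun q => c q ≠ 0).erase p)
    (Finset.notMem_erase _ _)
  rw [Finset.card_erase_add_one (by simpa using hp)] at h1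
  have h2 := Nat.mul_le_mul_right (2 ^ (m - h) - 1) hw
  rw [hammingNorm] at h2
  -- Every shift is bad: otherwise some flat off the origin meets the support only in p, and its
  -- check sum is c p ≠ 0. So with weight at most t there would be k ≤ t(2^(m-h) - 1), against `ht`.
  rw [Finset.filter_true_of_mem, Finset.card_range] at h1
  · omega
  · intro b hb
    by_contra! hcon
    obtain ⟨⟨l, hl, hl0⟩, hq⟩ := hcon
    have h3 := hc b (fun l => s (p + b + l)) ⟨l, hl, hl0⟩
    rw [Finset.sum_eq_single p] at h3
    · simp only [implies_true, if_true] at h3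
      exact hp h3
    · intro q _ hqp
      by_cases hcq : c q = 0
      · simp [hcq]
      · obtain ⟨l, hl, hne⟩ := hq q (by simp [hqp, hcq])
        exact if_neg fun H => hne (H l hl)
    · simp

/-- The check sum of a word over a flat through a point. -/
def flatSum {k : ℕ} (s : ℕ → ZMod 2) (h b : ℕ) (c : Fin k → ZMod 2) (p : ℕ) : ZMod 2 :=
  ∑ q : Fin k, if ∀ l < h, s (q + b + l) = s (p + b + l) then c q else 0

/-- The majority vote of the check sums over the flats through a point that avoid the origin. -/
def flatMajority {k : ℕ} (s : ℕ → ZMod 2) (h : ℕ) (c : Fin k → ZMod 2) (p : ℕ) : ZMod 2 :=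
  if k < 2 * ((Finset.range k).filter fun b =>
    (∃ l < h, s (p + b + l) ≠ 0) ∧ flatSum s h b c p ≠ 0).card then 1 else 0

theorem flatMajority_zero {k : ℕ} (s : ℕ → ZMod 2) (h : ℕ) (p : ℕ) :
    flatMajority s h (0 : Fin k → ZMod 2) p = 0 := by
  simp [flatMajority, flatSum]

/-- One-step majority logic decoding. -/
theorem flatMajority_add (hs : IsMSequence m s) {h t : ℕ} (hh : h ≤ m)
    (ht : 2 * (t + 1) * (2 ^ (m - h) - 1) < 2 ^ m - 1) {c e : Fin (2 ^ m - 1) → ZMod 2}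
    (hc : FlatChecks s h c) (he : hammingNorm e ≤ t) (p : Fin (2 ^ m - 1)) :
    flatMajority s h (c + e) p = e p := by
  -- The word with vanishing checks drops out of the check sums off the origin, so only the errors
  -- matter.
  have hsum : ∀ b, (∃ l < h, s (p + b + l) ≠ 0) → flatSum s h b (c + e) p = flatSum s h b e p := by
    intro b hb
    have h1 := hc b (fun l => s (p + b + l)) hb
    rw [← zero_add (flatSum s h b e p), ← h1, flatSum, flatSum, ← Finset.sum_add_distrib]
    refine Finset.sum_congr rfl fun q _ => ?_
    split_ifs <;> simp
  set Q := (Finset.univ.filter fun q => e q ≠ 0).erase p with hQ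
  have hQc : Q.card ≤ t := (Finset.card_erase_le).trans he
  have hbad := hs.card_bad_shifts_le hh p Q (Finset.notMem_erase _ _)
  have hbad' : (Q.card + 1) * (2 ^ (m - h) - 1) ≤ (t + 1) * (2 ^ (m - h) - 1) :=
    Nat.mul_le_mul_right _ (by omega)
  rw [mul_assoc] at ht
  -- A flat that misses the origin and all errors other than p reports e p. By `hbad` fewer than
  -- half of the shifts fail to give such a flat, which settles both values of e p.
  have hgood : ∀ b, ¬ ((∀ l < h, s (p + b + l) = 0) ∨
      ∃ q ∈ Q, ∀ l < h, s (q + b + l) = s (p + b + l)) → flatSum s h b e p = e p := by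
    intro b hb
    push Not at hb
    rw [flatSum, Finset.sum_eq_single p]
    · simp
    · intro q _ hqp
      by_cases hcq : e q = 0
      · simp [hcq]
      · obtain ⟨l, hl, hne⟩ := hb.2 q (by simp [hQ, hqp, hcq])
        exact if_neg fun H => hne (H l hl)
    · simp
  rw [flatMajority]
  by_cases hp : e p = 0
  · rw [hp, if_neg]
    have h1 : ((Finset.range (2 ^ m - 1)).filter fun b =>
        (∃ l < h, s (p + b + l) ≠ 0) ∧ flatSum s h b (c + e) p ≠ 0).card ≤ _ :=
      (Finset.card_le_card (Finset.monotone_filter_right _ (by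
        rintro b - ⟨hb, hb'⟩
        by_contra hcon
        exact hb' (by rw [hsum b hb, hgood b hcon, hp])))).trans hbad
    omega
  · have hp1 : e p = 1 := by
      revert hp
      generalize e p = z
      revert z
      decide
    rw [hp1, if_pos]
    have h1 := Finset.card_filter_add_card_filter_not (s := Finset.range (2 ^ m - 1))
      (fun b => (∀ l < h, s (p + b + l) = 0) ∨
        ∃ q ∈ Q, ∀ l < h, s (q + b + l) = s (p + b + l))
    have h2 : ((Finset.range (2 ^ m - 1)).filter fun b => ¬ ((∀ l < h, s (p + b + l) = 0) ∨
        ∃ q ∈ Q, ∀ l < h, s (q + b + l) = s (p + b + l))).card ≤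
        ((Finset.range (2 ^ m - 1)).filter fun b =>
        (∃ l < h, s (p + b + l) ≠ 0) ∧ flatSum s h b (c + e) p ≠ 0).card := by
      refine Finset.card_le_card (Finset.monotone_filter_right _ ?_)
      intro b _ hb
      have hb' : ∃ l < h, s (p + b + l) ≠ 0 := by
        push Not at hb
        exact hb.1
      exact ⟨hb', by rw [hsum b hb', hgood b hb]; exact hp⟩
    rw [Finset.card_range] at h1
    omega

end IsMSequence

/-! ### Elimination -/

/-- `b` is a family in echelon form that spans the words orthogonal to all words in `Y`. -/
structure IsEchelon {k : ℕ} (b : Fin k → Fin k → ZMod 2) (Y : Set (Fin k → ZMod 2)) : Prop where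
  shape : ∀ q, b q = 0 ∨ (b q q = 1 ∧ ∀ i, q < i → b q i = 0)
  orth : ∀ q, ∀ y ∈ Y, ∑ i, b q i * y i = 0
  span : ∀ c : Fin k → ZMod 2, (∀ y ∈ Y, ∑ i, c i * y i = 0) →
    ∃ x : Fin k → ZMod 2, ∀ i, c i = ∑ q, x q * b q i

theorem isEchelon_one (k : ℕ) :
    IsEchelon (fun q i : Fin k => if q = i then 1 else 0) ∅ := by
  refine ⟨fun q => .inr ⟨by simp, fun i hi => if_neg hi.ne⟩, by simp, fun c _ => ⟨c, by simp⟩⟩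

theorem IsEchelon.insert_of_forall {k : ℕ} {b : Fin k → Fin k → ZMod 2} {Y : Set (Fin k → ZMod 2)}
    (hb : IsEchelon b Y) {y : Fin k → ZMod 2} (hy : ∀ q, ∑ i, b q i * y i = 0) :
    IsEchelon b (insert y Y) := by
  refine ⟨hb.shape, ?_, fun c hc => hb.span c fun y' hy' => hc y' (Set.mem_insert_of_mem _ hy')⟩
  rintro q y' (rfl | hy')
  · exact hy q
  · exact hb.orth q y' hy'

/-- Row p cancels itself. As `p` is the first row not orthogonal to y, only rows q > p are otherwise
changed, and row p vanishes from q on, so their leading entries persist. A word orthogonal to y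
keeps its coefficients x: the total multiple of row p that is added is ∑ x_q (b_q · y) = c · y = 0.
-/
theorem IsEchelon.insert {k : ℕ} {b : Fin k → Fin k → ZMod 2} {Y : Set (Fin k → ZMod 2)}
    (hb : IsEchelon b Y) {y : Fin k → ZMod 2} {p : Fin k} (hp : ∑ i, b p i * y i ≠ 0)
    (hlt : ∀ q < p, ∑ i, b q i * y i = 0) :
    IsEchelon (fun q i => b q i + (∑ j, b q j * y j) * b p i) (insert y Y) := by
  have hp1 : ∑ i, b p i * y i = 1 := by
    revert hp
    generalize ∑ i, b p i * y i = z
    revert z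
    decide
  have hadd : ∀ q, ∀ y' : Fin k → ZMod 2,
      ∑ i, (b q i + (∑ j, b q j * y j) * b p i) * y' i =
        ∑ i, b q i * y' i + (∑ j, b q j * y j) * ∑ i, b p i * y' i := by
    intro q y'
    simp only [add_mul, Finset.sum_add_distrib, mul_assoc, ← Finset.mul_sum]
  refine ⟨fun q => ?_, fun q y' hy' => ?_, fun c hc => ?_⟩
  · rcases lt_trichotomy q p with h | rfl | h
    · simpa [hlt q h] using hb.shape q
    · left
      funext i
      rw [hp1, one_mul, Pi.zero_apply, CharTwo.add_self_eq_zero]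
    · rcases hb.shape q with h0 | ⟨h1, h2⟩
      · left
        funext i
        simp [h0]
      · right
        have hbp : ∀ i, p < i → b p i = 0 := by
          rcases hb.shape p with h0 | h0
          · simp [h0]
          · exact h0.2
        refine ⟨?_, fun i hi => ?_⟩
        · rw [hbp q h, mul_zero, add_zero, h1]
        · rw [hbp i (h.trans hi), mul_zero, add_zero, h2 i hi]
  · rw [hadd]
    rcases hy' with rfl | hy'
    · rw [hp1, mul_one, CharTwo.add_self_eq_zero]
    · rw [hb.orth q y' hy', hb.orth p y' hy', mul_zero, add_zero]
  · obtain ⟨x, hx⟩ := hb.span c fun y' hy' => hc y' (Set.mem_insert_of_mem _ hy')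
    refine ⟨x, fun i => ?_⟩
    have h0 : ∑ q, x q * ∑ j, b q j * y j = 0 := by
      rw [← hc y (Set.mem_insert _ _)]
      simp only [hx, Finset.mul_sum, Finset.sum_mul]
      rw [Finset.sum_comm]
      exact Finset.sum_congr rfl fun _ _ => Finset.sum_congr rfl fun _ _ => (mul_assoc _ _ _).symm
    simp only [mul_add, Finset.sum_add_distrib, ← mul_assoc, ← Finset.sum_mul]
    rw [h0, zero_mul, add_zero, hx i]

/-- The words orthogonal to `Y` have no nonzero member below the first nonzero row. -/
theorem IsEchelon.eq_zero_of_orth {k : ℕ} {b : Fin k → Fin k → ZMod 2} {Y : Set (Fin k → ZMod 2)}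
    (hb : IsEchelon b Y) {p : ℕ} (hp : ∀ q : Fin k, (q : ℕ) < p → b q q = 0)
    {c : Fin k → ZMod 2} (hc : ∀ y ∈ Y, ∑ i, c i * y i = 0)
    (hcp : ∀ i : Fin k, p ≤ i → c i = 0) : c = 0 := by
  obtain ⟨x, hx⟩ := hb.span c hc
  have hzero : ∀ q : Fin k, b q q = 0 → b q = 0 := by
    intro q hq
    rcases hb.shape q with h | ⟨h, -⟩
    · exact h
    · rw [hq] at h
      exact absurd h zero_ne_one
  by_contra hc0
  have hne : (Finset.univ.filter fun q => x q ≠ 0 ∧ b q ≠ 0).Nonempty := by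
    by_contra hemp
    rw [Finset.not_nonempty_iff_eq_empty, Finset.filter_eq_empty_iff] at hemp
    apply hc0
    funext i
    rw [hx i, Pi.zero_apply]
    refine Finset.sum_eq_zero fun q _ => ?_
    by_cases hxq : x q = 0
    · simp [hxq]
    · have := hemp (Finset.mem_univ q)
      push Not at this
      simp [this hxq]
  -- The last row that really occurs in the combination determines entry q of c, since all other
  -- occurring rows end before q.
  obtain ⟨q, hq, hmax⟩ := Finset.exists_max_image _ (fun q : Fin k => q) hne
  simp only [Finset.mem_filter, Finset.mem_univ, true_and] at hq hmax
  have hpq : p ≤ q := by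
    by_contra! hlt
    exact hq.2 (hzero q (hp q hlt))
  have hcq : c q = x q * b q q := by
    rw [hx q]
    refine Finset.sum_eq_single q (fun j _ hj => ?_) (by simp)
    by_cases hjx : x j ≠ 0 ∧ b j ≠ 0
    · rcases hb.shape j with h | ⟨-, h⟩
      · exact absurd h hjx.2
      · rw [h q (lt_of_le_of_ne (hmax j hjx) hj), mul_zero]
    · rw [not_and_or, not_not, not_not] at hjx
      rcases hjx with h | h <;> simp [h]
  rw [hcp q hpq] at hcq
  exact mul_ne_zero hq.1 (fun h => hq.2 (hzero q h)) hcq.symm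

/-! ### The generator polynomial by elimination, and division by it. -/

theorem wordPoly_sub {F : Type*} [Field F] {n : ℕ} (c c' : Fin n → F) :
    wordPoly (c - c') = wordPoly c - wordPoly c' := by
  simp [wordPoly, sub_mul, Finset.sum_sub_distrib]

namespace IsMSequence

variable {m : ℕ} {s : ℕ → ZMod 2}

/-- The values of a squarefree monomial along the sequence. -/
def monomialWord (m : ℕ) (s : ℕ → ZMod 2) (S : Finset (Fin m)) : Fin (2 ^ m - 1) → ZMod 2 :=
  fun i => monomialFun S (window m s i)

theorem dvd_X_pow_sub_one (hm : 1 ≤ m) (hs : IsMSequence m s) (r : ℕ) :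
    hs.generatorPoly hm r ∣ X ^ (2 ^ m - 1) - 1 :=
  (hs.generatorPoly_dvd_iff hm).2 (hs.X_pow_sub_one_mem_dualIdeal r)

/-- As g divides x^k - 1, the reduction modulo x^k - 1 matters only if the two are equal, that is,
if the dual code is zero. -/
theorem column_eq_zero_or (hm : 1 ≤ m) (hs : IsMSequence m s) (r : ℕ) :
    (hs.generatorPoly hm r = X ^ (2 ^ m - 1) - 1 ∧ hs.column hm r = 0) ∨
      wordPoly (hs.column hm r) = hs.generatorPoly hm r := by
  have hk : 0 < 2 ^ m - 1 := by
    have : 2 ≤ 2 ^ m := Nat.pow_le_pow_right (n := 2) (by norm_num) hm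
    omega
  have hmon := monic_X_pow_sub_one (F := ZMod 2) hk
  by_cases h : (hs.generatorPoly hm r).degree < (X ^ (2 ^ m - 1) - 1 : (ZMod 2)[X]).degree
  · right
    rw [wordPoly_column, (modByMonic_eq_self_iff hmon).2 h]
  · left
    have h1 : hs.generatorPoly hm r = X ^ (2 ^ m - 1) - 1 :=
      (eq_of_monic_of_dvd_of_natDegree_le (hs.monic_generatorPoly hm r) hmon
        (hs.dvd_X_pow_sub_one hm r) (natDegree_le_natDegree (not_lt.1 h))).symm
    refine ⟨h1, ?_⟩
    funext i
    rw [column, h1, modByMonic_self hmon, coeff_zero, Pi.zero_apply]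

theorem wordPoly_mem_dualIdeal_iff_orth (hs : IsMSequence m s) {r : ℕ}
    (c : Fin (2 ^ m - 1) → ZMod 2) : wordPoly c ∈ hs.dualIdeal r ↔
      ∀ y ∈ monomialWord m s '' {S | S.card ≤ r}, ∑ i, c i * y i = 0 := by
  rw [wordPoly_mem_dualIdeal_iff]
  simp [monomialWord]

/-- Row p is a monic polynomial of degree p in the ideal, so g divides it. If g had smaller degree,
it would be an orthogonal word supported below the first nonzero row, which
`IsEchelon.eq_zero_of_orth` excludes. -/
theorem column_eq_of_isEchelon (hm : 1 ≤ m) (hs : IsMSequence m s) {r : ℕ}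
    {b : Fin (2 ^ m - 1) → Fin (2 ^ m - 1) → ZMod 2}
    (hb : IsEchelon b (monomialWord m s '' {S | S.card ≤ r})) {p : Fin (2 ^ m - 1)}
    (hp : b p p ≠ 0) (hlt : ∀ q < p, b q q = 0) : hs.column hm r = b p := by
  obtain ⟨h1, h2⟩ : b p p = 1 ∧ ∀ i, p < i → b p i = 0 := by
    rcases hb.shape p with h | h
    · rw [h] at hp
      exact absurd rfl hp
    · exact h
  have hdvd : hs.generatorPoly hm r ∣ wordPoly (b p) := by
    rw [hs.generatorPoly_dvd_iff hm, wordPoly_mem_dualIdeal_iff_orth]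
    exact hb.orth p
  have hbp0 : wordPoly (b p) ≠ 0 := by
    intro h
    have := coeff_wordPoly (b p) p
    rw [h, coeff_zero, h1] at this
    exact zero_ne_one this
  have hdeg : (hs.generatorPoly hm r).degree < (2 ^ m - 1 : ℕ) :=
    (degree_le_of_dvd hdvd hbp0).trans_lt (degree_wordPoly_lt _)
  have hcol : wordPoly (hs.column hm r) = hs.generatorPoly hm r := by
    rcases hs.column_eq_zero_or hm r with h | h
    · rw [h.1, degree_X_pow_sub_one (Nat.pos_of_ne_zero fun h0 => by
        have := p.2
        omega)] at hdeg
      exact absurd hdeg (lt_irrefl _)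
    · exact h
  have hmonic : (wordPoly (b p)).Monic ∧ (wordPoly (b p)).natDegree ≤ p := by
    have hle : (wordPoly (b p)).natDegree ≤ p := by
      rw [natDegree_le_iff_coeff_eq_zero]
      intro n hn
      by_cases hnk : n < 2 ^ m - 1
      · rw [coeff_wordPoly (b p) ⟨n, hnk⟩]
        exact h2 _ hn
      · refine coeff_eq_zero_of_degree_lt ((degree_wordPoly_lt _).trans_le ?_)
        exact_mod_cast not_lt.1 hnk
    exact ⟨monic_of_natDegree_le_of_coeff_eq_one p hle (by rw [coeff_wordPoly, h1]), hle⟩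
  apply wordPoly_injective
  rw [hcol]
  refine (eq_of_monic_of_dvd_of_natDegree_le (hs.monic_generatorPoly hm r) hmonic.1 hdvd ?_).symm
  refine hmonic.2.trans ?_
  by_contra! hlt'
  have h0 : hs.column hm r = 0 := by
    refine hb.eq_zero_of_orth (p := p) (fun q hq => hlt q hq)
      ((hs.wordPoly_mem_dualIdeal_iff_orth _).1 (hs.column_mem_dualIdeal hm r)) fun i hi => ?_
    rw [← coeff_wordPoly (hs.column hm r), hcol]
    exact coeff_eq_zero_of_natDegree_lt (hlt'.trans_le hi)
  rw [h0] at hcol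
  apply (hs.monic_generatorPoly hm r).ne_zero
  rw [← hcol]
  simp [wordPoly]

theorem column_eq_zero_of_isEchelon (hm : 1 ≤ m) (hs : IsMSequence m s) {r : ℕ}
    {b : Fin (2 ^ m - 1) → Fin (2 ^ m - 1) → ZMod 2}
    (hb : IsEchelon b (monomialWord m s '' {S | S.card ≤ r})) (h0 : ∀ q, b q q = 0) :
    hs.column hm r = 0 :=
  hb.eq_zero_of_orth (p := 2 ^ m - 1) (fun q _ => h0 q)
    ((hs.wordPoly_mem_dualIdeal_iff_orth _).1 (hs.column_mem_dualIdeal hm r))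
    fun i hi => absurd i.2 (by omega)

/-- Division of a word by the generator polynomial, from the lowest coefficient on. -/
theorem circulant_mulVec_of_recurrence [NeZero (2 ^ m - 1)] (hm : 1 ≤ m) (hs : IsMSequence m s)
    {r : ℕ} {V u : ℕ → ZMod 2} {a : ℕ → ZMod 2} (ha : ∀ i : Fin (2 ^ m - 1), a i = hs.column hm r i)
    {e : Fin (2 ^ m - 1) → ZMod 2}
    (hV : ∀ i : Fin (2 ^ m - 1), V i = (Matrix.circulant (hs.column hm r)).mulVec e i)
    (hu : ∀ n < 2 ^ m - 1, u n = V n + ∑ i ∈ Finset.range n, u i * a (n - i)) :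
    (Matrix.circulant (hs.column hm r)).mulVec (fun i => u i) =
      (Matrix.circulant (hs.column hm r)).mulVec e := by
  have hk : 0 < 2 ^ m - 1 := Nat.pos_of_neZero _
  -- If the dual code is zero, then A = 0 and any `u` will do.
  rcases hs.column_eq_zero_or hm r with ⟨-, h0⟩ | hcol
  · rw [h0]
    funext i
    simp [Matrix.mulVec, dotProduct, Matrix.circulant_apply]
  set g := hs.generatorPoly hm r with hg
  obtain ⟨q, hq⟩ := (hs.generatorPoly_dvd_iff hm).2 (hs.circulant_mem_dualIdeal hm r e)
  rw [← hg] at hq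
  -- g divides x^k - 1, whose constant term is not zero. This lets the division start from the
  -- lowest coefficient.
  have hg0 : g.coeff 0 = 1 := by
    obtain ⟨h, hh⟩ := hs.dvd_X_pow_sub_one hm r
    have := congrArg (fun f => f.coeff 0) hh
    simp only [coeff_sub, coeff_X_pow, hk.ne, if_false, coeff_one_zero, mul_coeff_zero] at this
    rw [← hg] at this
    revert this
    generalize g.coeff 0 = x
    generalize h.coeff 0 = y
    revert x y
    decide
  have hcoeff : ∀ n < 2 ^ m - 1, u n = q.coeff n := by
    intro n
    induction n using Nat.strong_induction_on with
    | _ n ih =>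
      intro hn
      have h1 : V n = ∑ i ∈ Finset.range (n + 1), q.coeff i * g.coeff (n - i) := by
        rw [hV ⟨n, hn⟩, ← coeff_wordPoly ((Matrix.circulant (hs.column hm r)).mulVec e), hq, mul_comm, coeff_mul,
          Finset.Nat.sum_antidiagonal_eq_sum_range_succ (fun i j => q.coeff i * g.coeff j)]
      rw [hu n hn, h1, Finset.sum_range_succ, Nat.sub_self, hg0, mul_one]
      have h2 : ∑ i ∈ Finset.range n, u i * a (n - i) =
          ∑ i ∈ Finset.range n, q.coeff i * g.coeff (n - i) := by
        refine Finset.sum_congr rfl fun i hi => ?_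
        rw [Finset.mem_range] at hi
        rw [ih i hi (by omega), ← hcol, ha ⟨n - i, by omega⟩,
          ← coeff_wordPoly (hs.column hm r)]
      rw [h2, add_right_comm, CharTwo.add_self_eq_zero, zero_add]
  -- The product of g and q is a word, so q has degree below k. The k computed coefficients are
  -- therefore all of q.
  have hqdeg : q.degree < (2 ^ m - 1 : ℕ) := by
    by_cases hq0 : q = 0
    · rw [hq0, degree_zero]
      exact WithBot.bot_lt_coe _
    · refine (degree_le_of_dvd ⟨g, by rw [hq, mul_comm]⟩ ?_).trans_lt (degree_wordPoly_lt
        ((Matrix.circulant (hs.column hm r)).mulVec e))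
      rw [hq]
      exact mul_ne_zero (hs.monic_generatorPoly hm r).ne_zero hq0
  have hwq : wordPoly (fun i : Fin (2 ^ m - 1) => u i) = q := by
    rw [← wordPoly_coeff hqdeg]
    congr 1
    funext i
    exact hcoeff i i.2
  have h1 := X_pow_sub_one_dvd_circulant (hs.column hm r) (fun i => u i)
  rw [hwq, hcol, ← hq, ← wordPoly_sub, wordPoly_dvd_iff hk, sub_eq_zero] at h1
  exact h1.symm

end IsMSequence

/-! ### Parameters, minimum distance, balancedness and decoding. -/

/-- The number of errors that are corrected. -/
def errorRadius (m : ℕ) : ℕ := 2 ^ (m - m / 2 - 2) - 1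

/-- The designed distance. -/
def designDistance (m : ℕ) : ℕ := 2 * errorRadius m + 1

/-- Needed for h = ⌊m/2⌋ (second half) and h = m - ⌊m/2⌋ - 1 (reversed first half). With t the error
radius, 2(t+1) 2^(m-h) ≤ 2^m, and subtracting 2(t+1) ≥ 2 makes the inequality strict. For m ≥ 3 the
exponent in the radius is not truncated. -/
theorem errorRadius_bound {m h : ℕ} (hm : 3 ≤ m) (hh : m - h ≤ m / 2 + 1) :
    2 * (errorRadius m + 1) * (2 ^ (m - h) - 1) < 2 ^ m - 1 := by
  have h1 : errorRadius m + 1 = 2 ^ (m - m / 2 - 2) := Nat.sub_add_cancel Nat.one_le_two_pow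
  have h2 : 2 * 2 ^ (m - m / 2 - 2) * 2 ^ (m - h) ≤ 2 ^ m := by
    rw [← pow_succ', ← pow_add]
    exact Nat.pow_le_pow_right (by norm_num) (by omega)
  have h3 : 1 ≤ 2 ^ (m - m / 2 - 2) := Nat.one_le_two_pow
  rw [h1, Nat.mul_sub, mul_one]
  have h4 : 2 ≤ 2 ^ m := Nat.pow_le_pow_right (n := 2) (by norm_num) (by omega : 1 ≤ m)
  omega

theorem errorRadius_of_le {m : ℕ} (hm : m ≤ 2) : errorRadius m = 0 := by
  rw [errorRadius, show m - m / 2 - 2 = 0 by omega]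
  rfl

/-- The distance is at least 2^(m-⌊m/2⌋-2), and four times this is at least 2^(m/2). A truncated
exponent for small m only helps. -/
theorem sqrt_le_designDistance (m : ℕ) :
    1 / 4 * Real.sqrt ((2 ^ m - 1 : ℕ) : ℝ) ≤ (designDistance m : ℝ) := by
  have h1 : errorRadius m + 1 = 2 ^ (m - m / 2 - 2) := Nat.sub_add_cancel Nat.one_le_two_pow
  have h2 : 2 ^ (m - m / 2 - 2) ≤ designDistance m := by
    rw [designDistance, ← h1]
    omega
  have h3 : 2 ^ m ≤ (4 * designDistance m) ^ 2 := by
    refine le_trans ?_ (Nat.pow_le_pow_left (Nat.mul_le_mul_left 4 h2) 2)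
    rw [show 4 = 2 ^ 2 by norm_num, ← pow_add, ← pow_mul]
    exact Nat.pow_le_pow_right (by norm_num) (by omega)
  have h4 : Real.sqrt ((2 ^ m - 1 : ℕ) : ℝ) ≤ 4 * (designDistance m : ℝ) := by
    rw [Real.sqrt_le_left (by positivity)]
    exact_mod_cast (Nat.sub_le _ 1).trans h3
  linarith

theorem mem_doubleCirculantCode {F : Type*} [Field F] {k : ℕ} {a : Fin k → F}
    {c : Fin k ⊕ Fin k → F} : c ∈ doubleCirculantCode a ↔
      ∃ u, c = Sum.elim u ((Matrix.circulant a).mulVec u) := by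
  simp [doubleCirculantCode, doubleCirculantMatrix, Matrix.fromRows_mulVec, eq_comm]

theorem balancedWeight_le {F ι : Type*} [Fintype ι] [DecidableEq F] [Zero F] (w : ι → F) :
    balancedWeight w ≤ hammingNorm w :=
  ciInf_le (OrderBot.bddBelow _) (0 : F)

theorem IsTwoBalanced.hasDistanceAtLeast {F : Type*} [Field F] [DecidableEq F] {k d : ℕ}
    {C : Submodule F (Fin k ⊕ Fin k → F)} (h : IsTwoBalanced C d) : HasDistanceAtLeast C d := by
  intro c hc c' hc' hne
  rw [hammingDist_eq_hammingNorm, neg_add_eq_sub]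
  refine (h _ (sub_mem hc' hc) (sub_ne_zero.2 hne.symm)).trans ?_
  refine (Nat.add_le_add_left (balancedWeight_le ((c' - c) ∘ Sum.inr)) _).trans ?_
  refine Eq.le ?_
  simp only [hammingNorm, Finset.card_filter, Fintype.sum_sum_type, Function.comp_apply]

namespace IsMSequence

variable {m : ℕ} {s : ℕ → ZMod 2}

theorem sum_window_shift [NeZero (2 ^ m - 1)] (hs : IsMSequence m s)
    (G : (Fin m → ZMod 2) → ZMod 2) (b : ℕ) :
    ∑ i : Fin (2 ^ m - 1), G (window m s (i + b)) = ∑ i : Fin (2 ^ m - 1), G (window m s i) := by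
  refine Eq.trans ?_ (Equiv.sum_comp (Equiv.addRight (Fin.ofNat (2 ^ m - 1) b))
    fun i : Fin (2 ^ m - 1) => G (window m s i))
  refine Finset.sum_congr rfl fun i _ => ?_
  rw [Equiv.coe_addRight, Fin.val_add, Fin.val_ofNat, Nat.add_mod_mod, hs.window_mod]

/-- A flat of positive dimension has an even number of points, and none of these is the punctured
one. -/
theorem flatChecks_one [NeZero (2 ^ m - 1)] (hs : IsMSequence m s) {h : ℕ} (hh : h < m) :
    FlatChecks s h (1 : Fin (2 ^ m - 1) → ZMod 2) := by
  rintro b v ⟨l, hl, hl0⟩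
  have h1 := sum_flat_eq_zero (h := h) (r := 0) (by omega : h + 0 < m) v
    (const_mem_reedMuller 0 m 1)
  let G : (Fin m → ZMod 2) → ZMod 2 := fun x =>
    if ∀ l : Fin m, (l : ℕ) < h → x l = v l then 1 else 0
  have h0 : G 0 = 0 := if_neg fun H => hl0 (H ⟨l, by omega⟩ hl).symm
  change ∑ x, G x = 0 at h1
  rw [← hs.sum_window G h0, ← hs.sum_window_shift G b] at h1
  refine Eq.trans ?_ h1
  refine Finset.sum_congr rfl fun q _ => ?_
  simp only [G, forall_lt_iff_window hh.le, Pi.one_apply]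

theorem FlatChecks.add {k h : ℕ} {c c' : Fin k → ZMod 2} (hc : FlatChecks s h c)
    (hc' : FlatChecks s h c') : FlatChecks s h (c + c') := by
  intro b v hv
  rw [← add_zero (0 : ZMod 2)]
  refine Eq.trans ?_ (congrArg₂ (· + ·) (hc b v hv) (hc' b v hv))
  rw [← Finset.sum_add_distrib]
  refine Finset.sum_congr rfl fun q _ => ?_
  split_ifs <;> simp

theorem isTwoBalanced [NeZero (2 ^ m - 1)] (hm : 1 ≤ m) (hs : IsMSequence m s) :
    IsTwoBalanced (doubleCirculantCode (hs.column hm (m / 2))) (designDistance m) := by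
  intro c hc hc0
  obtain ⟨u, rfl⟩ := mem_doubleCirculantCode.1 hc
  rw [Sum.elim_comp_inl, Sum.elim_comp_inr]
  have hu : u ≠ 0 := by
    rintro rfl
    apply hc0
    ext i
    cases i <;> simp
  -- Here the designed distance is 1, and u ≠ 0 is enough.
  by_cases hm3 : m ≤ 2
  · rw [designDistance, errorRadius_of_le hm3]
    have := hammingNorm_pos_iff.2 hu
    omega
  obtain ⟨v, hv⟩ : ∃ v, (Matrix.circulant (hs.column hm (m / 2))).mulVec u = v := ⟨_, rfl⟩
  rw [hv]
  by_cases hv0 : v = 0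
  · have h1 : designDistance m < hammingNorm fun q => u (-q) := by
      refine (Nat.lt_succ_self _).trans (hs.lt_hammingNorm_of_flatChecks (h := m - m / 2 - 1)
        (t := 2 * (errorRadius m + 1)) (by omega) (errorRadius_bound (by omega) (by omega))
        (hs.flatChecks_of_circulant_eq_zero hm (by omega) (hv.trans hv0)) ?_)
      intro h
      apply hu
      funext q
      simpa using congrFun h (-q)
    have h2 : hammingNorm (fun q => u (-q)) = hammingNorm u := by
      simp only [hammingNorm, Finset.card_filter]
      exact Equiv.sum_comp (Equiv.neg _) (fun q => if u q ≠ 0 then 1 else 0)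
    omega
  · have hvI := hs.circulant_mem_dualIdeal hm (m / 2) u
    rw [hv] at hvI
    have hvF := hs.flatChecks_of_mem_dualIdeal (le_refl (m / 2)) (by omega) hvI
    have hbound := errorRadius_bound (m := m) (h := m / 2) (by omega) (by omega)
    -- If Au ≠ 0, the second half alone reaches the bound.
    refine le_add_left (le_ciInf fun β => ?_)
    have hβ : β = 0 ∨ β = 1 := by
      revert β
      decide
    rcases hβ with rfl | rfl
    · have h1 := hs.lt_hammingNorm_of_flatChecks (by omega) hbound hvF hv0
      change _ ≤ hammingNorm v
      rw [designDistance]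
      omega
    · have h1 := hs.lt_hammingNorm_of_flatChecks (by omega) hbound
        (FlatChecks.add hvF (hs.flatChecks_one (by omega))) (by
          intro h
          -- Otherwise Au would be the all-one word. But Au is orthogonal to the constant 1, the
          -- monomial of the empty set, and k is odd.
          have hv1 : ∀ i, v i = 1 := by
            intro i
            have := congrFun h i
            simp only [Pi.add_apply, Pi.one_apply, Pi.zero_apply] at this
            revert this
            generalize v i = z
            revert z
            decide
          have h2 := (hs.wordPoly_mem_dualIdeal_iff _).1 hvI ∅ (by simp)
          simp only [hv1, monomialFun_apply, Finset.prod_empty, mul_one, Finset.sum_const,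
            Finset.card_univ, Fintype.card_fin, nsmul_eq_mul] at h2
          rw [Nat.cast_sub Nat.one_le_two_pow, Nat.cast_pow] at h2
          rw [show ((2 : ℕ) : ZMod 2) = 0 by decide, zero_pow (by omega)] at h2
          exact absurd h2 (by decide))
      have h3 : hammingNorm (v + 1) = (Finset.univ.filter fun i => v i ≠ 1).card := by
        rw [hammingNorm]
        congr 1
        ext i
        simp only [Pi.add_apply, Pi.one_apply, Finset.mem_filter, Finset.mem_univ, true_and]
        generalize v i = z
        revert z
        decide
      rw [← h3, designDistance]
      omega

/-- Decoding: from a word at distance at most `errorRadius m` from a codeword, two rounds of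
majority votes and one division recover the information part of the codeword. -/
theorem decode_eq [NeZero (2 ^ m - 1)] (hm : 1 ≤ m) (hs : IsMSequence m s)
    {w₀ w₁ e₁ e₀ x : Fin (2 ^ m - 1) → ZMod 2}
    (he₁ : ∀ i : Fin (2 ^ m - 1), e₁ i = flatMajority s (m / 2)
      (w₁ + (Matrix.circulant (hs.column hm (m / 2))).mulVec w₀) i)
    {V : ℕ → ZMod 2} {u a : ℕ → ZMod 2}
    (ha : ∀ i : Fin (2 ^ m - 1), a i = hs.column hm (m / 2) i)
    (hV : ∀ i : Fin (2 ^ m - 1),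
      V i = (w₁ + (Matrix.circulant (hs.column hm (m / 2))).mulVec w₀) i + e₁ i)
    (hu : ∀ n < 2 ^ m - 1, u n = V n + ∑ i ∈ Finset.range n, u i * a (n - i))
    (he₀ : ∀ i : Fin (2 ^ m - 1), e₀ i = flatMajority s (m - m / 2 - 1)
      (fun q : Fin (2 ^ m - 1) => u ((-q : Fin (2 ^ m - 1)) : ℕ)) i)
    (hx : hammingNorm (w₀ + x) +
      hammingNorm (w₁ + (Matrix.circulant (hs.column hm (m / 2))).mulVec x) ≤ errorRadius m) :
    (fun q => w₀ q + e₀ (-q)) = x := by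
  set A := Matrix.circulant (hs.column hm (m / 2)) with hA
  set f₀ := w₀ + x with hf₀
  set f₁ := w₁ + A.mulVec x with hf₁
  -- In the syndrome the information part x cancels.
  have hsyn : w₁ + A.mulVec w₀ = A.mulVec f₀ + f₁ := by
    rw [hf₀, hf₁, Matrix.mulVec_add]
    funext i
    simp only [Pi.add_apply]
    generalize w₁ i = p
    generalize A.mulVec w₀ i = q
    generalize A.mulVec x i = r
    revert p q r
    decide
  rw [hsyn] at he₁ hV
  have key : e₀ = fun q => f₀ (-q) := by
    by_cases hm3 : m ≤ 2
    · rw [errorRadius_of_le hm3] at hx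
      have h0 : f₀ = 0 := hammingNorm_eq_zero.1 (by omega)
      have h1 : f₁ = 0 := hammingNorm_eq_zero.1 (by omega)
      rw [h0, h1] at he₁ hV
      rw [Matrix.mulVec_zero, add_zero] at he₁ hV
      simp only [flatMajority_zero] at he₁
      simp only [he₁, Pi.zero_apply, add_zero] at hV
      have hu0 : ∀ n < 2 ^ m - 1, u n = 0 := by
        intro n
        induction n using Nat.strong_induction_on with
        | _ n ih =>
          intro hn
          rw [hu n hn, hV ⟨n, hn⟩, zero_add]
          refine Finset.sum_eq_zero fun i hi => ?_
          rw [Finset.mem_range] at hi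
          rw [ih i hi (by omega), zero_mul]
      have hz : (fun q : Fin (2 ^ m - 1) => u ((-q : Fin (2 ^ m - 1)) : ℕ)) = 0 :=
        funext fun q => hu0 _ (-q).2
      rw [hz] at he₀
      funext i
      rw [he₀ i, flatMajority_zero, h0, Pi.zero_apply]
    · have hmaj₁ : e₁ = f₁ := by
        funext i
        rw [he₁ i]
        exact hs.flatMajority_add (by omega) (errorRadius_bound (by omega) (by omega))
          (hs.flatChecks_of_mem_dualIdeal le_rfl (by omega) (hs.circulant_mem_dualIdeal hm _ f₀))
          (by omega) i
      have hV' : ∀ i : Fin (2 ^ m - 1), V i = A.mulVec f₀ i := by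
        intro i
        rw [hV, hmaj₁, Pi.add_apply, add_assoc, CharTwo.add_self_eq_zero, add_zero]
      have hdiv := hs.circulant_mulVec_of_recurrence hm ha hV' hu
      -- The division finds f₀ only up to the kernel of A. Reversed kernel words satisfy flat
      -- checks, so f₀ plays the part of the error in the second vote.
      have hker : A.mulVec ((fun i : Fin (2 ^ m - 1) => u i) + f₀) = 0 := by
        rw [Matrix.mulVec_add, hdiv]
        funext i
        exact CharTwo.add_self_eq_zero _
      have hrev : (fun q : Fin (2 ^ m - 1) => u ((-q : Fin (2 ^ m - 1)) : ℕ)) =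
          (fun q => ((fun i : Fin (2 ^ m - 1) => u i) + f₀) (-q)) + fun q => f₀ (-q) := by
        funext q
        simp only [Pi.add_apply]
        rw [add_assoc, CharTwo.add_self_eq_zero, add_zero]
      have hnorm : hammingNorm (fun q => f₀ (-q)) = hammingNorm f₀ := by
        simp only [hammingNorm, Finset.card_filter]
        exact Equiv.sum_comp (Equiv.neg _) (fun q => if f₀ q ≠ 0 then 1 else 0)
      funext i
      rw [he₀ i, hrev]
      exact hs.flatMajority_add (by omega) (errorRadius_bound (by omega) (by omega))
        (hs.flatChecks_of_circulant_eq_zero hm (by omega) hker) (by omega) i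
  funext q
  have hq : e₀ (-q) = f₀ (- -q) := congrFun key (-q)
  rw [hq, neg_neg, hf₀, Pi.add_apply, ← add_assoc, CharTwo.add_self_eq_zero, zero_add]

end IsMSequence

/-! ### Programs: digits, constants and the search for the sequence. -/

/-- The value of register `x` has a digit `1` at the place given by register `y`; array `1` holds
the powers of two. -/
def BExpr.bitAt (x y : ℕ) : BExpr :=
  .parity 23 (.le (.mul 24 (.add (.var 23) (.lit 1)) (.get 1 (.var y))) (.var x))

/-- The indices i with (i + 1) 2^y ≤ x number ⌊x / 2^y⌋, and the parity of this quotient is the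
digit. -/
theorem BExpr.holds_bitAt {s : RamState} {x y : ℕ} (hx : x ≠ 23) (hy : y ≠ 23)
    (hy' : y ≠ 24) (hxN : s.reg x ≤ s.reg 1) (hpow : s.arr 1 (s.reg y) = 2 ^ s.reg y) :
    (bitAt x y).Holds s ↔ (s.reg x).testBit (s.reg y) = true := by
  rw [bitAt, holds_parity]
  have h1 : (Finset.range (s.reg 1)).filter (fun i =>
      (BExpr.le (.mul 24 (.add (.var 23) (.lit 1)) (.get 1 (.var y))) (.var x)).Holds
        (s.setReg 23 i)) = Finset.range (s.reg x / 2 ^ s.reg y) := by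
    ext i
    rw [Finset.mem_filter, Finset.mem_range, Finset.mem_range, holds_le, eval_var, reg_setReg,
      if_neg hx]
    have hle : s.reg x / 2 ^ s.reg y ≤ s.reg x := Nat.div_le_self _ _
    by_cases hi : i < s.reg 1
    · rw [eval_mul (u := i + 1) (v := 2 ^ s.reg y), ← Nat.le_div_iff_mul_le (by positivity)]
      · omega
      · intro j
        simp
      · intro j
        simp [hy, hy', hpow]
      · simpa using hi
    · constructor
      · exact fun h => absurd h.1 hi
      · intro h
        omega
  rw [h1, Finset.card_range, Nat.testBit_eq_decide_div_mod_eq, decide_eq_true_eq]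

namespace DoubleCirculant

open BExpr BProg

/-- The constants are in place: register `0` holds `k`, register `1` a bound for all loops,
registers `2`, `3`, `7`, `8` hold `m`, `⌊m/2⌋`, `2k` and `m - ⌊m/2⌋ - 1`, arrays `1` and `3` the
powers of two and the multiples of `k`. -/
structure IsSetup (m : ℕ) (s : RamState) : Prop where
  reg0 : s.reg 0 = 2 ^ m - 1
  reg1 : s.reg 1 = 3 * (2 ^ m - 1) + 3
  reg2 : s.reg 2 = m
  reg3 : s.reg 3 = m / 2
  reg7 : s.reg 7 = 2 * (2 ^ m - 1)
  reg8 : s.reg 8 = m - m / 2 - 1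
  pow : ∀ l < s.reg 1, s.arr 1 l = 2 ^ l
  mul : ∀ i < s.reg 1, s.arr 3 i = i * (2 ^ m - 1)

theorem IsSetup.congr {m : ℕ} {s σ : RamState} (h : IsSetup m s)
    (hr : ∀ x ∈ [0, 1, 2, 3, 7, 8], σ.reg x = s.reg x) (ha : ∀ n ∈ [1, 3], σ.arr n = s.arr n) :
    IsSetup m σ := by
  simp only [List.mem_cons, List.not_mem_nil, or_false, forall_eq_or_imp, forall_eq] at hr ha
  obtain ⟨h0, h1, h2, h3, h7, h8⟩ := hr
  exact ⟨h0.trans h.reg0, h1.trans h.reg1, h2.trans h.reg2, h3.trans h.reg3, h7.trans h.reg7,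
    h8.trans h.reg8, by simpa [h1, ha.1] using h.pow, by simpa [h1, ha.2] using h.mul⟩

theorem IsSetup.den {m : ℕ} {s : RamState} (h : IsSetup m s) (p : BProg)
    (hr : ∀ x ∈ [0, 1, 2, 3, 7, 8], p.WritesReg x = false)
    (ha : ∀ n ∈ [1, 3], p.WritesArr n = false) : IsSetup m (p.den s) :=
  h.congr (fun x hx => den_reg p (hr x hx) s) fun n hn => den_arr p (ha n hn) s

/-- Powers of two, `m`, `⌊m/2⌋` and the other constants. -/
def setup : BProg :=
  .seq (tab 1 10 1 (.cond (.var 10) (.add (.get 1 (.sub (.var 10) (.lit 1)))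
    (.get 1 (.sub (.var 10) (.lit 1)))) (.lit 1))) <|
  .seq (tab 3 10 1 (.cond (.var 10) (.add (.get 3 (.sub (.var 10) (.lit 1))) (.var 0))
    (.lit 0))) <|
  .seq (.set 2 (.count 20 (.le (.get 1 (.var 20)) (.var 0)))) <|
  .seq (.set 3 (.count 20 (.lt (.add (.add (.var 20) (.var 20)) (.lit 1)) (.var 2)))) <|
  .seq (.set 7 (.add (.var 0) (.var 0))) (.set 8 (.sub (.sub (.var 2) (.var 3)) (.lit 1)))

theorem self_le_two_pow_sub_one (m : ℕ) : m ≤ 2 ^ m - 1 := by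
  have := Nat.lt_two_pow_self (n := m)
  omega

theorem isSetup_setup {m : ℕ} {s : RamState} (h0 : s.reg 0 = 2 ^ m - 1)
    (h1 : s.reg 1 = 3 * (2 ^ m - 1) + 3) : IsSetup m (setup.den s) := by
  have hm := self_le_two_pow_sub_one m
  set p₁ := tab 1 10 1 (.cond (.var 10) (.add (.get 1 (.sub (.var 10) (.lit 1)))
    (.get 1 (.sub (.var 10) (.lit 1)))) (.lit 1)) with hp₁
  set p₂ := tab 3 10 1 (.cond (.var 10) (.add (.get 3 (.sub (.var 10) (.lit 1))) (.var 0))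
    (.lit 0)) with hp₂
  have hpow : ∀ l < s.reg 1, (p₁.den s).arr 1 l = 2 ^ l := by
    intro l hl
    refine den_tab (by norm_num) (fun l => 2 ^ l) ?_ hl hl
    intro i hi _ σ hr _ _ hlt
    rcases i with _ | i
    · simp
    · simp [hlt i (by omega), pow_succ, mul_two]
  have hs₁ : ∀ x, x ≠ 10 → (p₁.den s).reg x = s.reg x :=
    fun x hx => den_reg p₁ (by simpa [hp₁] using hx) s
  have hmul : ∀ l < s.reg 1, (p₂.den (p₁.den s)).arr 3 l = l * (2 ^ m - 1) := by
    intro l hl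
    rw [← hs₁ 1 (by norm_num)] at hl
    refine den_tab (by norm_num) (fun l => l * (2 ^ m - 1)) ?_ hl hl
    intro i hi _ σ hr _ _ hlt
    rcases i with _ | i
    · simp
    · simp [hlt i (by omega), hr, hs₁, h0, add_mul]
  set s₂ := p₂.den (p₁.den s) with hs₂
  have hr₂ : ∀ x, x ≠ 10 → s₂.reg x = s.reg x := by
    intro x hx
    rw [hs₂, den_reg p₂ (by simpa [hp₂] using hx), hs₁ x hx]
  have ha₂ : ∀ l < s.reg 1, s₂.arr 1 l = 2 ^ l := by
    intro l hl
    rw [hs₂, den_arr p₂ (by simp [hp₂]), hpow l hl]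
  -- m is the number of i with 2^i ≤ 2^m - 1, and below ⌊m/2⌋ is the number of i with 2i + 1 < m.
  have hreg2 : (BExpr.count 20 (.le (.get 1 (.var 20)) (.var 0))).eval s₂ = m := by
    rw [eval_count, hr₂ 1 (by norm_num)]
    have : (Finset.range (s.reg 1)).filter (fun i =>
        (BExpr.le (.get 1 (.var 20)) (.var 0)).Holds (s₂.setReg 20 i)) = Finset.range m := by
      ext i
      simp only [Finset.mem_filter, Finset.mem_range, holds_le, eval_get, eval_var, reg_setReg,
        arr_setReg, if_true, hr₂ 0 (by norm_num), h0, show (0 : ℕ) ≠ 20 by norm_num, if_false]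
      constructor
      · rintro ⟨hi, hle⟩
        rw [ha₂ i hi] at hle
        by_contra! hmi
        have := Nat.pow_le_pow_right (n := 2) (by norm_num) hmi
        have := Nat.one_le_two_pow (n := m)
        omega
      · intro hi
        have h2 := Nat.pow_lt_pow_right (a := 2) (by norm_num) hi
        refine ⟨by omega, ?_⟩
        rw [ha₂ i (by omega)]
        omega
    rw [this, Finset.card_range]
  have hreg3 : (BExpr.count 20 (.lt (.add (.add (.var 20) (.var 20)) (.lit 1)) (.var 2))).eval
      (s₂.setReg 2 m) = m / 2 := by
    rw [eval_count]
    have : (Finset.range ((s₂.setReg 2 m).reg 1)).filter (fun i =>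
        (BExpr.lt (.add (.add (.var 20) (.var 20)) (.lit 1)) (.var 2)).Holds
          ((s₂.setReg 2 m).setReg 20 i)) = Finset.range (m / 2) := by
      ext i
      simp only [Finset.mem_filter, Finset.mem_range, reg_setReg, holds_lt, eval_add, eval_var,
        eval_lit, if_true, show (1 : ℕ) ≠ 2 by norm_num, show (2 : ℕ) ≠ 20 by norm_num, if_false,
        hr₂ 1 (by norm_num), h1]
      omega
    rw [this, Finset.card_range]
  have hden : setup.den s = (((s₂.setReg 2 m).setReg 3 (m / 2)).setReg 7
      (2 * (2 ^ m - 1))).setReg 8 (m - m / 2 - 1) := by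
    simp only [setup, BProg.den, ← hp₁, ← hp₂, ← hs₂, hreg2, hreg3]
    simp [hr₂, h0, two_mul]
  rw [hden]
  constructor <;> simp [hr₂, h0, h1]
  · simpa [h1] using ha₂
  · simpa [h1] using hmul

/-- The entries of the sequence with feedback coefficients given by register `10`. -/
def generateSequence : BProg :=
  tab 2 11 1 (.cond (.lt (.var 11) (.var 2)) (.eq (.add (.var 11) (.lit 1)) (.var 2))
    (.parity 20 (.and (.lt (.var 20) (.var 2)) (.and (bitAt 10 20)
      (.get 2 (.add (.sub (.var 11) (.var 2)) (.var 20)))))))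

theorem den_generateSequence {m c : ℕ} {s : RamState} (h : IsSetup m s) (h10 : s.reg 10 = c)
    (hc : c < 2 ^ m) {n : ℕ} (hn : n < s.reg 1) :
    (generateSequence.den s).arr 2 n = (lfsr m c n).val := by
  have hm := self_le_two_pow_sub_one m
  have hN := h.reg1
  refine den_tab (by norm_num) (fun n => (lfsr m c n).val) ?_ hn hn
  intro i hi _ σ hr ha _ hlt
  have hr1 : σ.reg 1 = s.reg 1 := hr 1 (by norm_num)
  have hr2 : σ.reg 2 = m := (hr 2 (by norm_num)).trans h.reg2
  have hr10 : σ.reg 10 = c := (hr 10 (by norm_num)).trans h10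
  simp only [eval_cond, holds_lt, eval_var, reg_setReg, if_true, show (2 : ℕ) ≠ 11 by norm_num, if_false, hr2]
  split_ifs with him
  · rw [lfsr_of_lt _ him]
    simp only [eval_eq, eval_add, eval_var, eval_lit, reg_setReg, if_true,
      show (2 : ℕ) ≠ 11 by norm_num, if_false, hr2]
    split_ifs <;> rfl
  · obtain ⟨j, rfl⟩ : ∃ j, i = j + m := ⟨i - m, by omega⟩
    rw [lfsr_add]
    refine eval_parity_eq _ m _ (by simp [hr1]; omega) fun l hl => ?_
    have hl' : l < s.reg 1 := by simpa [hr1] using hl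
    rw [holds_and, holds_and, holds_bitAt (by norm_num) (by norm_num) (by norm_num)]
    · simp only [holds_lt, eval_var, reg_setReg, holds_get, eval_add, eval_sub, arr_setReg]
      simp only [if_true, show (2 : ℕ) ≠ 20 by norm_num, show (2 : ℕ) ≠ 11 by norm_num,
        show (10 : ℕ) ≠ 20 by norm_num, show (10 : ℕ) ≠ 11 by norm_num,
        show (11 : ℕ) ≠ 20 by norm_num, if_false, hr2, hr10, Nat.add_sub_cancel]
      refine and_congr_right fun hlm => ?_
      rw [hlt _ (by omega)]
      split_ifs with hb <;> simp [hb, ZMod.val_eq_zero]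
    · simp [hr1, hr10]
      omega
    · simp [ha 1, h.pow l hl']

/-- Whether the sequence returns to its initial window after exactly `k` steps. -/
def testSequence : BProg :=
  .set 4 (.and
    (.all 20 (.imp (.and (.lt (.lit 0) (.var 20)) (.lt (.var 20) (.var 0)))
      (.ex 21 (.and (.lt (.var 21) (.var 2))
        (.neg (.eq (.get 2 (.add (.var 20) (.var 21))) (.get 2 (.var 21))))))))
    (.all 21 (.imp (.lt (.var 21) (.var 2))
      (.eq (.get 2 (.add (.var 0) (.var 21))) (.get 2 (.var 21))))))

theorem den_testSequence {m c : ℕ} {s : RamState} (h : IsSetup m s)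
    (hS : ∀ n < s.reg 1, s.arr 2 n = (lfsr m c n).val) :
    (testSequence.den s).reg 4 ≠ 0 ↔ LfsrPrimitive m c := by
  have hm := self_le_two_pow_sub_one m
  have hN := h.reg1
  simp only [testSequence, BProg.den, reg_setReg, if_true]
  change BExpr.Holds s _ ↔ _
  simp only [holds_and, holds_all, holds_imp, holds_lt, holds_ex, holds_neg, holds_eq, eval_get,
    eval_add, eval_var, eval_lit, reg_setReg, arr_setReg, LfsrPrimitive]
  simp only [if_true, show (0 : ℕ) ≠ 20 by norm_num, show (1 : ℕ) ≠ 20 by norm_num,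
    show (20 : ℕ) ≠ 21 by norm_num, show (2 : ℕ) ≠ 21 by norm_num, show (2 : ℕ) ≠ 20 by norm_num,
    show (0 : ℕ) ≠ 21 by norm_num, if_false, h.reg0, h.reg2]
  refine and_congr ⟨fun H i h0 hik => ?_, fun H i hi ⟨h0, hik⟩ => ?_⟩
    ⟨fun H l hl => ?_, fun H l hlN hl => ?_⟩
  · obtain ⟨l, hlN, hl, hne⟩ := H i (by omega) ⟨h0, hik⟩
    rw [hS _ (by omega), hS _ (by omega)] at hne
    exact ⟨l, hl, fun heq => hne (by rw [heq])⟩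
  · obtain ⟨l, hl, hne⟩ := H i h0 hik
    refine ⟨l, by omega, hl, ?_⟩
    rw [hS _ (by omega), hS _ (by omega)]
    exact fun heq => hne (ZMod.val_injective 2 heq)
  · have := H l (by omega) hl
    rw [hS _ (by omega), hS _ (by omega)] at this
    exact ZMod.val_injective 2 this
  · rw [hS _ (by omega), hS _ (by omega), H l hl]

/-- The search for feedback coefficients. -/
def searchSequence : BProg :=
  .seq (.set 4 (.lit 0)) (.loop 10
    (.ite (.and (.neg (.var 4)) (.lt (.var 10) (.get 1 (.var 2))))
      (.seq generateSequence testSequence) .skip))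

/-- The least feedback coefficients of a sequence of maximal period. -/
noncomputable def leastFeedback (m : ℕ) : ℕ := sInf {c | c < 2 ^ m ∧ LfsrPrimitive m c}

theorem leastFeedback_spec {m : ℕ} (hm : 1 ≤ m) :
    leastFeedback m < 2 ^ m ∧ LfsrPrimitive m (leastFeedback m) :=
  Nat.sInf_mem (exists_lfsrPrimitive hm)

/-- The sequence that the search finds. -/
noncomputable def maximalSequence (m : ℕ) : ℕ → ZMod 2 := lfsr m (leastFeedback m)

theorem isMSequence_maximalSequence {m : ℕ} (hm : 1 ≤ m) : IsMSequence m (maximalSequence m) :=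
  (leastFeedback_spec hm).2.isMSequence hm

/-- Invariant: either nothing is found and the index has not passed the least good coefficients, or
array 2 holds their sequence and is no longer touched. The first alternative is impossible at the
end because N ≥ 2^m. -/
theorem den_searchSequence {m : ℕ} (hm : 1 ≤ m) {s : RamState} (h : IsSetup m s) {n : ℕ}
    (hn : n < s.reg 1) : (searchSequence.den s).arr 2 n = (maximalSequence m n).val := by
  obtain ⟨hc, hprim⟩ := leastFeedback_spec hm
  have hmk := self_le_two_pow_sub_one m
  have hN := h.reg1
  have h4 : IsSetup m (s.setReg 4 0) := h.congr (by simp) (by simp)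
  have h41 : (s.setReg 4 0).reg 1 = s.reg 1 := by simp
  obtain ⟨σ, hσ, hden⟩ := den_loop (x := 10)
    (p := .ite (.and (.neg (.var 4)) (.lt (.var 10) (.get 1 (.var 2))))
      (.seq generateSequence testSequence) .skip) (s := s.setReg 4 0)
    (fun i σ => (σ.reg 4 = 0 ∧ i ≤ leastFeedback m) ∨
      (σ.reg 4 ≠ 0 ∧ ∀ n < s.reg 1, σ.arr 2 n = (maximalSequence m n).val))
    (by left; simp)
    (by
      intro i hi σ hr ha hI
      have hσ : IsSetup m (σ.setReg 10 i) := by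
        refine h4.congr (fun x hx => ?_) fun n hn => ?_
        · rw [← hr x]
          · simp only [List.mem_cons, List.not_mem_nil, or_false] at hx
            rcases hx with rfl | rfl | rfl | rfl | rfl | rfl <;> simp
          · simp only [List.mem_cons, List.not_mem_nil, or_false] at hx
            rcases hx with rfl | rfl | rfl | rfl | rfl | rfl <;> rfl
        · rw [arr_setReg]
          apply ha
          simp only [List.mem_cons, List.not_mem_nil, or_false] at hn
          rcases hn with rfl | rfl <;> rfl
      have hσ1 : (σ.setReg 10 i).reg 1 = s.reg 1 := by rw [hσ.reg1, hN]
      have hcond : (BExpr.and (.neg (.var 4)) (.lt (.var 10) (.get 1 (.var 2)))).eval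
          (σ.setReg 10 i) = if σ.reg 4 = 0 ∧ i < 2 ^ m then 1 else 0 := by
        have h2 := hσ.pow m (by omega)
        have h3 := hσ.reg2
        simp only [eval_and, holds_neg, holds_var, holds_lt, eval_get, eval_var]
        rw [h3, h2]
        simp
      rcases hI with ⟨h40, hle⟩ | ⟨h40, hS⟩
      · have hgen : ∀ n < (σ.setReg 10 i).reg 1, _ :=
          fun n hn => den_generateSequence (c := i) (n := n) hσ (by simp) (by omega) hn
        set τ := generateSequence.den (σ.setReg 10 i) with hτ
        have hτs : IsSetup m τ := hσ.den _ (by decide) (by decide)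
        have hτ1 : τ.reg 1 = s.reg 1 := by rw [hτs.reg1, hN]
        rw [hσ1, ← hτ1] at hgen
        have htest := den_testSequence hτs hgen
        have hstep : (BProg.ite (.and (.neg (.var 4)) (.lt (.var 10) (.get 1 (.var 2))))
            (.seq generateSequence testSequence) .skip).den (σ.setReg 10 i) =
            testSequence.den τ := by
          simp only [BProg.den, hcond]
          rw [if_pos (show σ.reg 4 = 0 ∧ i < 2 ^ m from ⟨h40, by omega⟩), if_neg one_ne_zero]
        rw [hstep]
        by_cases hi : LfsrPrimitive m i
        · right
          have : i = leastFeedback m :=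
            le_antisymm hle (Nat.sInf_le ⟨by omega, hi⟩)
          refine ⟨htest.2 hi, fun n hn => ?_⟩
          rw [den_arr testSequence rfl, hgen _ (by omega), this, maximalSequence]
        · left
          refine ⟨not_not.1 fun h => hi (htest.1 h), ?_⟩
          refine lt_of_le_of_ne hle ?_
          rintro rfl
          exact hi hprim
      · right
        simp only [BProg.den, hcond]
        rw [if_neg (show ¬ (σ.reg 4 = 0 ∧ i < 2 ^ m) from fun hh => h40 hh.1), if_pos rfl]
        refine ⟨by simpa using h40, hS⟩)
  have hfin : searchSequence.den s = σ.setReg 10 ((s.setReg 4 0).reg 1) := by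
    rw [← hden]
    rfl
  rw [hfin, arr_setReg]
  rcases hσ with ⟨-, hle⟩ | ⟨-, hS⟩
  · rw [h41] at hle
    omega
  · exact hS n hn

end DoubleCirculant

theorem BExpr.eval_parity_fin (s : RamState) {x k : ℕ} {e : BExpr} (f : Fin k → ZMod 2)
    (hk : k ≤ s.reg 1) (h : ∀ i : Fin k, e.Holds (s.setReg x i) ↔ f i ≠ 0)
    (h' : ∀ i, k ≤ i → ¬ e.Holds (s.setReg x i)) :
    (BExpr.parity x e).eval s = (∑ i, f i).val := by
  rw [eval_parity_eq s k (fun i => if hi : i < k then f ⟨i, hi⟩ else 0) hk, Finset.sum_range]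
  · simp
  · intro i _
    by_cases hi : i < k
    · simp [hi, h ⟨i, hi⟩]
    · simp [hi, h' i (not_lt.1 hi)]

theorem ZMod.val_ne_zero_iff {n : ℕ} (a : ZMod n) : a.val ≠ 0 ↔ a ≠ 0 :=
  (ZMod.val_eq_zero a).not

theorem ZMod.val_mul_of_two (a b : ZMod 2) : (a * b).val = if a ≠ 0 ∧ b ≠ 0 then 1 else 0 := by
  revert a b
  decide

/-! ### Programs: elimination. -/

namespace DoubleCirculant

open BExpr BProg IsMSequence

/-- The set of binary digits of a number. -/
def bitset (m c : ℕ) : Finset (Fin m) := Finset.univ.filter fun l => c.testBit l = true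

theorem mem_bitset {m c : ℕ} {l : Fin m} : l ∈ bitset m c ↔ c.testBit l = true := by
  simp [bitset]

theorem exists_bitset_eq {m : ℕ} (S : Finset (Fin m)) : ∃ c < 2 ^ m, bitset m c = S := by
  refine ⟨Nat.ofBits fun l : Fin m => decide (l ∈ S), Nat.ofBits_lt_two_pow _, ?_⟩
  ext l
  rw [mem_bitset, Nat.testBit_ofBits_lt _ _ l.2]
  simp

theorem val_monomialWord {m : ℕ} (s : ℕ → ZMod 2) (S : Finset (Fin m)) (i : Fin (2 ^ m - 1)) :
    (monomialWord m s S i).val = if ∀ l ∈ S, s (i + l) ≠ 0 then 1 else 0 := by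
  rw [monomialWord, monomialFun_apply]
  have h : (∀ l ∈ S, s (i + l) ≠ 0) ↔ ∏ l ∈ S, window m s i l ≠ 0 :=
    Finset.prod_ne_zero_iff.symm
  rw [if_congr h rfl rfl]
  generalize ∏ l ∈ S, window m s i l = z
  revert z
  decide

/-- The monomial whose exponents are the digits of register `10`, along the sequence. -/
def monomialProg : BProg :=
  tab 5 11 0 (.all 20 (.imp (.and (.lt (.var 20) (.var 2)) (bitAt 10 20))
    (.get 2 (.add (.var 11) (.var 20)))))

theorem den_monomialProg {m y : ℕ} {s : RamState} {S : ℕ → ZMod 2} (h : IsSetup m s)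
    (hS : ∀ n < s.reg 1, s.arr 2 n = (S n).val) (h10 : s.reg 10 = y) (hy : y < 2 ^ m)
    (i : Fin (2 ^ m - 1)) :
    (monomialProg.den s).arr 5 i = (monomialWord m S (bitset m y) i).val := by
  have hm := self_le_two_pow_sub_one m
  have hN := h.reg1
  have hi := i.2
  refine den_tab (by norm_num)
    (fun i => if hi : i < 2 ^ m - 1 then (monomialWord m S (bitset m y) ⟨i, hi⟩).val else 0) ?_
    (by omega) (by rw [h.reg0]; exact hi) |>.trans (by simp)
  intro i _ hi σ hr ha _ _
  rw [h.reg0] at hi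
  have hr0 : σ.reg 0 = 2 ^ m - 1 := (hr 0 (by norm_num)).trans h.reg0
  have hr1 : σ.reg 1 = s.reg 1 := hr 1 (by norm_num)
  have hr2 : σ.reg 2 = m := (hr 2 (by norm_num)).trans h.reg2
  have hr10 : σ.reg 10 = y := (hr 10 (by norm_num)).trans h10
  have ha1 := ha 1 (by norm_num)
  have ha2 := ha 2 (by norm_num)
  rw [dif_pos hi, val_monomialWord]
  classical
  rw [eval_all]
  congr 1
  apply propext
  have hbit : ∀ l < s.reg 1, (bitAt 10 20).Holds ((σ.setReg 11 i).setReg 20 l) ↔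
      y.testBit l = true := by
    intro l hl
    rw [holds_bitAt (by norm_num) (by norm_num) (by norm_num)]
    · simp [hr10]
    · simp [hr10, hr1]
      omega
    · simp [ha1, h.pow l hl]
  constructor
  · intro H l hl
    have hlm := l.2
    have := H l (by simp [hr1]; omega)
    rw [holds_imp, holds_and, hbit l (by omega)] at this
    have := this ⟨by simp [hr2], mem_bitset.1 hl⟩
    simpa [ha2, hS (i + l) (by omega), ZMod.val_eq_zero] using this
  · intro H l hl
    have hl' : l < s.reg 1 := by simpa [hr1] using hl
    rw [holds_imp, holds_and, hbit l hl']
    rintro ⟨hlm, hb⟩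
    have hlm' : l < m := by simpa [hr2] using hlm
    have := H ⟨l, hlm'⟩ (mem_bitset.2 hb)
    simpa [ha2, hS (i + l) (by omega), ZMod.val_eq_zero] using this

/-- The entry of the square matrix in array `4` with row in register `x` and column in register
`y`. -/
def entry (x y : ℕ) : BExpr := .get 4 (.add (.get 3 (.var x)) (.var y))

theorem eval_entry {m x y : ℕ} {s : RamState} (h3 : s.arr 3 (s.reg x) = s.reg x * (2 ^ m - 1)) :
    (entry x y).eval s = s.arr 4 (s.reg x * (2 ^ m - 1) + s.reg y) := by
  simp [entry, h3]

theorem holds_entry {m x y : ℕ} {s : RamState} (h3 : s.arr 3 (s.reg x) = s.reg x * (2 ^ m - 1)) :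
    (entry x y).Holds s ↔ s.arr 4 (s.reg x * (2 ^ m - 1) + s.reg y) ≠ 0 := by
  rw [Holds, eval_entry h3]

/-- Scalar products of the rows of the matrix with the word in array `5`. -/
def productProg : BProg :=
  tab 6 11 0 (.parity 20 (.and (.lt (.var 20) (.var 0)) (.and (entry 11 20) (.get 5 (.var 20)))))

/-- The first row whose scalar product does not vanish. -/
def pivotProg : BProg :=
  .set 5 (.count 20 (.all 21 (.imp (.le (.var 21) (.var 20))
    (.neg (.and (.lt (.var 21) (.var 0)) (.get 6 (.var 21)))))))

/-- A copy of the pivot row. -/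
def copyProg : BProg := tab 7 11 0 (entry 5 11)

/-- Addition of the pivot row to the rows whose scalar product does not vanish. -/
def updateProg : BProg :=
  tab₂ 4 3 11 12 0 (.xor (entry 11 12) (.and (.get 6 (.var 11)) (.get 7 (.var 12))))

theorem den_productProg {m : ℕ} {s : RamState} (h : IsSetup m s)
    {b : Fin (2 ^ m - 1) → Fin (2 ^ m - 1) → ZMod 2} {y : Fin (2 ^ m - 1) → ZMod 2}
    (hB : ∀ q i : Fin (2 ^ m - 1), s.arr 4 (q * (2 ^ m - 1) + i) = (b q i).val)
    (hY : ∀ i : Fin (2 ^ m - 1), s.arr 5 i = (y i).val) (q : Fin (2 ^ m - 1)) :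
    (productProg.den s).arr 6 q = (∑ i, b q i * y i).val := by
  have hN := h.reg1
  have hq := q.2
  refine den_tab (by norm_num)
    (fun q => if hq : q < 2 ^ m - 1 then (∑ i, b ⟨q, hq⟩ i * y i).val else 0) ?_
    (by omega) (by rw [h.reg0]; exact hq) |>.trans (by simp)
  intro q hqN hq σ hr ha _ _
  rw [h.reg0] at hq
  rw [dif_pos hq]
  have hr0 : σ.reg 0 = 2 ^ m - 1 := (hr 0 (by norm_num)).trans h.reg0
  have hr1 : σ.reg 1 = s.reg 1 := hr 1 (by norm_num)
  refine eval_parity_fin _ _ (by simp [hr1]; omega) (fun i => ?_) fun i hi => ?_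
  · rw [holds_and, holds_and, holds_entry (m := m) (by simp [ha 3, h.mul q hqN])]
    have h4 := hB ⟨q, hq⟩ i
    simp only at h4
    simp [hr0, ha 4, ha 5, hY, h4, ZMod.val_eq_zero]
  · simp [hr0, hi]

/-- Counts the indices up to which `f` vanishes. If `f` vanishes throughout, the count is N, which
is above every row index and so can be recognized later. -/
theorem eval_pivot {m : ℕ} {s : RamState} (h : IsSetup m s)
    (f : Fin (2 ^ m - 1) → ZMod 2) {e : BExpr}
    (he : ∀ i, e.Holds (s.setReg 20 i) ↔
      ∀ j < s.reg 1, j ≤ i → ¬ ∃ hj : j < 2 ^ m - 1, f ⟨j, hj⟩ ≠ 0) :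
    (∃ p : Fin (2 ^ m - 1), (BExpr.count 20 e).eval s = p ∧ f p ≠ 0 ∧ ∀ q < p, f q = 0) ∨
      ((BExpr.count 20 e).eval s = s.reg 1 ∧ ∀ q, f q = 0) := by
  have hN := h.reg1
  rw [eval_count]
  by_cases hex : ∃ p, f p ≠ 0
  · left
    classical
    obtain ⟨p, hp, hmin⟩ := Finset.exists_min_image (Finset.univ.filter fun p => f p ≠ 0) id
      (by simpa [Finset.filter_nonempty_iff] using hex)
    simp only [Finset.mem_filter, Finset.mem_univ, true_and, id] at hp hmin
    have hlt : ∀ q < p, f q = 0 := by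
      intro q hq
      by_contra hne
      exact absurd (hmin q hne) (not_le.2 hq)
    refine ⟨p, ?_, hp, hlt⟩
    refine Finset.card_filter_initial (fun j => ∃ hj : j < 2 ^ m - 1, f ⟨j, hj⟩ ≠ 0)
      (by have := p.2; omega) ⟨p.2, hp⟩ ?_ fun i _ => he i
    rintro j hj ⟨hjk, hne⟩
    exact hne (hlt ⟨j, hjk⟩ hj)
  · right
    push Not at hex
    refine ⟨?_, hex⟩
    refine Finset.card_filter_initial_of_forall_not
      (fun j => ∃ hj : j < 2 ^ m - 1, f ⟨j, hj⟩ ≠ 0) ?_ fun i _ => he i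
    rintro j _ ⟨hjk, hne⟩
    exact hne (hex _)

/-- One step of the elimination. -/
def eliminationStep : BProg :=
  .seq monomialProg <| .seq productProg <| .seq pivotProg <| .seq copyProg updateProg

/-- Realizes `IsEchelon.insert`, or `IsEchelon.insert_of_forall` if all scalar products vanish.
Products and pivot row are saved first because the matrix is updated in place. -/
theorem den_eliminationStep {m y : ℕ} {s : RamState} {S : ℕ → ZMod 2} (h : IsSetup m s)
    (hS : ∀ n < s.reg 1, s.arr 2 n = (S n).val) (h10 : s.reg 10 = y) (hy : y < 2 ^ m)
    {b : Fin (2 ^ m - 1) → Fin (2 ^ m - 1) → ZMod 2} {Y : Set (Fin (2 ^ m - 1) → ZMod 2)}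
    (hb : IsEchelon b Y)
    (hB : ∀ q i : Fin (2 ^ m - 1), s.arr 4 (q * (2 ^ m - 1) + i) = (b q i).val) :
    ∃ b' : Fin (2 ^ m - 1) → Fin (2 ^ m - 1) → ZMod 2,
      IsEchelon b' (insert (monomialWord m S (bitset m y)) Y) ∧
      ∀ q i : Fin (2 ^ m - 1),
        (eliminationStep.den s).arr 4 (q * (2 ^ m - 1) + i) = (b' q i).val := by
  have hN := h.reg1
  have hY := den_monomialProg h hS h10 hy
  set w := monomialWord m S (bitset m y) with hw
  have h1 : IsSetup m (monomialProg.den s) := h.den _ (by decide) (by decide)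
  have hB1 : (monomialProg.den s).arr 4 = s.arr 4 := den_arr _ rfl _
  set s₁ := monomialProg.den s with hs₁
  have hD := den_productProg h1 (by rwa [hB1]) hY
  have h2 : IsSetup m (productProg.den s₁) := h1.den _ (by decide) (by decide)
  have hB2 : (productProg.den s₁).arr 4 = s.arr 4 := (den_arr _ rfl _).trans hB1
  set s₂ := productProg.den s₁ with hs₂
  set f : Fin (2 ^ m - 1) → ZMod 2 := fun q => ∑ i, b q i * w i with hf
  have hpiv := eval_pivot h2 f (e := .all 21 (.imp (.le (.var 21) (.var 20))
    (.neg (.and (.lt (.var 21) (.var 0)) (.get 6 (.var 21)))))) (by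
      intro i
      have hr0 := h2.reg0
      simp only [holds_all, holds_imp, holds_le, holds_neg, holds_and, holds_lt, holds_get,
        eval_var, reg_setReg, arr_setReg]
      simp only [if_true, show (1 : ℕ) ≠ 20 by norm_num, show (20 : ℕ) ≠ 21 by norm_num,
        show (0 : ℕ) ≠ 20 by norm_num, show (0 : ℕ) ≠ 21 by norm_num, if_false, hr0]
      refine forall₃_congr fun j _ _ => not_congr ?_
      constructor
      · rintro ⟨hj, hne⟩
        exact ⟨hj, (ZMod.val_ne_zero_iff _).1 (by rwa [← hD ⟨j, hj⟩])⟩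
      · rintro ⟨hj, hne⟩
        exact ⟨hj, by rw [hD ⟨j, hj⟩]; exact (ZMod.val_ne_zero_iff _).2 hne⟩)
  have h3 : IsSetup m (pivotProg.den s₂) := h2.den _ (by decide) (by decide)
  have hreg5 : (pivotProg.den s₂).reg 5 = (BExpr.count 20 (.all 21 (.imp (.le (.var 21) (.var 20))
    (.neg (.and (.lt (.var 21) (.var 0)) (.get 6 (.var 21))))))).eval s₂ := by
    simp [pivotProg, BProg.den]
  rw [← hreg5] at hpiv
  have hB3 : (pivotProg.den s₂).arr 4 = s.arr 4 := (den_arr _ rfl _).trans hB2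
  have hD3 : (pivotProg.den s₂).arr 6 = s₂.arr 6 := den_arr _ rfl _
  set s₃ := pivotProg.den s₂ with hs₃
  have h4 : IsSetup m (copyProg.den s₃) := h3.den _ (by decide) (by decide)
  have hB4 : (copyProg.den s₃).arr 4 = s.arr 4 := (den_arr _ rfl _).trans hB3
  have hD4 : (copyProg.den s₃).arr 6 = s₂.arr 6 := (den_arr _ rfl _).trans hD3
  have hR : ∀ p : Fin (2 ^ m - 1), s₃.reg 5 = p → ∀ i : Fin (2 ^ m - 1),
      (copyProg.den s₃).arr 7 i = (b p i).val := by
    intro p hp i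
    have hi := i.2
    have hN3 := h3.reg1
    refine den_tab (by norm_num)
      (fun i => if hi : i < 2 ^ m - 1 then (b p ⟨i, hi⟩).val else 0) ?_
      (by omega) (by rw [h3.reg0]; exact hi) |>.trans (by simp)
    intro i hiN hi σ hr ha _ _
    rw [h3.reg0] at hi
    have hp2 := p.2
    rw [dif_pos hi, eval_entry (m := m)]
    · simp only [reg_setReg, arr_setReg, if_true, show (5 : ℕ) ≠ 11 by norm_num, if_false,
        hr 5 (by norm_num), hp, ha 4 (by norm_num), hB3]
      exact hB p ⟨i, hi⟩
    · simp only [reg_setReg, arr_setReg, show (5 : ℕ) ≠ 11 by norm_num, if_false,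
        hr 5 (by norm_num), hp, ha 3 (by norm_num)]
      exact h3.mul p (by omega)
  set s₄ := copyProg.den s₃ with hs₄
  have hN4 := h4.reg1
  -- Stated for both cases at once. Without a pivot, array 7 may hold anything, since it is
  -- multiplied by vanishing scalar products.
  have hupd : ∀ b' : Fin (2 ^ m - 1) → Fin (2 ^ m - 1) → ZMod 2,
      (∀ q i, ∃ x : ZMod 2, b' q i = b q i + x ∧
        x.val = if f q ≠ 0 ∧ s₄.arr 7 i ≠ 0 then 1 else 0) →
      ∀ q i : Fin (2 ^ m - 1),
        (eliminationStep.den s).arr 4 (q * (2 ^ m - 1) + i) = (b' q i).val := by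
    intro b' hb' q i
    have hq := q.2
    have key := den_tab₂ (n := 4) (c := 3) (x := 11) (y := 12) (b := 0) (s := s₄)
      (e := .xor (entry 11 12) (.and (.get 6 (.var 11)) (.get 7 (.var 12))))
      (by norm_num) (by norm_num) (by norm_num) (by norm_num) (by norm_num) (by norm_num)
      (by norm_num) (by norm_num) (by rw [h4.reg0]; exact h4.mul) (by rw [h4.reg0]; omega)
      (fun q i => if h : q < 2 ^ m - 1 ∧ i < 2 ^ m - 1 then (b' ⟨q, h.1⟩ ⟨i, h.2⟩).val else 0)
      (by
        intro q hqN hq i hi σ hr ha hx hcell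
        rw [h4.reg0] at hq hi hcell
        rw [dif_pos ⟨hq, hi⟩]
        obtain ⟨x, hx1, hx2⟩ := hb' ⟨q, hq⟩ ⟨i, hi⟩
        rw [hx1]
        apply eval_xor
        · rw [eval_entry (m := m)]
          · simp only [reg_setReg, arr_setReg, if_true, show (11 : ℕ) ≠ 12 by norm_num, if_false,
              hx]
            rw [hcell, hB4]
            exact hB ⟨q, hq⟩ ⟨i, hi⟩
          · simp only [reg_setReg, arr_setReg, show (11 : ℕ) ≠ 12 by norm_num, if_false, hx,
              ha 3 (by norm_num)]
            exact h4.mul q hqN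
        · rw [hx2]
          have h6 : s₄.arr 6 q = (f ⟨q, hq⟩).val := by
            rw [hD4]
            exact hD ⟨q, hq⟩
          simp [hx, ha 6, ha 7, h6, ZMod.val_eq_zero])
      (q := q) (i := i) (by omega) (by rw [h4.reg0]; exact hq) (by rw [h4.reg0]; exact i.2)
    rw [h4.reg0] at key
    refine Eq.trans ?_ (key.trans (by simp))
    rfl
  rcases hpiv with ⟨p, hp, hne, hlt⟩ | ⟨-, h0⟩
  · refine ⟨_, hb.insert (y := w) hne hlt, hupd _ fun q i => ⟨f q * b p i, rfl, ?_⟩⟩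
    simp only [hR p hp i, ZMod.val_mul_of_two, ZMod.val_ne_zero_iff]
  · refine ⟨b, hb.insert_of_forall h0, hupd _ fun q i => ⟨0, by simp, by simp [h0 q]⟩⟩

end DoubleCirculant

theorem BExpr.eval_count_fin (s : RamState) {x k : ℕ} {e : BExpr} (p : Fin k → Prop)
    [DecidablePred p] (hk : k ≤ s.reg 1) (h : ∀ i : Fin k, e.Holds (s.setReg x i) ↔ p i)
    (h' : ∀ i, k ≤ i → ¬ e.Holds (s.setReg x i)) :
    (BExpr.count x e).eval s = (Finset.univ.filter p).card := by
  rw [eval_count, ← Finset.card_map Fin.valEmbedding]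
  congr 1
  ext i
  simp only [Finset.mem_filter, Finset.mem_range, Finset.mem_map, Finset.mem_univ, true_and,
    Fin.valEmbedding_apply]
  constructor
  · rintro ⟨-, hi⟩
    by_cases hik : i < k
    · exact ⟨⟨i, hik⟩, (h ⟨i, hik⟩).1 hi, rfl⟩
    · exact absurd hi (h' i (not_lt.1 hik))
  · rintro ⟨j, hj, rfl⟩
    exact ⟨j.2.trans_le hk, (h j).2 hj⟩

theorem BExpr.eval_and_of_iff {s : RamState} {a b : BExpr} {p : Prop} [Decidable p]
    (h : a.Holds s ∧ b.Holds s ↔ p) : (BExpr.and a b).eval s = if p then 1 else 0 := by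
  rw [eval_and]
  exact if_congr h rfl rfl

theorem Fin.val_sub_eq_ite {k : ℕ} (i j : Fin k) :
    ((i - j : Fin k) : ℕ) = if (j : ℕ) ≤ i then (i : ℕ) - j else i + k - j := by
  split_ifs with h
  · exact Fin.sub_val_of_le h
  · rw [Fin.coe_sub_iff_lt.2 (not_le.1 h), add_comm]

namespace DoubleCirculant

open BExpr BProg IsMSequence

/-- Elimination with all monomials of degree at most `⌊m/2⌋`. -/
def elimination : BProg :=
  .seq (tab₂ 4 3 11 12 0 (.eq (.var 11) (.var 12))) (.loop 10
    (.ite (.and (.lt (.var 10) (.get 1 (.var 2)))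
      (.le (.count 20 (.and (.lt (.var 20) (.var 2)) (bitAt 10 20))) (.var 3)))
      eliminationStep .skip))

theorem den_elimination {m : ℕ} {s : RamState} {S : ℕ → ZMod 2} (h : IsSetup m s)
    (hS : ∀ n < s.reg 1, s.arr 2 n = (S n).val) :
    ∃ b : Fin (2 ^ m - 1) → Fin (2 ^ m - 1) → ZMod 2,
      IsEchelon b (monomialWord m S '' {T | T.card ≤ m / 2}) ∧
      ∀ q i : Fin (2 ^ m - 1), (elimination.den s).arr 4 (q * (2 ^ m - 1) + i) = (b q i).val := by
  have hN := h.reg1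
  have hm := self_le_two_pow_sub_one m
  set p₁ := tab₂ 4 3 11 12 0 (.eq (.var 11) (.var 12)) with hp₁
  have h1 : IsSetup m (p₁.den s) := h.den _ (by decide) (by decide)
  have hS1 : (p₁.den s).arr 2 = s.arr 2 := den_arr _ rfl _
  have hB : ∀ q i : Fin (2 ^ m - 1), (p₁.den s).arr 4 (q * (2 ^ m - 1) + i) =
      (if q = i then 1 else 0 : ZMod 2).val := by
    intro q i
    have hq := q.2
    have hi := i.2
    have key := den_tab₂ (n := 4) (c := 3) (x := 11) (y := 12) (b := 0) (s := s)
      (e := .eq (.var 11) (.var 12))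
      (by norm_num) (by norm_num) (by norm_num) (by norm_num) (by norm_num) (by norm_num)
      (by norm_num) (by norm_num) (by rw [h.reg0]; exact h.mul) (by rw [h.reg0]; omega)
      (fun q i => if q = i then 1 else 0) (by
        intro q _ _ i _ σ _ _ hx _
        simp [hx])
      (q := q) (i := i) (by omega) (by rw [h.reg0]; exact hq) (by rw [h.reg0]; exact hi)
    rw [h.reg0] at key
    rw [key]
    simp only [Fin.val_inj]
    split_ifs <;> rfl
  set s₁ := p₁.den s with hs₁
  have hN1 := h1.reg1
  -- The sets of small cardinality whose digit pattern has been passed. Every subset of the m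
  -- coordinates has a pattern below 2^m ≤ N.
  let Y : ℕ → Set (Finset (Fin m)) := fun i =>
    {T | ∃ c < i, c < 2 ^ m ∧ bitset m c = T ∧ T.card ≤ m / 2}
  obtain ⟨σ, ⟨b, hb, hbσ⟩, hσ⟩ := den_loop (x := 10)
    (p := .ite (.and (.lt (.var 10) (.get 1 (.var 2)))
      (.le (.count 20 (.and (.lt (.var 20) (.var 2)) (bitAt 10 20))) (.var 3)))
      eliminationStep .skip) (s := s₁)
    (fun i σ => ∃ b : Fin (2 ^ m - 1) → Fin (2 ^ m - 1) → ZMod 2,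
      IsEchelon b (monomialWord m S '' Y i) ∧
      ∀ q j : Fin (2 ^ m - 1), σ.arr 4 (q * (2 ^ m - 1) + j) = (b q j).val)
    ⟨_, by
      have : Y 0 = ∅ := by simp [Y]
      rw [this, Set.image_empty]
      exact isEchelon_one _, hB⟩
    (by
      rintro i hi σ hr ha ⟨b, hb, hbσ⟩
      have hσ : IsSetup m (σ.setReg 10 i) := by
        refine h1.congr (fun x hx => ?_) fun n hn => ?_
        · rw [← hr x]
          · simp only [List.mem_cons, List.not_mem_nil, or_false] at hx
            rcases hx with rfl | rfl | rfl | rfl | rfl | rfl <;> simp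
          · simp only [List.mem_cons, List.not_mem_nil, or_false] at hx
            rcases hx with rfl | rfl | rfl | rfl | rfl | rfl <;> rfl
        · rw [arr_setReg]
          apply ha
          simp only [List.mem_cons, List.not_mem_nil, or_false] at hn
          rcases hn with rfl | rfl <;> rfl
      have h2 := hσ.reg2
      have h3 := hσ.reg3
      have hσ1 := hσ.reg1
      have hcount : (BExpr.count 20 (.and (.lt (.var 20) (.var 2)) (bitAt 10 20))).eval
          (σ.setReg 10 i) = (bitset m i).card := by
        have hbit : ∀ l < m, (bitAt 10 20).Holds ((σ.setReg 10 i).setReg 20 l) ↔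
            i.testBit l = true := by
          intro l hl
          rw [holds_bitAt (by norm_num) (by norm_num) (by norm_num)]
          · simp
          · simp only [reg_setReg, show (10 : ℕ) ≠ 20 by norm_num, show (1 : ℕ) ≠ 20 by norm_num,
              if_false, if_true] at hσ1 ⊢
            omega
          · have := hσ.pow l (by omega)
            simpa using this
        refine eval_count_fin _ _ (by omega) (fun l => ?_) fun l hl => ?_
        · rw [holds_and, hbit l l.2]
          have : (BExpr.lt (.var 20) (.var 2)).Holds ((σ.setReg 10 i).setReg 20 l) := by
            rw [reg_setReg] at h2
            simp at h2
            simp [h2]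
          simp [this]
        · rw [holds_and]
          rintro ⟨hlt, -⟩
          simp only [reg_setReg] at h2
          simp at h2
          simp [h2] at hlt
          omega
      have hcond : (BExpr.and (.lt (.var 10) (.get 1 (.var 2)))
          (.le (.count 20 (.and (.lt (.var 20) (.var 2)) (bitAt 10 20))) (.var 3))).eval
          (σ.setReg 10 i) = if i < 2 ^ m ∧ (bitset m i).card ≤ m / 2 then 1 else 0 := by
        apply eval_and_of_iff
        rw [holds_le, hcount, holds_lt, eval_get, eval_var, eval_var, eval_var, h2, h3,
          hσ.pow m (by omega)]
        simp
      simp only [BProg.den, hcond]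
      by_cases hc2 : i < 2 ^ m ∧ (bitset m i).card ≤ m / 2
      · rw [if_pos hc2, if_neg one_ne_zero]
        obtain ⟨b', hb', hbσ'⟩ := den_eliminationStep hσ (by
          rw [arr_setReg, ha 2 rfl, hS1, hσ1, ← hN]
          exact hS) (by simp) hc2.1 hb hbσ
        refine ⟨b', ?_, hbσ'⟩
        convert hb' using 1
        rw [← Set.image_insert_eq]
        congr 1
        ext T
        simp only [Y, Set.mem_ofPred_eq, Set.mem_insert_iff]
        constructor
        · rintro ⟨c, hci, hc, rfl, hcard⟩
          rcases Nat.lt_succ_iff_lt_or_eq.1 hci with hlt | rfl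
          · exact .inr ⟨c, hlt, hc, rfl, hcard⟩
          · exact .inl rfl
        · rintro (rfl | ⟨c, hci, hc, rfl, hcard⟩)
          · exact ⟨i, by omega, hc2.1, rfl, hc2.2⟩
          · exact ⟨c, by omega, hc, rfl, hcard⟩
      · rw [if_neg hc2, if_pos rfl]
        refine ⟨b, ?_, hbσ⟩
        convert hb using 2
        ext T
        simp only [Y, Set.mem_ofPred_eq]
        constructor
        · rintro ⟨c, hci, hc, rfl, hcard⟩
          rcases Nat.lt_succ_iff_lt_or_eq.1 hci with hlt | rfl
          · exact ⟨c, hlt, hc, rfl, hcard⟩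
          · exact absurd ⟨hc, hcard⟩ hc2
        · rintro ⟨c, hci, hc, rfl, hcard⟩
          exact ⟨c, by omega, hc, rfl, hcard⟩)
  have hY : Y (s₁.reg 1) = {T | T.card ≤ m / 2} := by
    ext T
    simp only [Y, Set.mem_ofPred_eq]
    constructor
    · rintro ⟨c, -, -, -, hcard⟩
      exact hcard
    · intro hcard
      obtain ⟨c, hc, rfl⟩ := exists_bitset_eq T
      exact ⟨c, by omega, hc, rfl, hcard⟩
  rw [hY] at hb
  refine ⟨b, hb, fun q i => ?_⟩
  rw [← hbσ q i, ← arr_setReg σ 10 (s₁.reg 1), ← hσ]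
  rfl

/-! ### Programs: the column and the generator matrix. -/

/-- The row with the least nonzero diagonal entry is the first column of the circulant matrix. -/
def columnProg : BProg :=
  .seq (.set 5 (.count 20 (.all 21 (.imp (.le (.var 21) (.var 20))
    (.neg (.and (.lt (.var 21) (.var 0)) (entry 21 21)))))))
  (tab 8 11 0 (.and (.lt (.var 5) (.var 0)) (entry 5 11)))

theorem den_columnProg {m : ℕ} (hm : 1 ≤ m) {s : RamState} {S : ℕ → ZMod 2}
    (hS : IsMSequence m S) (h : IsSetup m s)
    {b : Fin (2 ^ m - 1) → Fin (2 ^ m - 1) → ZMod 2}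
    (hb : IsEchelon b (monomialWord m S '' {T | T.card ≤ m / 2}))
    (hB : ∀ q i : Fin (2 ^ m - 1), s.arr 4 (q * (2 ^ m - 1) + i) = (b q i).val)
    (i : Fin (2 ^ m - 1)) :
    (columnProg.den s).arr 8 i = (hS.column hm (m / 2) i).val := by
  have hN := h.reg1
  have hpiv := eval_pivot h (fun q => b q q) (e := .all 21 (.imp (.le (.var 21) (.var 20))
    (.neg (.and (.lt (.var 21) (.var 0)) (entry 21 21))))) (by
      intro i
      have hr0 := h.reg0
      rw [holds_all]
      refine forall₂_congr fun j hj => ?_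
      have hj' : j < s.reg 1 := by simpa using hj
      rw [holds_imp, holds_neg, holds_and, holds_entry (m := m) (by simp [h.mul j hj'])]
      simp only [holds_le, holds_lt, eval_var, reg_setReg, arr_setReg, if_true,
        show (20 : ℕ) ≠ 21 by norm_num, show (0 : ℕ) ≠ 20 by norm_num,
        show (0 : ℕ) ≠ 21 by norm_num, if_false, hr0]
      refine forall_congr' fun _ => not_congr ?_
      constructor
      · rintro ⟨hj, hne⟩
        exact ⟨hj, (ZMod.val_ne_zero_iff _).1 (by rwa [← hB ⟨j, hj⟩ ⟨j, hj⟩])⟩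
      · rintro ⟨hj, hne⟩
        exact ⟨hj, by rw [hB ⟨j, hj⟩ ⟨j, hj⟩]; exact (ZMod.val_ne_zero_iff _).2 hne⟩)
  set v := (BExpr.count 20 (.all 21 (.imp (.le (.var 21) (.var 20))
    (.neg (.and (.lt (.var 21) (.var 0)) (entry 21 21)))))).eval s with hv
  have hi := i.2
  refine den_tab (s := s.setReg 5 v) (by norm_num)
    (fun i => if hi : i < 2 ^ m - 1 then (hS.column hm (m / 2) ⟨i, hi⟩).val else 0) ?_
    (by simp; omega) (by simp [h.reg0]) |>.trans (by simp)
  intro i _ hi σ hr ha _ _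
  have hi' : i < 2 ^ m - 1 := by simpa [h.reg0] using hi
  have hr5 : σ.reg 5 = v := (hr 5 (by norm_num)).trans (by simp)
  have hr0 : σ.reg 0 = 2 ^ m - 1 := (hr 0 (by norm_num)).trans (by simp [h.reg0])
  have hlt' : (BExpr.lt (.var 5) (.var 0)).Holds (σ.setReg 11 i) ↔ v < 2 ^ m - 1 := by
    simp [hr5, hr0]
  rw [dif_pos hi']
  rcases hpiv with ⟨p, hp, hne, hlt⟩ | ⟨hv', h0⟩
  · rw [hS.column_eq_of_isEchelon hm hb hne hlt, eval_and_of_iff (p := b p ⟨i, hi'⟩ ≠ 0)]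
    · generalize b p ⟨i, hi'⟩ = z
      revert z
      decide
    · have h4 := hB p ⟨i, hi'⟩
      simp only at h4
      rw [hlt', hp, holds_entry (m := m)]
      · simp only [reg_setReg, arr_setReg, if_true, show (5 : ℕ) ≠ 11 by norm_num, if_false, hr5,
          hp, ha 4 (by norm_num), h4, p.2, true_and, ZMod.val_ne_zero_iff]
      · simp only [reg_setReg, arr_setReg, show (5 : ℕ) ≠ 11 by norm_num, if_false, hr5, hp,
          ha 3 (by norm_num)]
        have := p.2
        exact h.mul p (by omega)
  -- Without a pivot the count is N > k. The test against k fails, and the zero column is written.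
  · rw [hS.column_eq_zero_of_isEchelon hm hb h0, eval_and_of_iff (p := False)]
    · rfl
    · rw [hlt', iff_false]
      rintro ⟨hlt, -⟩
      omega

/-- The first column of the circulant matrix that the algorithms compute. -/
noncomputable def maximalColumn {m : ℕ} (hm : 1 ≤ m) : Fin (2 ^ m - 1) → ZMod 2 :=
  (isMSequence_maximalSequence hm).column hm (m / 2)

/-- The computation of the sequence and of the first column of the circulant matrix. -/
def prepare : BProg :=
  .seq setup <| .seq searchSequence <| .seq elimination columnProg

theorem den_prepare {m : ℕ} (hm : 1 ≤ m) {s : RamState} (h0 : s.reg 0 = 2 ^ m - 1)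
    (h1 : s.reg 1 = 3 * (2 ^ m - 1) + 3) :
    IsSetup m (prepare.den s) ∧
      (∀ n < 3 * (2 ^ m - 1) + 3, (prepare.den s).arr 2 n = (maximalSequence m n).val) ∧
      ∀ i : Fin (2 ^ m - 1), (prepare.den s).arr 8 i = (maximalColumn hm i).val := by
  have h₁ := isSetup_setup h0 h1
  have h₂ : IsSetup m (searchSequence.den (setup.den s)) := h₁.den _ (by decide) (by decide)
  have hS₂ : ∀ n < (searchSequence.den (setup.den s)).reg 1,
      (searchSequence.den (setup.den s)).arr 2 n = (maximalSequence m n).val := by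
    intro n hn
    rw [h₂.reg1, ← h₁.reg1] at hn
    exact den_searchSequence hm h₁ hn
  obtain ⟨b, hb, hB⟩ := den_elimination h₂ hS₂
  have h₃ : IsSetup m (elimination.den (searchSequence.den (setup.den s))) :=
    h₂.den _ (by decide) (by decide)
  refine ⟨h₃.den _ (by decide) (by decide), fun n hn => ?_,
    den_columnProg hm (isMSequence_maximalSequence hm) h₃ hb hB⟩
  rw [← hS₂ n (by rwa [h₂.reg1])]
  exact congrFun ((den_arr columnProg rfl _).trans (den_arr elimination rfl _)) n

/-- The construction of the generator matrix. -/
def constructProg : BProg :=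
  .seq prepare (tab₂ 0 3 11 12 7 (.cond (.lt (.var 11) (.var 0)) (.eq (.var 11) (.var 12))
    (.get 8 (.cond (.le (.var 12) (.sub (.var 11) (.var 0)))
      (.sub (.sub (.var 11) (.var 0)) (.var 12)) (.sub (.var 11) (.var 12))))))

theorem den_constructProg {m : ℕ} (hm : 1 ≤ m) {s : RamState} (h0 : s.reg 0 = 2 ^ m - 1)
    (h1 : s.reg 1 = 3 * (2 ^ m - 1) + 3) (i : Fin (2 ^ m - 1) ⊕ Fin (2 ^ m - 1))
    (j : Fin (2 ^ m - 1)) :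
    (constructProg.den s).arr 0 (coordPos i * (2 ^ m - 1) + j) =
      (doubleCirculantMatrix (maximalColumn hm) i j).val := by
  obtain ⟨h, -, ha8⟩ := den_prepare hm h0 h1
  set s₁ := prepare.den s with hs₁
  have hN := h.reg1
  have hi : coordPos i < 2 * (2 ^ m - 1) := by
    rcases i with i | i <;> have := i.2 <;> simp only [coordPos] <;> omega
  have key := den_tab₂ (n := 0) (c := 3) (x := 11) (y := 12) (b := 7) (s := s₁)
    (e := .cond (.lt (.var 11) (.var 0)) (.eq (.var 11) (.var 12))
      (.get 8 (.cond (.le (.var 12) (.sub (.var 11) (.var 0)))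
        (.sub (.sub (.var 11) (.var 0)) (.var 12)) (.sub (.var 11) (.var 12)))))
    (by norm_num) (by norm_num) (by norm_num) (by norm_num) (by norm_num) (by norm_num)
    (by norm_num) (by norm_num) (by rw [h.reg0]; exact h.mul) (by rw [h.reg0]; omega)
    -- Row q ≥ k of the matrix is row q - k of the circulant. If j > q - k, then (q - k) - j + k = q
    -- - j is the residue.
    (fun q j => if q < 2 ^ m - 1 then (if q = j then 1 else 0) else
      s₁.arr 8 (if j ≤ q - (2 ^ m - 1) then q - (2 ^ m - 1) - j else q - j)) (by
      intro q _ _ j _ σ hr ha hx _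
      have hr0 : σ.reg 0 = 2 ^ m - 1 := (hr 0 (by norm_num) (by norm_num)).trans h.reg0
      simp [hx, hr0, ha 8])
    (q := coordPos i) (i := j) (by omega) (by rw [h.reg7]; exact hi) (by rw [h.reg0]; exact j.2)
  rw [h.reg0] at key
  refine Eq.trans ?_ (key.trans ?_)
  · rfl
  rcases i with i | i
  · rw [coordPos, if_pos i.2, doubleCirculantMatrix, Matrix.fromRows_apply_inl, Matrix.one_apply]
    simp only [Fin.val_inj]
    split_ifs <;> rfl
  · rw [coordPos, if_neg (by omega), doubleCirculantMatrix, Matrix.fromRows_apply_inr,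
      Matrix.circulant_apply, ← ha8, Fin.val_sub_eq_ite, Nat.add_sub_cancel_left, add_comm]

end DoubleCirculant

/-! ### Programs: decoding. -/

theorem hammingDist_sumElim {α β γ : Type*} [Fintype α] [Fintype β] [DecidableEq γ]
    (w : α ⊕ β → γ) (x : α → γ) (y : β → γ) :
    hammingDist w (Sum.elim x y) =
      hammingDist (w ∘ Sum.inl) x + hammingDist (w ∘ Sum.inr) y := by
  simp only [hammingDist, Finset.card_filter, Fintype.sum_sum_type, Function.comp_apply,
    Sum.elim_inl, Sum.elim_inr]
  rfl

theorem hammingNorm_add_of_two {ι : Type*} [Fintype ι] (x y : ι → ZMod 2) :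
    hammingNorm (x + y) = hammingDist x y := by
  rw [hammingDist_eq_hammingNorm]
  congr 1
  funext i
  simp only [Pi.add_apply, Pi.neg_apply, CharTwo.neg_eq]

theorem Fin.val_neg_eq_ite {k : ℕ} [NeZero k] (i : Fin k) :
    ((-i : Fin k) : ℕ) = if (i : ℕ) ≠ 0 then k - i else 0 := by
  rw [Fin.val_neg']
  split_ifs with h
  · exact Nat.mod_eq_of_lt (by omega)
  · rw [not_not.1 h, Nat.sub_zero, Nat.mod_self]

/-- The quotient of two power series over the field with two elements, the second of which has
constant term `1`. -/
def quotientSeq (V a : ℕ → ZMod 2) (n : ℕ) : ZMod 2 :=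
  V n + ∑ i : Fin n, quotientSeq V a i * a (n - i)

theorem quotientSeq_eq (V a : ℕ → ZMod 2) (n : ℕ) :
    quotientSeq V a n = V n + ∑ i ∈ Finset.range n, quotientSeq V a i * a (n - i) := by
  rw [quotientSeq, Finset.sum_range]

/-- Extension of a word by zeros. -/
def extendWord {k : ℕ} (f : Fin k → ZMod 2) (i : ℕ) : ZMod 2 := if h : i < k then f ⟨i, h⟩ else 0

theorem extendWord_val {k : ℕ} (f : Fin k → ZMod 2) (i : Fin k) : extendWord f i = f i :=
  dif_pos i.2

namespace DoubleCirculant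

open BExpr BProg IsMSequence

/-- The form of `BProg.den_tab` for words of length k: the state in which the entry is computed
keeps the constants, and all arrays other than `n` are unchanged. -/
theorem IsSetup.den_tab {m n : ℕ} {s : RamState} {e : BExpr} (h : IsSetup m s) (h1 : 1 ≠ n)
    (h3 : 3 ≠ n) (f : Fin (2 ^ m - 1) → ℕ)
    (hf : ∀ i : Fin (2 ^ m - 1), ∀ σ, IsSetup m σ → (∀ n', n' ≠ n → σ.arr n' = s.arr n') →
      σ.reg 11 = i → (∀ j < i, σ.arr n j = f j) → e.eval σ = f i) (i : Fin (2 ^ m - 1)) :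
    ((tab n 11 0 e).den s).arr n i = f i := by
  have hN := h.reg1
  have hi := i.2
  refine (BProg.den_tab (by norm_num) (fun i => if hi : i < 2 ^ m - 1 then f ⟨i, hi⟩ else 0) ?_
    (by omega) (by rwa [h.reg0])).trans (by simp)
  intro i _ hi σ hr ha _ hlt
  rw [h.reg0] at hi
  rw [dif_pos hi]
  refine hf ⟨i, hi⟩ _ (h.congr (fun x hx => ?_) fun n' hn' => ?_) (by simpa using ha) (by simp)
    fun j hj => ?_
  · have hx11 : x ≠ 11 := by
      rintro rfl
      simp at hx
    simp [hx11, hr]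
  · refine ha n' ?_
    simp only [List.mem_cons, List.not_mem_nil, or_false] at hn'
    rcases hn' with rfl | rfl <;> assumption
  · rw [arr_setReg, hlt j hj, dif_pos j.2]

/-- The entry of the product of the circulant matrix and the word in array `n` at the place given
by register `11`. -/
def circulantExpr (n : ℕ) : BExpr :=
  .parity 20 (.and (.lt (.var 20) (.var 0)) (.and
    (.get 8 (.cond (.le (.var 20) (.var 11)) (.sub (.var 11) (.var 20))
      (.sub (.add (.var 11) (.var 0)) (.var 20))))
    (.get n (.var 20))))

theorem eval_circulantExpr {m n : ℕ} {s : RamState} (h : IsSetup m s)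
    {a w : Fin (2 ^ m - 1) → ZMod 2} (ha : ∀ i : Fin (2 ^ m - 1), s.arr 8 i = (a i).val)
    (hw : ∀ i : Fin (2 ^ m - 1), s.arr n i = (w i).val) {i : Fin (2 ^ m - 1)}
    (hi : s.reg 11 = i) :
    (circulantExpr n).eval s = ((Matrix.circulant a).mulVec w i).val := by
  have hN := h.reg1
  rw [Matrix.mulVec, dotProduct]
  refine eval_parity_fin s _ (by omega) (fun j => ?_) fun j hj => ?_
  · have h1 : s.arr 8 (if (j : ℕ) ≤ i then (i : ℕ) - j else i + (2 ^ m - 1) - j) =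
        (a (i - j)).val := by
      rw [← Fin.val_sub_eq_ite, ha]
    simp only [holds_and, holds_lt, holds_get, eval_cond, holds_le, eval_sub, eval_add, eval_var,
      reg_setReg, arr_setReg]
    simp only [if_true, show (0 : ℕ) ≠ 20 by norm_num, show (11 : ℕ) ≠ 20 by norm_num, if_false,
      h.reg0, hi, h1, hw, ZMod.val_ne_zero_iff, Matrix.circulant_apply, j.2, true_and]
    rw [mul_ne_zero_iff]
  · simp [h.reg0, hj]

/-- The majority vote for the word in array `n` over the flats whose codimension is given by
register `y`, at the place given by register `11`. -/
def majorityCount (n y : ℕ) : BExpr :=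
  .count 20 (.and (.lt (.var 20) (.var 0)) (.and
    (.ex 21 (.and (.lt (.var 21) (.var y)) (.get 2 (.add (.add (.var 11) (.var 20)) (.var 21)))))
    (.parity 22 (.and (.lt (.var 22) (.var 0)) (.and (.get n (.var 22))
      (.all 21 (.imp (.lt (.var 21) (.var y))
        (.eq (.get 2 (.add (.add (.var 22) (.var 20)) (.var 21)))
          (.get 2 (.add (.add (.var 11) (.var 20)) (.var 21)))))))))))

/-- The result of the majority vote. -/
def majorityExpr (n y : ℕ) : BExpr :=
  .lt (.var 0) (.add (majorityCount n y) (majorityCount n y))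

/-- The vote reads the sequence at q + b + l with q, b < k and l < m ≤ k. This is why the table and
all loops extend to 3k + 3. -/
theorem eval_majorityExpr {m n y g : ℕ} {s : RamState} (h : IsSetup m s) {S : ℕ → ZMod 2}
    (hS : ∀ n < 3 * (2 ^ m - 1) + 3, s.arr 2 n = (S n).val) {c : Fin (2 ^ m - 1) → ZMod 2}
    (hc : ∀ i : Fin (2 ^ m - 1), s.arr n i = (c i).val) (hy : s.reg y = g) (hg : g ≤ m)
    (hy20 : y ≠ 20) (hy21 : y ≠ 21) (hy22 : y ≠ 22) {i : Fin (2 ^ m - 1)} (hi : s.reg 11 = i) :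
    (majorityExpr n y).eval s = (flatMajority S g c i).val := by
  have hN := h.reg1
  have hm := self_le_two_pow_sub_one m
  have hik := i.2
  have hcount : (majorityCount n y).eval s = ((Finset.range (2 ^ m - 1)).filter fun b =>
      (∃ l < g, S (i + b + l) ≠ 0) ∧ flatSum S g b c i ≠ 0).card := by
    rw [majorityCount, eval_count]
    congr 1
    ext b
    simp only [Finset.mem_filter, Finset.mem_range]
    rw [holds_and, holds_and]
    have hb : (BExpr.lt (.var 20) (.var 0)).Holds (s.setReg 20 b) ↔ b < 2 ^ m - 1 := by
      simp [h.reg0]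
    rw [hb]
    by_cases hbk : b < 2 ^ m - 1
    swap
    · simp [hbk]
    simp only [hbk, true_and, show b < s.reg 1 by omega]
    refine and_congr ?_ ?_
    · rw [holds_ex]
      simp only [holds_and, holds_lt, holds_get, eval_add, eval_var, reg_setReg, arr_setReg]
      simp only [if_true, show (1 : ℕ) ≠ 20 by norm_num, show (20 : ℕ) ≠ 21 by norm_num,
        show (11 : ℕ) ≠ 20 by norm_num, show (11 : ℕ) ≠ 21 by norm_num, hy20, hy21, if_false, hi,
        hy]
      constructor
      · rintro ⟨l, hl, hlg, hne⟩
        rw [hS _ (by omega), ZMod.val_ne_zero_iff] at hne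
        exact ⟨l, hlg, hne⟩
      · rintro ⟨l, hlg, hne⟩
        refine ⟨l, by omega, hlg, ?_⟩
        rwa [hS _ (by omega), ZMod.val_ne_zero_iff]
    · rw [Holds, ← ZMod.val_ne_zero_iff, flatSum]
      rw [eval_parity_fin _ (fun q => if ∀ l < g, S (q + b + l) = S (i + b + l) then c q else 0)]
      · simp
        omega
      · intro q
        have hq := q.2
        have hall : (BExpr.all 21 (.imp (.lt (.var 21) (.var y))
            (.eq (.get 2 (.add (.add (.var 22) (.var 20)) (.var 21)))
              (.get 2 (.add (.add (.var 11) (.var 20)) (.var 21)))))).Holds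
            ((s.setReg 20 b).setReg 22 q) ↔ ∀ l < g, S (q + b + l) = S (i + b + l) := by
          rw [holds_all]
          simp only [holds_imp, holds_lt, holds_eq, eval_get, eval_add, eval_var, reg_setReg,
            arr_setReg]
          simp only [if_true, show (1 : ℕ) ≠ 20 by norm_num, show (1 : ℕ) ≠ 22 by norm_num,
            show (20 : ℕ) ≠ 21 by norm_num, show (20 : ℕ) ≠ 22 by norm_num,
            show (22 : ℕ) ≠ 21 by norm_num, show (11 : ℕ) ≠ 20 by norm_num,
            show (11 : ℕ) ≠ 21 by norm_num, show (11 : ℕ) ≠ 22 by norm_num, hy20, hy21, hy22,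
            if_false, hi, hy]
          constructor
          · intro H l hl
            have := H l (by omega) hl
            rw [hS _ (by omega), hS _ (by omega)] at this
            exact ZMod.val_injective 2 this
          · intro H l _ hl
            rw [hS _ (by omega), hS _ (by omega), H l hl]
        rw [holds_and, holds_and, hall]
        simp [h.reg0, hc, ZMod.val_eq_zero, and_comm]
      · intro q hq
        simp [h.reg0, hq]
  rw [majorityExpr, eval_lt, eval_add, hcount, eval_var, h.reg0, flatMajority, two_mul]
  split_ifs <;> rfl

/-- The syndrome. -/
def syndromeProg : BProg :=
  tab 9 11 0 (.xor (.get 0 (.add (.var 0) (.var 11))) (circulantExpr 0))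

/-- The division of the corrected syndrome by the generator polynomial. -/
def divisionProg : BProg :=
  .seq (tab 11 11 0 (.xor (.get 9 (.var 11)) (.get 10 (.var 11))))
  (tab 12 11 0 (.xor (.get 11 (.var 11)) (.parity 20 (.and (.lt (.var 20) (.var 11))
    (.and (.get 12 (.var 20)) (.get 8 (.sub (.var 11) (.var 20))))))))

/-- The index opposite to the one in register `11`. -/
def oppositeExpr : BExpr := .cond (.var 11) (.sub (.var 0) (.var 11)) (.lit 0)

theorem eval_oppositeExpr {m : ℕ} {s : RamState} (h : IsSetup m s) [NeZero (2 ^ m - 1)]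
    {i : Fin (2 ^ m - 1)} (hi : s.reg 11 = i) :
    oppositeExpr.eval s = ((-i : Fin (2 ^ m - 1)) : ℕ) := by
  simp only [Fin.val_neg_eq_ite, oppositeExpr, eval_cond, holds_var, eval_sub, eval_var, hi,
    h.reg0, eval_lit]

/-- The errors in the first half and the codeword. -/
def correctionProg : BProg :=
  .seq (tab 13 11 0 (.get 12 oppositeExpr)) <|
  .seq (tab 14 11 0 (majorityExpr 13 8)) <|
  .seq (tab 15 11 0 (.xor (.get 0 (.var 11)) (.get 14 oppositeExpr)))
  (tab 16 11 0 (circulantExpr 15))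

/-- The comparison with the received word. -/
def acceptProg : BProg :=
  .set 6 (.lt (.add
      (.count 20 (.and (.lt (.var 20) (.var 0)) (.neg (.eq (.get 0 (.var 20)) (.get 15 (.var 20))))))
      (.count 20 (.and (.lt (.var 20) (.var 0))
        (.neg (.eq (.get 0 (.add (.var 0) (.var 20))) (.get 16 (.var 20)))))))
    (.get 1 (.sub (.var 8) (.lit 1))))

/-- The output of the codeword. -/
def outputProg : BProg :=
  .seq (tab 0 11 7 (.cond (.lt (.var 11) (.var 0)) (.get 15 (.var 11))
    (.get 16 (.sub (.var 11) (.var 0))))) (.set 0 (.var 6))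

/-- The computation of the information part of the codeword nearest to the received word. -/
def nearestProg : BProg :=
  .seq syndromeProg <| .seq (tab 10 11 0 (majorityExpr 9 3)) <| .seq divisionProg correctionProg

/-- The decoding algorithm. -/
def decodeProg : BProg :=
  .seq prepare <| .seq nearestProg <| .seq acceptProg outputProg

/-- The program carries out `decode_eq` on any input. The candidate `u` always exists, and it is
claimed to be right only if some codeword lies within the radius. -/
theorem den_nearestProg {m : ℕ} (hm : 1 ≤ m) {s : RamState} (h : IsSetup m s)
    (hS : ∀ n < 3 * (2 ^ m - 1) + 3, s.arr 2 n = (maximalSequence m n).val)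
    (h8 : ∀ i : Fin (2 ^ m - 1), s.arr 8 i = (maximalColumn hm i).val)
    {w : Fin (2 ^ m - 1) ⊕ Fin (2 ^ m - 1) → ZMod 2} (hw : ∀ i, s.arr 0 (coordPos i) = (w i).val) :
    ∃ u : Fin (2 ^ m - 1) → ZMod 2,
      (∀ c ∈ doubleCirculantCode (maximalColumn hm), hammingDist w c ≤ errorRadius m →
        c = Sum.elim u ((Matrix.circulant (maximalColumn hm)).mulVec u)) ∧
      (∀ i : Fin (2 ^ m - 1), (nearestProg.den s).arr 15 i = (u i).val) ∧
      ∀ i : Fin (2 ^ m - 1), (nearestProg.den s).arr 16 i =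
        ((Matrix.circulant (maximalColumn hm)).mulVec u i).val := by
  have hm2 : 2 ≤ 2 ^ m := Nat.pow_le_pow_right (n := 2) (by norm_num) hm
  have : NeZero (2 ^ m - 1) := ⟨by omega⟩
  have hw₀ : ∀ i : Fin (2 ^ m - 1), s.arr 0 i = ((w ∘ Sum.inl) i).val := fun i => hw (.inl i)
  have hw₁ : ∀ i : Fin (2 ^ m - 1), s.arr 0 (2 ^ m - 1 + i) = ((w ∘ Sum.inr) i).val :=
    fun i => hw (.inr i)
  set w₀ := w ∘ Sum.inl with hw₀'
  set w₁ := w ∘ Sum.inr with hw₁'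
  set A := Matrix.circulant (maximalColumn hm) with hA
  set σ₁ := syndromeProg.den s with hσ₁
  have h₁ : IsSetup m σ₁ := h.den _ (by decide) (by decide)
  have e₁ : ∀ n, n ≠ 9 → σ₁.arr n = s.arr n :=
    fun n hn => den_arr _ (by simpa [syndromeProg] using hn) _
  have v₁ : ∀ i : Fin (2 ^ m - 1), σ₁.arr 9 i = ((w₁ + A.mulVec w₀) i).val := by
    refine h.den_tab (by norm_num) (by norm_num) _ fun i σ hσ ha hi _ => eval_xor _ ?_ ?_
    · simp [hσ.reg0, hi, ha 0, hw₁]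
    · exact eval_circulantExpr hσ (by simpa [ha 8] using h8) (by simpa [ha 0] using hw₀) hi
  set E₁ : Fin (2 ^ m - 1) → ZMod 2 :=
    fun i => flatMajority (maximalSequence m) (m / 2) (w₁ + A.mulVec w₀) i with hE₁
  set p₂ := tab 10 11 0 (majorityExpr 9 3) with hp₂
  set σ₂ := p₂.den σ₁ with hσ₂
  have h₂ : IsSetup m σ₂ := h₁.den _ (by decide) (by decide)
  have e₂ : ∀ n, n ≠ 10 → σ₂.arr n = σ₁.arr n := fun n hn => den_arr _ (by simpa [hp₂] using hn) _
  have v₂ : ∀ i : Fin (2 ^ m - 1), σ₂.arr 10 i = (E₁ i).val := by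
    refine h₁.den_tab (by norm_num) (by norm_num) _ fun i σ hσ ha hi _ => ?_
    exact eval_majorityExpr hσ (by simpa [ha 2, e₁ 2] using hS) (by simpa [ha 9] using v₁) hσ.reg3
      (by omega) (by norm_num) (by norm_num) (by norm_num) hi
  set V : Fin (2 ^ m - 1) → ZMod 2 := fun i => (w₁ + A.mulVec w₀) i + E₁ i with hV
  set p₃ := tab 11 11 0 (.xor (.get 9 (.var 11)) (.get 10 (.var 11))) with hp₃
  set σ₃ := p₃.den σ₂ with hσ₃
  have h₃ : IsSetup m σ₃ := h₂.den _ (by decide) (by decide)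
  have e₃ : ∀ n, n ≠ 11 → σ₃.arr n = σ₂.arr n := fun n hn => den_arr _ (by simpa [hp₃] using hn) _
  have v₃ : ∀ i : Fin (2 ^ m - 1), σ₃.arr 11 i = (V i).val := by
    refine h₂.den_tab (by norm_num) (by norm_num) _ fun i σ hσ ha hi _ => eval_xor _ ?_ ?_
    · simp only [eval_get, eval_var, hi, ha 9 (by norm_num), e₂ 9 (by norm_num), v₁]
    · simp only [eval_get, eval_var, hi, ha 10 (by norm_num), v₂]
  -- The recurrence makes sense for every corrected syndrome, whether or not the first vote found
  -- the true errors.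
  set U : ℕ → ZMod 2 := quotientSeq (extendWord V) (extendWord (maximalColumn hm)) with hU
  set p₄ := tab 12 11 0 (.xor (.get 11 (.var 11)) (.parity 20 (.and (.lt (.var 20) (.var 11))
    (.and (.get 12 (.var 20)) (.get 8 (.sub (.var 11) (.var 20))))))) with hp₄
  set σ₄ := p₄.den σ₃ with hσ₄
  have h₄ : IsSetup m σ₄ := h₃.den _ (by decide) (by decide)
  have e₄ : ∀ n, n ≠ 12 → σ₄.arr n = σ₃.arr n := fun n hn => den_arr _ (by simpa [hp₄] using hn) _
  have a₃ : ∀ i : Fin (2 ^ m - 1), σ₃.arr 8 i = (maximalColumn hm i).val := by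
    intro i
    rw [e₃ 8 (by norm_num), e₂ 8 (by norm_num), e₁ 8 (by norm_num), h8]
  have v₄ : ∀ i : Fin (2 ^ m - 1), σ₄.arr 12 i = (U i).val := by
    refine h₃.den_tab (by norm_num) (by norm_num) (fun i => (U i).val) fun i σ hσ ha hi hlt => ?_
    rw [hU, quotientSeq_eq, ← hU, extendWord_val]
    refine eval_xor _ ?_ ?_
    · simp only [eval_get, eval_var, hi, ha 11 (by norm_num), v₃]
    · have hik := i.2
      have hσ1 := hσ.reg1
      refine eval_parity_eq σ i _ (by omega) fun j _ => ?_
      simp only [holds_and, holds_lt, holds_get, eval_sub, eval_var, reg_setReg, arr_setReg]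
      simp only [if_true, show (11 : ℕ) ≠ 20 by norm_num, if_false, hi]
      refine and_congr_right fun hj => ?_
      have h1 := hlt ⟨j, by omega⟩ hj
      have h2 := a₃ ⟨i - j, by omega⟩
      simp only at h1 h2
      rw [h1, ha 8 (by norm_num), h2, ← extendWord_val (maximalColumn hm)]
      simp [ZMod.val_eq_zero]
  set p₅ := tab 13 11 0 (.get 12 oppositeExpr) with hp₅
  set σ₅ := p₅.den σ₄ with hσ₅
  have h₅ : IsSetup m σ₅ := h₄.den _ (by decide) (by decide)
  have e₅ : ∀ n, n ≠ 13 → σ₅.arr n = σ₄.arr n := fun n hn => den_arr _ (by simpa [hp₅] using hn) _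
  have v₅ : ∀ i : Fin (2 ^ m - 1), σ₅.arr 13 i =
      ((fun q : Fin (2 ^ m - 1) => U ((-q : Fin (2 ^ m - 1)) : ℕ)) i).val := by
    refine h₄.den_tab (by norm_num) (by norm_num) _ fun i σ hσ ha hi _ => ?_
    rw [eval_get, eval_oppositeExpr hσ hi, ha 12 (by norm_num), v₄]
  set E₀ : Fin (2 ^ m - 1) → ZMod 2 := fun i => flatMajority (maximalSequence m) (m - m / 2 - 1)
    (fun q : Fin (2 ^ m - 1) => U ((-q : Fin (2 ^ m - 1)) : ℕ)) i with hE₀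
  set p₆ := tab 14 11 0 (majorityExpr 13 8) with hp₆
  set σ₆ := p₆.den σ₅ with hσ₆
  have h₆ : IsSetup m σ₆ := h₅.den _ (by decide) (by decide)
  have e₆ : ∀ n, n ≠ 14 → σ₆.arr n = σ₅.arr n := fun n hn => den_arr _ (by simpa [hp₆] using hn) _
  have e₆' : ∀ n, n < 9 → σ₆.arr n = s.arr n := by
    intro n hn
    rw [e₆ n (by omega), e₅ n (by omega), e₄ n (by omega), e₃ n (by omega), e₂ n (by omega),
      e₁ n (by omega)]
  have v₆ : ∀ i : Fin (2 ^ m - 1), σ₆.arr 14 i = (E₀ i).val := by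
    refine h₅.den_tab (by norm_num) (by norm_num) _ fun i σ hσ ha hi _ => ?_
    exact eval_majorityExpr hσ (by simpa [ha 2, ← e₆ 2, e₆' 2] using hS)
      (by simpa [ha 13] using v₅) hσ.reg8 (by omega) (by norm_num) (by norm_num) (by norm_num) hi
  set u : Fin (2 ^ m - 1) → ZMod 2 := fun i => w₀ i + E₀ (-i) with hu
  set p₇ := tab 15 11 0 (.xor (.get 0 (.var 11)) (.get 14 oppositeExpr)) with hp₇
  set σ₇ := p₇.den σ₆ with hσ₇
  have h₇ : IsSetup m σ₇ := h₆.den _ (by decide) (by decide)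
  have e₇ : ∀ n, n ≠ 15 → σ₇.arr n = σ₆.arr n := fun n hn => den_arr _ (by simpa [hp₇] using hn) _
  have v₇ : ∀ i : Fin (2 ^ m - 1), σ₇.arr 15 i = (u i).val := by
    refine h₆.den_tab (by norm_num) (by norm_num) _ fun i σ hσ ha hi _ => eval_xor _ ?_ ?_
    · rw [eval_get, eval_var, hi, ha 0 (by norm_num), e₆' 0 (by norm_num), hw₀]
    · rw [eval_get, eval_oppositeExpr hσ hi, ha 14 (by norm_num), v₆]
  set p₈ := tab 16 11 0 (circulantExpr 15) with hp₈
  have v₈ : ∀ i : Fin (2 ^ m - 1), (p₈.den σ₇).arr 16 i = (A.mulVec u i).val := by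
    refine h₇.den_tab (by norm_num) (by norm_num) _ fun i σ hσ ha hi _ => ?_
    exact eval_circulantExpr hσ (by simpa [ha 8, e₇ 8, e₆' 8] using h8)
      (by simpa [ha 15] using v₇) hi
  refine ⟨u, fun c hc hd => ?_, fun i => ?_, v₈⟩
  · obtain ⟨x, rfl⟩ := mem_doubleCirculantCode.1 hc
    rw [hammingDist_sumElim] at hd
    have hux : u = x := (isMSequence_maximalSequence hm).decode_eq hm (w₀ := w₀) (w₁ := w₁)
      (e₁ := E₁) (e₀ := E₀) (V := extendWord V) (u := U) (a := extendWord (maximalColumn hm))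
      (fun _ => rfl) (extendWord_val _) (extendWord_val V) (fun n _ => quotientSeq_eq _ _ n)
      (fun _ => rfl) (by
        rw [hammingNorm_add_of_two, hammingNorm_add_of_two]
        exact hd)
    rw [hux]
  · rw [← v₇ i, ← den_arr p₈ (n := 15) (by simp [hp₈]) σ₇]
    rfl

/-- The candidate is a codeword in every case, and it is the only one that can be near. Comparing it
with the received word therefore decides both alternatives. -/
theorem den_decodeProg {m : ℕ} (hm : 1 ≤ m) {s : RamState} (h0 : s.reg 0 = 2 ^ m - 1)
    (h1 : s.reg 1 = 3 * (2 ^ m - 1) + 3)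
    {w : Fin (2 ^ m - 1) ⊕ Fin (2 ^ m - 1) → ZMod 2} (hw : ∀ i, s.arr 0 (coordPos i) = (w i).val) :
    (∀ c ∈ doubleCirculantCode (maximalColumn hm), hammingDist w c ≤ errorRadius m →
      (decodeProg.den s).reg 0 = 1 ∧ ∀ i, (decodeProg.den s).arr 0 (coordPos i) = (c i).val) ∧
    ((¬ ∃ c ∈ doubleCirculantCode (maximalColumn hm), hammingDist w c ≤ errorRadius m) →
      (decodeProg.den s).reg 0 = 0) := by
  obtain ⟨h, hS, h8⟩ := den_prepare hm h0 h1
  have hw' : ∀ i, (prepare.den s).arr 0 (coordPos i) = (w i).val := by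
    rw [den_arr prepare rfl]
    exact hw
  obtain ⟨u, hu, h15, h16⟩ := den_nearestProg hm h hS h8 hw'
  have h₂ : IsSetup m (nearestProg.den (prepare.den s)) := h.den _ (by decide) (by decide)
  have hw₂ : ∀ i, (nearestProg.den (prepare.den s)).arr 0 (coordPos i) = (w i).val := by
    rw [den_arr nearestProg rfl]
    exact hw'
  set σ := nearestProg.den (prepare.den s) with hσ
  set c := Sum.elim u ((Matrix.circulant (maximalColumn hm)).mulVec u) with hc
  have hN := h₂.reg1
  have h6 : (acceptProg.den σ).reg 6 = if hammingDist w c ≤ errorRadius m then 1 else 0 := by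
    have hcmp : ∀ {x y : ZMod 2}, x.val = y.val ↔ x = y := (ZMod.val_injective 2).eq_iff
    -- Register 8 holds m - ⌊m/2⌋ - 1, so the cell of array 1 that is read holds the radius plus
    -- one. The strict comparison thus means distance at most the radius.
    have hrad : errorRadius m = 2 ^ (m - m / 2 - 1 - 1) - 1 := rfl
    have hpow := Nat.one_le_two_pow (n := m - m / 2 - 1 - 1)
    have hmk := self_le_two_pow_sub_one m
    rw [acceptProg, den, reg_setReg, if_pos rfl, eval_lt, eval_add,
      eval_count_fin σ (fun i => (w ∘ Sum.inl) i ≠ u i) (by omega) (fun i => ?_) fun i hi => ?_,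
      eval_count_fin σ (fun i => (w ∘ Sum.inr) i ≠
        (Matrix.circulant (maximalColumn hm)).mulVec u i) (by omega) (fun i => ?_) fun i hi => ?_]
    · rw [eval_get, eval_sub, eval_var, eval_lit, h₂.reg8, h₂.pow _ (by omega), hc,
        hammingDist_sumElim, hrad]
      refine if_congr ?_ rfl rfl
      simp only [hammingDist]
      omega
    · have := hw₂ (.inr i)
      simp only [coordPos] at this
      simp [h₂.reg0, h16, this, hcmp]
    · simp [h₂.reg0, hi]
    · have := hw₂ (.inl i)
      simp only [coordPos] at this
      simp [h₂.reg0, h15, this, hcmp]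
    · simp [h₂.reg0, hi]
  have h₃ : IsSetup m (acceptProg.den σ) := h₂.den _ (by decide) (by decide)
  have hreg : (decodeProg.den s).reg 0 = if hammingDist w c ≤ errorRadius m then 1 else 0 := by
    rw [← h6, ← den_reg (tab 0 11 7 (.cond (.lt (.var 11) (.var 0)) (.get 15 (.var 11))
      (.get 16 (.sub (.var 11) (.var 0))))) rfl (acceptProg.den σ)]
    rfl
  have hout : ∀ i, (decodeProg.den s).arr 0 (coordPos i) = (c i).val := by
    intro i
    have hi : coordPos i < 2 * (2 ^ m - 1) := by
      rcases i with i | i <;> have := i.2 <;> simp only [coordPos] <;> omega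
    have hN3 := h₃.reg1
    have key := BProg.den_tab (n := 0) (x := 11) (b := 7) (s := acceptProg.den σ)
      (e := .cond (.lt (.var 11) (.var 0)) (.get 15 (.var 11))
        (.get 16 (.sub (.var 11) (.var 0)))) (by norm_num)
      (fun i => if i < 2 ^ m - 1 then σ.arr 15 i else σ.arr 16 (i - (2 ^ m - 1))) (by
        intro i _ _ τ hr ha _ _
        have hr0 : τ.reg 0 = 2 ^ m - 1 := (hr 0 (by norm_num)).trans h₃.reg0
        have ha15 : τ.arr 15 = σ.arr 15 := ha 15 (by norm_num)
        have ha16 : τ.arr 16 = σ.arr 16 := ha 16 (by norm_num)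
        simp [hr0, ha15, ha16])
      (i := coordPos i) (by omega) (by rw [h₃.reg7]; exact hi)
    refine Eq.trans ?_ (key.trans ?_)
    · rfl
    rcases i with i | i
    · rw [coordPos, if_pos i.2, h15, hc, Sum.elim_inl]
    · rw [coordPos, if_neg (by omega), Nat.add_sub_cancel_left, h16, hc, Sum.elim_inr]
  refine ⟨fun c' hc' hd => ?_, fun hne => ?_⟩
  · have hcc := hu c' hc' hd
    rw [hcc] at hd ⊢
    exact ⟨by rw [hreg, if_pos hd], hout⟩
  · rw [hreg, if_neg]
    exact fun hd => hne ⟨c, mem_doubleCirculantCode.2 ⟨u, rfl⟩, hd⟩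

end DoubleCirculant

/-! ### Running times and the theorem. -/

namespace DoubleCirculant

/-- The machine program for a program of the abstract language; the bound for the loops is
`3k + 3`. -/
def machine (p : BProg) : RamProg :=
  .seq (.assign 1 (.add (.var 0) (.add (.var 0) (.add (.var 0) (.lit 3))))) (p.compile 30)

/-- A bound for the running time of `machine p`. -/
noncomputable def machineCost (p : BProg) : ℕ[X] := p.cost.comp (3 * X + 3) + 8

/-- The abstract programs use registers below 30, so the work space starts there. The loop bound N =
3k + 3 is written first, and substituting it into the cost keeps the bound polynomial in k. -/
theorem exec_machine (p : BProg) (hp : p.Ok 30) {k : ℕ} {s : RamState} (hs : s.reg 0 = k) :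
    ∃ s' t, RamExec (machine p) s s' t ∧ t ≤ (machineCost p).eval k ∧
      AgreeBelow 30 s' (p.den (s.setReg 1 (3 * k + 3))) := by
  have hv : RamExpr.eval s (.add (.var 0) (.add (.var 0) (.add (.var 0) (.lit 3)))) =
      3 * k + 3 := by
    simp only [RamExpr.eval, hs]
    omega
  obtain ⟨s', t, hE, ht, ha⟩ := BProg.exec_compile (by norm_num) p hp
    (AgreeBelow.refl (d := 30) (s.setReg 1 (3 * k + 3)))
  refine ⟨s', _, .seq (.assign _ _ _) (by rw [hv]; exact hE), ?_, ha⟩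
  simp only [reg_setReg, if_true] at ht
  simp [machineCost, RamExpr.cost]
  omega

theorem constructs_machine {m : ℕ} (hm : 1 ≤ m) :
    Constructs (machine constructProg) (doubleCirculantMatrix (maximalColumn hm))
      ((machineCost constructProg).eval (2 ^ m - 1)) := by
  obtain ⟨s', t, hE, ht, ha⟩ := exec_machine constructProg (by decide) (k := 2 ^ m - 1)
    (s := constructInput (2 ^ m - 1)) rfl
  refine ⟨s', t, hE, ht, fun i j => ?_⟩
  rw [ha.2]
  exact den_constructProg hm rfl rfl i j

theorem decodesHalf_machine {m : ℕ} (hm : 1 ≤ m) :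
    DecodesHalf (machine decodeProg) (doubleCirculantCode (maximalColumn hm)) (designDistance m)
      ((machineCost decodeProg).eval (2 ^ m - 1)) := by
  intro w
  obtain ⟨s', t, hE, ht, ha⟩ := exec_machine decodeProg (by decide) (k := 2 ^ m - 1)
    (s := decodeInput w) rfl
  have hw : ∀ i, ((decodeInput w).setReg 1 (3 * (2 ^ m - 1) + 3)).arr 0 (coordPos i) =
      (w i).val := by
    rintro (i | i) <;> simp [decodeInput, coordPos]
  obtain ⟨h1, h2⟩ := den_decodeProg hm (s := (decodeInput w).setReg 1 (3 * (2 ^ m - 1) + 3))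
    rfl rfl hw
  -- The designed distance 2t + 1 is odd, so half of it allows exactly t errors.
  have hd : ∀ c, 2 * hammingDist w c ≤ designDistance m ↔ hammingDist w c ≤ errorRadius m := by
    intro c
    rw [designDistance]
    omega
  simp only [hd]
  exact ⟨s', t, hE, ht, by simpa [ha.1 0 (by norm_num), ha.2] using h1,
    by simpa [ha.1 0 (by norm_num)] using h2⟩

end DoubleCirculant

open DoubleCirculant

theorem mainTheorem6 :
    ∃ (a : (m : ℕ) → Fin (2 ^ m - 1) → ZMod 2) (d : ℕ → ℕ) (ε : ℝ)
      (construct decode : RamProg) (P : Polynomial ℕ),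
      0 < ε ∧
      ∀ m : ℕ, 1 ≤ m →
        IsDualRMColumn m (a m) ∧
        ε * Real.sqrt ((2 ^ m - 1 : ℕ) : ℝ) ≤ (d m : ℝ) ∧
        HasDistanceAtLeast (doubleCirculantCode (a m)) (d m) ∧
        IsTwoBalanced (doubleCirculantCode (a m)) (d m) ∧
        Constructs construct (doubleCirculantMatrix (a m)) (P.eval (2 ^ m - 1)) ∧
        DecodesHalf decode (doubleCirculantCode (a m)) (d m) (P.eval (2 ^ m - 1)) := by
  -- The column at m = 0 is a filler. The sum of the two cost polynomials bounds each of them since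
  -- the coefficients are natural numbers.
  refine ⟨fun m => if hm : 1 ≤ m then maximalColumn hm else 0, designDistance, 1 / 4,
    machine constructProg, machine decodeProg, machineCost constructProg + machineCost decodeProg,
    by norm_num, fun m hm => ?_⟩
  have hm2 : 2 ≤ 2 ^ m := Nat.pow_le_pow_right (n := 2) (by norm_num) hm
  have : NeZero (2 ^ m - 1) := ⟨by omega⟩
  have hs := isMSequence_maximalSequence hm
  have hb : IsTwoBalanced (doubleCirculantCode (maximalColumn hm)) (designDistance m) :=
    hs.isTwoBalanced hm
  simp only [dif_pos hm, eval_add]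
  refine ⟨IsMSequence.isDualRMColumn_column hm hs, sqrt_le_designDistance m, hb.hasDistanceAtLeast,
    hb, ?_, ?_⟩
  · obtain ⟨s', t, hE, ht, h⟩ := constructs_machine hm
    exact ⟨s', t, hE, ht.trans (Nat.le_add_right _ _), h⟩
  · intro w
    obtain ⟨s', t, hE, ht, h⟩ := decodesHalf_machine hm w
    exact ⟨s', t, hE, ht.trans (Nat.le_add_left _ _), h⟩
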